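/- Let $d\ge 2$ be an integer, let $E\subset(0,\infty)$ be an arbitrary set, and let $1\le p<\frac{d}{d-1}$ and $p\le q<\infty$. Let $\sigma$ be the rotationally invariant probability measure on $S^{d-1}$, and for $f\in L^p(\mathbb R^d)$ put $$A_tf(x)=\int_{S^{d-1}}f(x-ty)\,d\sigma(y),\qquad \mathcal M_Ef(x)=\sup_{t\in E}|A_tf(x)|,$$ where $|A_tf(x)|:=\infty$ if the integral does not converge absolutely (and $\sup\emptyset=0$). For $k\in\mathbb Z$ let $E^k=E\cap[2^k,2^{k+1}]$, and for $a>0$ let $N(E^k,a)$ be the minimal number of compact intervals of length $a$ needed to cover $E^k$. Let $$\|g\|_{L^{p,q}(\mathbb R^d)}=\Big(\frac qp\int_0^\infty\big[t^{1/p}g^*(t)\big]^q\,\frac{dt}{t}\Big)^{1/q},\qquad g^*(t)=\inf\{\alpha\ge0:\ |\{x\in\mathbb R^d:|g(x)|>\alpha\}|\le t\},$$ be the Lorentz quasinorm, where $|\cdot|$ is Lebesgue (outer) measure on $\mathbb R^d$, and let $\frac1{p'}=1-\frac1p$. A function $f$ is called radial if $f(x)$ depends only on $|x|$. Then there is a constant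 $C<\infty$ such that $$\|\mathcal M_Ef\|_{L^{p,q}(\mathbb R^d)}\le C\,\|f\|_{L^p(\mathbb R^d)}\qquad\text{for all radial } f\in L^p(\mathbb R^d)$$ if and only if $$\sup_{j\in\mathbb Z}\Big(\sum_{n=0}^\infty \big[N(E^{j+n},2^j)\big]^{q/p}\,2^{-n(d-1)q/p'}\Big)^{1/q}<\infty .$$ -/

import Mathlib

open MeasureTheory Set
open scoped ENNReal NNReal

namespace SphericalMaximal

/-- The rotationally invariant measure on the unit sphere of `ℝ^d`, normalized to total mass `1`. -/
noncomputable def sphereMeasure (d : ℕ) :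
    Measure (Metric.sphere (0 : EuclideanSpace ℝ (Fin d)) 1) :=
  ((volume : Measure (EuclideanSpace ℝ (Fin d))).toSphere univ)⁻¹ •
    (volume : Measure (EuclideanSpace ℝ (Fin d))).toSphere

/-- The spherical mean `A_t f(x) = ∫ f(x - t y) dσ(y)`. -/
noncomputable def sphericalMean {d : ℕ} (t : ℝ) (f : EuclideanSpace ℝ (Fin d) → ℂ)
    (x : EuclideanSpace ℝ (Fin d)) : ℂ :=
  ∫ y, f (x - t • (y : EuclideanSpace ℝ (Fin d))) ∂(sphereMeasure d)

open Classical in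
/-- `|A_t f(x)|` as an extended nonnegative number. If the integral defining `A_t f(x)` does not
converge absolutely the value is `∞`, rather than the default value of the integral. -/
noncomputable def absSphericalMean {d : ℕ} (t : ℝ) (f : EuclideanSpace ℝ (Fin d) → ℂ)
    (x : EuclideanSpace ℝ (Fin d)) : ℝ≥0∞ :=
  if Integrable (fun y : Metric.sphere (0 : EuclideanSpace ℝ (Fin d)) 1 =>
      f (x - t • (y : EuclideanSpace ℝ (Fin d)))) (sphereMeasure d)
  then ‖sphericalMean t f x‖ₑ else ∞

/-- The maximal function `M_E f(x) = sup_{t ∈ E} |A_t f(x)|`. -/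
noncomputable def maximalFunction {d : ℕ} (E : Set ℝ) (f : EuclideanSpace ℝ (Fin d) → ℂ)
    (x : EuclideanSpace ℝ (Fin d)) : ℝ≥0∞ :=
  ⨆ t ∈ E, absSphericalMean t f x

/-- `f(x)` depends only on `|x|`. -/
def IsRadial {d : ℕ} (f : EuclideanSpace ℝ (Fin d) → ℂ) : Prop :=
  ∀ x y, ‖x‖ = ‖y‖ → f x = f y

/-- The nonincreasing rearrangement `g^*(t) = inf {α : μ {g > α} ≤ t}` of a nonnegative function.
If `g` is not measurable, `μ` is the outer measure. -/
noncomputable def rearrangement {X : Type*} [MeasurableSpace X] (μ : Measure X) (g : X → ℝ≥0∞)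
    (t : ℝ) : ℝ≥0∞ :=
  sInf {α : ℝ≥0∞ | μ {x | α < g x} ≤ ENNReal.ofReal t}

/-- The Lorentz quasinorm `((q/p) ∫_0^∞ [t^{1/p} g^*(t)]^q dt/t)^{1/q}`, for `0 < p, q < ∞`. -/
noncomputable def lorentzNorm {X : Type*} [MeasurableSpace X] (μ : Measure X) (p q : ℝ)
    (g : X → ℝ≥0∞) : ℝ≥0∞ :=
  (ENNReal.ofReal (q / p) * ∫⁻ t in Ioi (0 : ℝ),
    (ENNReal.ofReal (t ^ (1 / p)) * rearrangement μ g t) ^ q * ENNReal.ofReal t⁻¹) ^ (1 / q)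

/-- The entropy number `N(S, a)`: the minimal number of compact intervals of length `a` needed
to cover `S` (a finite number whenever `S` is bounded and `a > 0`). -/
noncomputable def entropyNumber (S : Set ℝ) (a : ℝ) : ℕ :=
  sInf {n : ℕ | ∃ s : Finset ℝ, s.card = n ∧ S ⊆ ⋃ c ∈ s, Icc c (c + a)}

/-- `E^k = E ∩ [2^k, 2^{k+1}]`. -/
def dyadicPart (E : Set ℝ) (k : ℤ) : Set ℝ :=
  Icc ((2 : ℝ) ^ k) ((2 : ℝ) ^ (k + 1)) ∩ E

/-- `sup_j (∑_{n ≥ 0} N(E^{j+n}, 2^j)^{q/p} 2^{-n(d-1)q/p'})^{1/q}` with `1/p' = 1 - 1/p`. -/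
noncomputable def entropySup (d : ℕ) (p q : ℝ) (E : Set ℝ) : ℝ≥0∞ :=
  ⨆ j : ℤ, (∑' n : ℕ, ENNReal.ofReal
    ((entropyNumber (dyadicPart E (j + n)) ((2 : ℝ) ^ j) : ℝ) ^ (q / p) *
      (2 : ℝ) ^ (-((n : ℝ) * ((d : ℝ) - 1) * q * (1 - 1 / p))))) ^ (1 / q)

end SphericalMaximal

namespace SphericalMaximal

/-! ### The Lorentz quasinorm in terms of the distribution function -/

/-! Write `k = d - 2`. The `q`-th power of the Lorentz quasinorm is `q ∫ α^{q-1} |{g > α}|^{q/p} dα`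
(`lorentzNorm_eq`). For `p ≤ q` its `p`-th power is, up to a constant, countably subadditive under
suprema, by Minkowski in `L^{q/p}` (`levelIntegral_rpow_le_tsum`). For indicators whose heights
decay geometrically, `levelIntegral_le_of_geometric` does better: it adds `q`-th powers instead of
`p`-th powers. That `ℓ^q` sum is the one in the entropy condition.

Necessity (`exists_entropyBound`): test on the indicator of the ball of radius `3 · 2^j`. If `t ∈
E^{j+n}` and `||x| - t| ≤ 2^j`, the mean is at least about `2^{-n(d-1)}`, and such `x` fill a set of
measure at least about `2^{(j+n)(d-1)} N(E^{j+n}, 2^j) 2^j`. Integrating the distribution function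
between consecutive heights recovers the series.

Sufficiency for `p > 1`: with `r = |x|`, the mean is dominated by an integral of the profile of
`|f|` over `|r-t| < s < r+t` against an explicit kernel (`lintegral_sphere_le`), unbounded at the
endpoints only when `d = 2`. Decompose dyadically around the endpoints. Wherever a sum over scales
has decay to spare, a little of it turns the sum into a supremum, so the maximal function is
dominated by a supremum of multiples of indicators. The sets consist of `x` for which a dyadic point
`b` is close to `±(r-t)` or `r+t` for some `t ∈ E^m`, and entropy numbers control their measure. The
heights are integrals of the profile over dyadic intervals, and the sum of their `p`-th powers is
controlled by the `L^p` norm. The assumption `p < d/(d-1)` is what leaves decay over scales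
(`decay_pos`).

Four regions occur. If `s < t/4` (two regions, `levelIntegral_far_le` and `levelIntegral_near_le`),
then `|r-t| < t/4`, the same `s` is reached from all larger dyadic sizes of `t`, and the full series
is needed (`levelIntegral_nearSet_le`). If `s ≥ t/4`, the bound for a single entropy number
suffices. For `r ≤ 8t` one sums over the ratio of `t` to `min r t` (`levelIntegral_comparable_le`).
For `r > 8t` there is no decay in `t/r`; the supremum over `t` is handled by maximal dyadic
intervals, as in the Hardy–Littlewood theorem, and this needs `p > 1` (`levelIntegral_outer_le`).

For `p = 1` the weights in the condition disappear, so `E` must be finite (`EntropyBound.finite`),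
and each single mean is bounded on `L^1`, which embeds in `L^{1,q}`. -/

theorem lintegral_Ioi_rpow_sub_one_eq_top (s : ℝ) :
    ∫⁻ α in Ioi (0 : ℝ), ENNReal.ofReal (α ^ (s - 1)) = ∞ := by
  by_contra h
  refine not_integrableOn_Ioi_rpow (s - 1) ⟨?_, ?_⟩
  · exact (measurable_id.pow_const _).aestronglyMeasurable
  · rw [hasFiniteIntegral_iff_ofReal]
    · exact lt_of_le_of_ne le_top h
    · exact (ae_restrict_mem measurableSet_Ioi).mono fun x hx => Real.rpow_nonneg (le_of_lt hx) _

theorem lintegral_Ioo_rpow_sub_one {s b : ℝ} (hs : 0 < s) (hb : 0 ≤ b) :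
    ∫⁻ α in Ioo (0 : ℝ) b, ENNReal.ofReal (α ^ (s - 1)) = ENNReal.ofReal (b ^ s / s) := by
  rw [Measure.restrict_congr_set Ioo_ae_eq_Ioc, ← ofReal_integral_eq_lintegral_ofReal,
    ← intervalIntegral.integral_of_le hb, integral_rpow (Or.inl (by linarith))]
  · congr 1
    rw [sub_add_cancel, Real.zero_rpow hs.ne', sub_zero]
  · exact (intervalIntegral.intervalIntegrable_rpow' (by linarith)).1
  · exact (ae_restrict_mem measurableSet_Ioc).mono fun x hx => Real.rpow_nonneg hx.1.le _

theorem lintegral_rpow_sub_one_lt {s : ℝ} (hs : 0 < s) (y : ℝ≥0∞) :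
    ∫⁻ α in Ioi (0 : ℝ), {α : ℝ | ENNReal.ofReal α < y}.indicator
      (fun α => ENNReal.ofReal (α ^ (s - 1))) α = y ^ s / ENNReal.ofReal s := by
  have hm : MeasurableSet {α : ℝ | ENNReal.ofReal α < y} :=
    measurableSet_lt ENNReal.measurable_ofReal measurable_const
  rw [lintegral_indicator hm, Measure.restrict_restrict hm]
  induction y with
  | top =>
    have : {α : ℝ | ENNReal.ofReal α < ∞} ∩ Ioi 0 = Ioi 0 := by ext; simp
    rw [this, lintegral_Ioi_rpow_sub_one_eq_top s, ENNReal.top_rpow_of_pos hs,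
      ENNReal.top_div_of_ne_top ENNReal.ofReal_ne_top]
  | coe b =>
    have : {α : ℝ | ENNReal.ofReal α < b} ∩ Ioi 0 = Ioo 0 (b : ℝ) := by
      ext α
      simp only [mem_inter_iff, mem_ofPred_eq, mem_Ioi, mem_Ioo]
      refine ⟨fun h => ⟨h.2, ?_⟩, fun h => ⟨?_, h.1⟩⟩
      · have := (ENNReal.ofReal_lt_iff_lt_toReal h.2.le ENNReal.coe_ne_top).1 h.1
        simpa using this
      · exact (ENNReal.ofReal_lt_iff_lt_toReal h.1.le ENNReal.coe_ne_top).2 (by simpa using h.2)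
    rw [this]
    refine (lintegral_Ioo_rpow_sub_one hs b.coe_nonneg).trans ?_
    rw [ENNReal.ofReal_div_of_pos hs,
      ← ENNReal.ofReal_rpow_of_nonneg b.coe_nonneg hs.le, ENNReal.ofReal_coe_nnreal]

theorem lintegral_rpow_sub_one_le {s : ℝ} (hs : 0 < s) (y : ℝ≥0∞) :
    ∫⁻ α in Ioi (0 : ℝ), {α : ℝ | ENNReal.ofReal α ≤ y}.indicator
      (fun α => ENNReal.ofReal (α ^ (s - 1))) α = y ^ s / ENNReal.ofReal s := by
  rw [← lintegral_rpow_sub_one_lt hs]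
  refine setLIntegral_congr_fun_ae measurableSet_Ioi ?_
  have : ∀ᵐ α : ℝ, α ≠ y.toReal := by
    simp [ae_iff]
  filter_upwards [this] with α hα h0
  simp only [indicator, mem_ofPred_eq]
  have : ENNReal.ofReal α ≤ y ↔ ENNReal.ofReal α < y := by
    refine ⟨fun h => lt_of_le_of_ne h fun h' => hα ?_, le_of_lt⟩
    rw [← h', ENNReal.toReal_ofReal (le_of_lt h0)]
  simp only [this]

variable {X : Type*} [MeasurableSpace X]

/-- `∫_0^∞ α^{q-1} μ{g > α}^{q/p} dα`. -/
noncomputable def levelIntegral (μ : Measure X) (p q : ℝ) (g : X → ℝ≥0∞) : ℝ≥0∞ :=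
  ∫⁻ α in Ioi (0 : ℝ), ENNReal.ofReal (α ^ (q - 1)) * μ {x | ENNReal.ofReal α < g x} ^ (q / p)

theorem rearrangement_antitone (μ : Measure X) (g : X → ℝ≥0∞) : Antitone (rearrangement μ g) := by
  intro s t hst
  exact sInf_le_sInf fun α hα => le_trans (mem_ofPred.1 hα) (ENNReal.ofReal_le_ofReal hst)

theorem lt_measure_of_lt_rearrangement {μ : Measure X} {g : X → ℝ≥0∞} {t α : ℝ}
    (h : ENNReal.ofReal α < rearrangement μ g t) :
    ENNReal.ofReal t < μ {x | ENNReal.ofReal α < g x} := by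
  by_contra! h'
  exact absurd h (not_lt.2 (sInf_le h'))

theorem le_rearrangement_of_lt_measure {μ : Measure X} {g : X → ℝ≥0∞} {t α : ℝ}
    (h : ENNReal.ofReal t < μ {x | ENNReal.ofReal α < g x}) :
    ENNReal.ofReal α ≤ rearrangement μ g t := by
  refine le_sInf fun β hβ => ?_
  by_contra! h'
  rw [mem_ofPred_eq] at hβ
  refine absurd (h.trans_le ((measure_mono fun x hx => ?_).trans hβ)) (lt_irrefl _)
  rw [mem_ofPred_eq] at hx ⊢
  exact h'.trans hx

/-- Both sides are integrals of `t^{s-1} α^{q-1}` over essentially the same planar region, computed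
in the two orders. Only monotone functions of one variable are integrated, so `g` itself may be
nonmeasurable. -/
theorem lintegral_rearrangement (μ : Measure X) {s q : ℝ} (hs : 0 < s) (hq : 0 < q)
    (g : X → ℝ≥0∞) :
    (∫⁻ t in Ioi (0 : ℝ), ENNReal.ofReal (t ^ (s - 1)) * rearrangement μ g t ^ q) /
      ENNReal.ofReal q =
    (∫⁻ α in Ioi (0 : ℝ), ENNReal.ofReal (α ^ (q - 1)) *
      μ {x | ENNReal.ofReal α < g x} ^ s) / ENNReal.ofReal s := by
  have hmr : Measurable (rearrangement μ g) := (rearrangement_antitone μ g).measurable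
  have hmd : Measurable fun α : ℝ => μ {x | ENNReal.ofReal α < g x} := by
    refine Antitone.measurable fun a b hab => measure_mono fun x hx => ?_
    rw [mem_ofPred_eq] at hx ⊢
    exact (ENNReal.ofReal_le_ofReal hab).trans_lt hx
  have hw : ∀ a : ℝ, Measurable fun α : ℝ => ENNReal.ofReal (α ^ (a - 1)) := fun a =>
    (measurable_id.pow_const _).ennreal_ofReal
  have hmeas : ∀ S : Set (ℝ × ℝ), MeasurableSet S → Measurable (fun z : ℝ × ℝ =>
      ENNReal.ofReal (z.1 ^ (s - 1)) * ENNReal.ofReal (z.2 ^ (q - 1)) * S.indicator 1 z) :=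
    fun S hS => (((hw s).comp measurable_fst).mul ((hw q).comp measurable_snd)).mul
      (measurable_one.indicator hS)
  -- The region below the distribution function lies between the strict and the closed region below
  -- the rearrangement. The region is therefore left open here: both variants have slices with the
  -- same integral.
  have key1 : ∀ (S : Set (ℝ × ℝ)), MeasurableSet S →
      (∀ t, ∫⁻ α in Ioi (0 : ℝ), {α : ℝ | (t, α) ∈ S}.indicator
        (fun α => ENNReal.ofReal (α ^ (q - 1))) α = rearrangement μ g t ^ q / ENNReal.ofReal q) →
      (∫⁻ t in Ioi (0 : ℝ), ENNReal.ofReal (t ^ (s - 1)) * rearrangement μ g t ^ q) /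
      ENNReal.ofReal q = ∫⁻ t in Ioi (0 : ℝ), ∫⁻ α in Ioi (0 : ℝ),
        ENNReal.ofReal (t ^ (s - 1)) * ENNReal.ofReal (α ^ (q - 1)) * S.indicator 1 (t, α) := by
    intro S hS h
    rw [ENNReal.div_eq_inv_mul, ← lintegral_const_mul _ (by exact (hw s).mul (hmr.pow_const _))]
    congr 1 with t
    rw [mul_left_comm, ← ENNReal.div_eq_inv_mul, ← h t, ← lintegral_const_mul]
    · congr 1 with α
      simp [indicator]
    · exact (hw q).indicator (measurable_prodMk_left hS)
  have key2 : (∫⁻ α in Ioi (0 : ℝ), ENNReal.ofReal (α ^ (q - 1)) *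
      μ {x | ENNReal.ofReal α < g x} ^ s) / ENNReal.ofReal s =
      ∫⁻ t in Ioi (0 : ℝ), ∫⁻ α in Ioi (0 : ℝ),
        ENNReal.ofReal (t ^ (s - 1)) * ENNReal.ofReal (α ^ (q - 1)) *
        {z : ℝ × ℝ | ENNReal.ofReal z.1 < μ {x | ENNReal.ofReal z.2 < g x}}.indicator 1 (t, α) := by
    have hS : MeasurableSet {z : ℝ × ℝ | ENNReal.ofReal z.1 < μ {x | ENNReal.ofReal z.2 < g x}} :=
      measurableSet_lt measurable_fst.ennreal_ofReal (hmd.comp measurable_snd)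
    rw [lintegral_lintegral_swap (hmeas _ hS).aemeasurable,
      ENNReal.div_eq_inv_mul, ← lintegral_const_mul _ (by exact (hw q).mul (hmd.pow_const _))]
    congr 1 with α
    rw [mul_left_comm, ← ENNReal.div_eq_inv_mul, ← lintegral_rpow_sub_one_lt hs,
      ← lintegral_const_mul]
    · congr 1 with t
      simp only [indicator, mem_ofPred_eq, Pi.one_apply]
      split_ifs
      · rw [mul_one, mul_comm]
      · simp
    · exact (hw s).indicator (measurableSet_lt ENNReal.measurable_ofReal measurable_const)
  have hlt := key1 {z : ℝ × ℝ | ENNReal.ofReal z.2 < rearrangement μ g z.1}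
    (measurableSet_lt measurable_snd.ennreal_ofReal (hmr.comp measurable_fst))
    fun t => by simpa only [mem_ofPred_eq] using lintegral_rpow_sub_one_lt hq _
  have hle := key1 {z : ℝ × ℝ | ENNReal.ofReal z.2 ≤ rearrangement μ g z.1}
    (measurableSet_le measurable_snd.ennreal_ofReal (hmr.comp measurable_fst))
    fun t => by simpa only [mem_ofPred_eq] using lintegral_rpow_sub_one_le hq _
  apply le_antisymm
  · rw [hlt, key2]
    refine lintegral_mono fun t => lintegral_mono fun α => mul_le_mul' le_rfl ?_
    exact indicator_le_indicator_of_subset (fun z hz => lt_measure_of_lt_rearrangement hz)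
      (fun _ => zero_le) _
  · rw [hle, key2]
    refine lintegral_mono fun t => lintegral_mono fun α => mul_le_mul' le_rfl ?_
    exact indicator_le_indicator_of_subset (fun z hz => le_rearrangement_of_lt_measure hz)
      (fun _ => zero_le) _

theorem lorentzNorm_eq (μ : Measure X) {p q : ℝ} (hp : 0 < p) (hq : 0 < q) (g : X → ℝ≥0∞) :
    lorentzNorm μ p q g = (ENNReal.ofReal q * levelIntegral μ p q g) ^ (1 / q) := by
  have hs : 0 < q / p := div_pos hq hp
  have h := lintegral_rearrangement μ hs hq g
  have h1 : ∫⁻ t in Ioi (0 : ℝ), (ENNReal.ofReal (t ^ (1 / p)) * rearrangement μ g t) ^ q *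
      ENNReal.ofReal t⁻¹ =
      ∫⁻ t in Ioi (0 : ℝ), ENNReal.ofReal (t ^ (q / p - 1)) * rearrangement μ g t ^ q := by
    refine setLIntegral_congr_fun measurableSet_Ioi fun t (ht : 0 < t) => ?_
    rw [ENNReal.mul_rpow_of_nonneg _ _ hq.le, ENNReal.ofReal_rpow_of_pos (Real.rpow_pos_of_pos ht _),
      mul_right_comm, ← ENNReal.ofReal_mul (by positivity), ← Real.rpow_mul ht.le,
      Real.rpow_sub_one ht.ne', div_eq_mul_inv]
    congr 4
    ring
  have hs0 : ENNReal.ofReal (q / p) ≠ 0 := by simpa using hs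
  have hq0 : ENNReal.ofReal q ≠ 0 := by simpa using hq
  rw [lorentzNorm, levelIntegral, h1]
  congr 1
  rw [ENNReal.div_eq_div_iff hs0 ENNReal.ofReal_ne_top hq0 ENNReal.ofReal_ne_top] at h
  exact h

/-! ### Powers of two and geometric series -/

/-- `2^x` as an extended nonnegative number. -/
noncomputable def twoPow (x : ℝ) : ℝ≥0∞ := 2 ^ x

theorem twoPow_ne_zero (x : ℝ) : twoPow x ≠ 0 := by simp [twoPow]

theorem twoPow_ne_top (x : ℝ) : twoPow x ≠ ∞ := by simp [twoPow]

theorem twoPow_zero : twoPow 0 = 1 := by simp [twoPow]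

theorem twoPow_mul (x y : ℝ) : twoPow x * twoPow y = twoPow (x + y) :=
  (ENNReal.rpow_add x y (by simp) (by simp)).symm

theorem twoPow_rpow (x y : ℝ) : twoPow x ^ y = twoPow (x * y) :=
  (ENNReal.rpow_mul 2 x y).symm

theorem twoPow_mono {x y : ℝ} (h : x ≤ y) : twoPow x ≤ twoPow y :=
  ENNReal.rpow_le_rpow_of_exponent_le (by norm_num) h

theorem twoPow_eq_ofReal (x : ℝ) : twoPow x = ENNReal.ofReal (2 ^ x) := by
  rw [← ENNReal.ofReal_rpow_of_pos (by norm_num)]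
  simp [twoPow]

theorem twoPow_intCast (k : ℤ) : twoPow k = ENNReal.ofReal (2 ^ k) := by
  rw [twoPow_eq_ofReal, Real.rpow_intCast]

theorem twoPow_natCast_mul (n : ℕ) (x : ℝ) : twoPow (n * x) = twoPow x ^ n := by
  rw [mul_comm, ← twoPow_rpow, ENNReal.rpow_natCast]

theorem tsum_twoPow_lt_top {δ : ℝ} (hδ : 0 < δ) : ∑' l : ℕ, twoPow (-(l * δ)) < ∞ := by
  have h : twoPow (-δ) < 1 := by
    rw [← twoPow_zero]
    exact ENNReal.rpow_lt_rpow_of_exponent_lt (by norm_num) (by simp) (by linarith)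
  have : ∀ l : ℕ, twoPow (-(l * δ)) = twoPow (-δ) ^ l := fun l => by
    rw [← twoPow_natCast_mul]
    ring_nf
  simp_rw [this, ENNReal.tsum_geometric]
  simpa using h

/-- Trades a loss of `2^{lδ}` for the replacement of a sum by a supremum; suprema pass through the
maximal function, sums do not. -/
theorem tsum_le_mul_iSup_twoPow (δ : ℝ) (x : ℕ → ℝ≥0∞) :
    ∑' l, x l ≤ (∑' l : ℕ, twoPow (-(l * δ))) * ⨆ l : ℕ, twoPow (l * δ) * x l := by
  rw [← ENNReal.tsum_mul_right]
  refine ENNReal.tsum_le_tsum fun l => ?_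
  calc x l = twoPow (-(l * δ)) * (twoPow (l * δ) * x l) := by
        rw [← mul_assoc, twoPow_mul, neg_add_cancel, twoPow_zero, one_mul]
    _ ≤ _ := by
        gcongr
        exact le_iSup (fun l : ℕ => twoPow (l * δ) * x l) l

theorem iSup_rpow_le_tsum {ι : Type*} {s : ℝ} (hs : 0 < s) (x : ι → ℝ≥0∞) :
    (⨆ i, x i) ^ s ≤ ∑' i, x i ^ s := by
  rw [← ENNReal.le_rpow_inv_iff hs]
  refine iSup_le fun i => ?_
  rw [ENNReal.le_rpow_inv_iff hs]
  exact ENNReal.le_tsum i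

/-- Partial sums of the terms below `1` of a geometric sequence. -/
theorem sum_geometric_lt_one_le {b u : ℝ} (hb : 1 < b) (hu : 0 ≤ u) (N : ℕ) :
    ∑ n ∈ Finset.range N, (if u * b ^ n < 1 then u * b ^ n else 0) ≤
      (b - 1)⁻¹ * min (u * b ^ N) b := by
  have hb' : 0 < b - 1 := by linarith
  induction N with
  | zero => simp; positivity
  | succ N ih =>
    rw [Finset.sum_range_succ]
    have hN : 0 ≤ u * b ^ N := by positivity
    split_ifs with h
    · rw [min_eq_left (by linarith)] at ih
      rw [pow_succ, ← mul_assoc, min_eq_left (by nlinarith)]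
      have : (b - 1)⁻¹ * (u * b ^ N * b) = (b - 1)⁻¹ * (u * b ^ N) + u * b ^ N := by
        field_simp
        ring
      linarith
    · refine (add_zero _).trans_le (ih.trans ?_)
      rw [pow_succ, ← mul_assoc]
      have : u * b ^ N ≤ u * b ^ N * b := by nlinarith
      gcongr

theorem tsum_geometric_lt_one_le {b u : ℝ} (hb : 1 < b) (hu : 0 ≤ u) :
    ∑' n : ℕ, ENNReal.ofReal (if u * b ^ n < 1 then u * b ^ n else 0) ≤
      ENNReal.ofReal ((b - 1)⁻¹ * b) := by
  have hb' : 0 < b - 1 := by linarith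
  refine ENNReal.tsum_le_of_sum_range_le fun N => ?_
  rw [← ENNReal.ofReal_sum_of_nonneg]
  · refine ENNReal.ofReal_le_ofReal ((sum_geometric_lt_one_le hb hu N).trans ?_)
    gcongr
    exact min_le_right _ _
  · intro n _
    split_ifs <;> positivity

/-! ### Level integrals of suprema -/

theorem lintegral_Lp_finset_sum_le {ι : Type*} {ν : Measure X} {s : ℝ} (hs : 1 ≤ s)
    {f : ι → X → ℝ≥0∞} (hf : ∀ i, Measurable (f i)) (F : Finset ι) :
    (∫⁻ a, (∑ i ∈ F, f i a) ^ s ∂ν) ^ (1 / s) ≤ ∑ i ∈ F, (∫⁻ a, f i a ^ s ∂ν) ^ (1 / s) := by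
  classical
  have hs0 : 0 < s := by linarith
  induction F using Finset.induction_on with
  | empty => simp [hs0]
  | insert i F hi ih =>
    simp_rw [Finset.sum_insert hi]
    refine (ENNReal.lintegral_Lp_add_le (hf i).aemeasurable
      (Finset.measurable_sum F fun j _ => hf j).aemeasurable hs).trans ?_
    gcongr

theorem lintegral_Lp_tsum_le {ι : Type*} [Countable ι] {ν : Measure X} {s : ℝ} (hs : 1 ≤ s)
    {f : ι → X → ℝ≥0∞} (hf : ∀ i, Measurable (f i)) :
    (∫⁻ a, (∑' i, f i a) ^ s ∂ν) ^ (1 / s) ≤ ∑' i, (∫⁻ a, f i a ^ s ∂ν) ^ (1 / s) := by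
  have hs0 : 0 < s := by linarith
  have h1 : ∀ a, (∑' i, f i a) ^ s = ⨆ F : Finset ι, (∑ i ∈ F, f i a) ^ s := fun a => by
    rw [ENNReal.tsum_eq_iSup_sum]
    exact (ENNReal.orderIsoRpow s hs0).map_iSup _
  simp_rw [h1]
  rw [lintegral_iSup_directed]
  · rw [one_div, ENNReal.rpow_inv_le_iff hs0]
    refine iSup_le fun F => ?_
    rw [← ENNReal.rpow_inv_le_iff hs0, ← one_div]
    exact (lintegral_Lp_finset_sum_le hs hf F).trans (ENNReal.sum_le_tsum F)
  · exact fun F => ((Finset.measurable_sum F fun j _ => hf j).pow_const s).aemeasurable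
  · refine Monotone.directed_le fun F G hFG a => ?_
    dsimp only
    gcongr

theorem measurable_measure_lt (μ : Measure X) (g : X → ℝ≥0∞) :
    Measurable fun α : ℝ => μ {x | ENNReal.ofReal α < g x} := by
  refine Antitone.measurable fun a b hab => measure_mono fun x hx => ?_
  rw [mem_ofPred_eq] at hx ⊢
  exact (ENNReal.ofReal_le_ofReal hab).trans_lt hx

/-- The distribution function of a supremum is at most the sum of the distribution functions, and
the left side is an `L^{q/p}` norm of the distribution function for the measure `α^{q-1} dα`.
Minkowski applies because `q/p ≥ 1`. -/
theorem levelIntegral_rpow_le_tsum (μ : Measure X) {p q : ℝ} (hp : 0 < p) (hpq : p ≤ q)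
    {ι : Type*} [Countable ι] {g : X → ℝ≥0∞} {G : ι → X → ℝ≥0∞}
    (h : ∀ᵐ x ∂μ, g x ≤ ⨆ i, G i x) :
    levelIntegral μ p q g ^ (p / q) ≤ ∑' i, levelIntegral μ p q (G i) ^ (p / q) := by
  have hq : 0 < q := hp.trans_le hpq
  set ν : Measure ℝ := (volume.restrict (Ioi 0)).withDensity fun α => ENNReal.ofReal (α ^ (q - 1))
  have hν : ∀ u : X → ℝ≥0∞, levelIntegral μ p q u =
      ∫⁻ α, μ {x | ENNReal.ofReal α < u x} ^ (q / p) ∂ν := fun u => by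
    exact (lintegral_withDensity_eq_lintegral_mul _
      (measurable_id.pow_const _).ennreal_ofReal ((measurable_measure_lt μ u).pow_const _)).symm
  have hpq' : p / q = 1 / (q / p) := by field_simp
  simp_rw [hν, hpq']
  refine le_trans ?_ (lintegral_Lp_tsum_le (by rwa [one_le_div hp])
    fun i => measurable_measure_lt μ (G i))
  refine ENNReal.rpow_le_rpow (lintegral_mono fun α => ENNReal.rpow_le_rpow ?_ (by positivity))
    (by positivity)
  refine le_trans (measure_mono_ae ?_) (measure_iUnion_le fun i => {x | ENNReal.ofReal α < G i x})
  filter_upwards [h] with x hx hα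
  exact mem_iUnion.2 (lt_iSup_iff.1 (lt_of_lt_of_le hα hx))

/-- With `c_n` the `n`-th height, `μ {g > α}` is at most the sum of `μ (S n)` over `c_n > α`.
Writing each term as `(α/c_n)^{p/2}` times `(c_n/α)^{p/2} μ (S n)`, the first factors form a
geometric series bounded independently of `α`, so the sum is at most a constant times the supremum
of the second factors. The power `q/p` of that supremum is at most the sum of the powers, and
integrating in `α` up to `c_n` restores `c_n^q`. -/
theorem levelIntegral_le_of_geometric_nnreal (μ : Measure X) {p q a : ℝ} (hp : 0 < p) (hq : 0 < q)
    (ha : 0 < a) : ∃ C : ℝ≥0∞, C ≠ 0 ∧ C ≠ ∞ ∧ ∀ (c : ℝ≥0) (S : ℕ → Set X) (g : X → ℝ≥0∞),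
      (∀ x, g x ≤ ⨆ n, (S n).indicator (fun _ => c * twoPow (-(n * a))) x) →
      levelIntegral μ p q g ≤ C * ∑' n : ℕ, (c * twoPow (-(n * a))) ^ q * μ (S n) ^ (q / p) := by
  -- Any exponent strictly between `0` and `p` could replace `p / 2`: positivity makes the series
  -- geometric, and staying below `p` keeps the integral in `α` convergent at `0`.
  set b : ℝ := 2 ^ (a * (p / 2)) with hbdef
  have hb : 1 < b := Real.one_lt_rpow (by norm_num) (by positivity)
  set K : ℝ≥0∞ := ENNReal.ofReal ((b - 1)⁻¹ * b) with hK
  have hs : 0 < q / p := by positivity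
  refine ⟨K ^ (q / p) / ENNReal.ofReal (q / 2), ?_, ?_, fun c S g hg => ?_⟩
  · refine ENNReal.div_ne_zero.2 ⟨?_, ENNReal.ofReal_ne_top⟩
    have : 0 < (b - 1)⁻¹ * b := mul_pos (inv_pos.2 (by linarith)) (by linarith)
    simp [hK, this, hs]
  · exact ENNReal.div_ne_top (ENNReal.rpow_ne_top_of_nonneg hs.le ENNReal.ofReal_ne_top)
      (by simpa using hq)
  set cn : ℕ → ℝ≥0∞ := fun n => c * twoPow (-(n * a)) with hcn
  have hcntop : ∀ n, cn n ≠ ∞ := fun n => ENNReal.mul_ne_top ENNReal.coe_ne_top (twoPow_ne_top _)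
  set y : ℝ → ℕ → ℝ≥0∞ := fun α n => {α : ℝ | ENNReal.ofReal α < cn n}.indicator
    (fun α => (cn n / ENNReal.ofReal α) ^ (p / 2) * μ (S n)) α with hy
  have hgeo : ∀ α : ℝ, 0 < α → ∀ n, ENNReal.ofReal α < cn n →
      (ENNReal.ofReal α / cn n) ^ (p / 2) ≤ ENNReal.ofReal
        (if (α / c) ^ (p / 2) * b ^ n < 1 then (α / c) ^ (p / 2) * b ^ n else 0) := by
    intro α hα n hn
    have hc : 0 < (c : ℝ) := by
      rcases eq_or_ne c 0 with rfl | hc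
      · simp [hcn] at hn
      · exact NNReal.coe_pos.2 (pos_iff_ne_zero.2 hc)
    have hcr : cn n = ENNReal.ofReal (c * 2 ^ (-(n * a))) := by
      simp only [hcn]
      rw [ENNReal.ofReal_mul hc.le, ENNReal.ofReal_coe_nnreal, twoPow_eq_ofReal]
    have hpos : 0 < c * (2 : ℝ) ^ (-(n * a)) := by positivity
    have e1 : (α / c) ^ (p / 2) * b ^ n = (α / (c * 2 ^ (-(n * a)))) ^ (p / 2) := by
      rw [hbdef, ← Real.rpow_natCast, ← Real.rpow_mul (by norm_num), ← div_div,
        Real.div_rpow (x := α / c) (by positivity) (by positivity),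
        ← Real.rpow_mul (x := 2) (by norm_num), div_eq_mul_inv (_ ^ _), ← Real.rpow_neg (by norm_num)]
      ring_nf
    have hlt : α / (c * 2 ^ (-(n * a))) < 1 := by
      rw [div_lt_one hpos]
      rw [hcr] at hn
      exact (ENNReal.ofReal_lt_ofReal_iff hpos).1 hn
    rw [e1, if_pos (Real.rpow_lt_one (by positivity) hlt (by positivity)), hcr,
      ← ENNReal.ofReal_div_of_pos hpos, ENNReal.ofReal_rpow_of_pos (by positivity)]
  have hlevel : ∀ α : ℝ, 0 < α → μ {x | ENNReal.ofReal α < g x} ≤ K * ⨆ n, y α n := by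
    intro α hα
    have hα0 : ENNReal.ofReal α ≠ 0 := by simpa using hα
    have hsub : {x | ENNReal.ofReal α < g x} ⊆
        ⋃ n, {x | x ∈ S n ∧ ENNReal.ofReal α < cn n} := by
      intro x hx
      obtain ⟨n, hn⟩ := lt_iSup_iff.1 (lt_of_lt_of_le hx (hg x))
      by_cases hxn : x ∈ S n
      · rw [indicator_of_mem hxn] at hn
        exact mem_iUnion.2 ⟨n, hxn, hn⟩
      · simp [hxn] at hn
    refine (measure_mono hsub).trans ((measure_iUnion_le _).trans ?_)
    refine le_trans ?_ (mul_le_mul' (tsum_geometric_lt_one_le hb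
      (u := (α / c) ^ (p / 2)) (by positivity)) le_rfl)
    rw [← ENNReal.tsum_mul_right]
    refine ENNReal.tsum_le_tsum fun n => ?_
    by_cases hn : ENNReal.ofReal α < cn n
    · refine le_trans ?_ (mul_le_mul' (hgeo α hα n hn) (le_iSup (y α) n))
      have hmem : α ∈ {α : ℝ | ENNReal.ofReal α < cn n} := hn
      simp only [hy, indicator_of_mem hmem, hn, and_true]
      rw [← mul_assoc, ← ENNReal.mul_rpow_of_nonneg _ _ (by positivity),
        ← ENNReal.mul_div_mul_comm (Or.inr ENNReal.ofReal_ne_top) (Or.inr hα0), mul_comm (cn n),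
        ENNReal.div_self (mul_ne_zero hα0 (ne_bot_of_gt hn))
          (ENNReal.mul_ne_top ENNReal.ofReal_ne_top (hcntop n)), ENNReal.one_rpow, one_mul]
      exact le_rfl
    · simp [hn]
  calc levelIntegral μ p q g
      ≤ ∫⁻ α in Ioi (0 : ℝ), ∑' n, K ^ (q / p) * (cn n ^ (q / 2) * μ (S n) ^ (q / p)) *
          {α : ℝ | ENNReal.ofReal α < cn n}.indicator
            (fun α => ENNReal.ofReal (α ^ (q / 2 - 1))) α := by
        refine setLIntegral_mono' measurableSet_Ioi fun α (hα : 0 < α) => ?_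
        have hα0 : ENNReal.ofReal α ≠ 0 := by simpa using hα
        refine (mul_le_mul' le_rfl (ENNReal.rpow_le_rpow (hlevel α hα) hs.le)).trans ?_
        rw [ENNReal.mul_rpow_of_nonneg _ _ hs.le]
        refine (mul_le_mul' le_rfl (mul_le_mul' le_rfl (iSup_rpow_le_tsum hs _))).trans ?_
        rw [← ENNReal.tsum_mul_left, ← ENNReal.tsum_mul_left]
        refine ENNReal.tsum_le_tsum fun n => ?_
        by_cases hn : ENNReal.ofReal α < cn n
        · have hmem : α ∈ {α : ℝ | ENNReal.ofReal α < cn n} := hn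
          simp only [hy, indicator_of_mem hmem]
          rw [ENNReal.mul_rpow_of_nonneg _ _ hs.le, ← ENNReal.rpow_mul,
            show p / 2 * (q / p) = q / 2 by field_simp,
            ENNReal.div_rpow_of_nonneg _ _ (by positivity), ENNReal.div_eq_inv_mul,
            ENNReal.ofReal_rpow_of_pos hα, ← ENNReal.ofReal_inv_of_pos (by positivity),
            show q / 2 - 1 = (q - 1) + -(q / 2) by ring, Real.rpow_add hα, Real.rpow_neg hα.le,
            ENNReal.ofReal_mul (by positivity)]
          exact le_of_eq (by ring)
        · have hmem : α ∉ {α : ℝ | ENNReal.ofReal α < cn n} := hn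
          simp [hy, hmem, hs]
    _ = ∑' n, K ^ (q / p) * (cn n ^ (q / 2) * μ (S n) ^ (q / p)) *
          (cn n ^ (q / 2) / ENNReal.ofReal (q / 2)) := by
        rw [lintegral_tsum]
        · congr 1 with n
          rw [lintegral_const_mul, lintegral_rpow_sub_one_lt (by positivity)]
          exact (measurable_id.pow_const _).ennreal_ofReal.indicator
            (measurableSet_lt ENNReal.measurable_ofReal measurable_const)
        · exact fun n => (((measurable_id.pow_const _).ennreal_ofReal.indicator
            (measurableSet_lt ENNReal.measurable_ofReal measurable_const)).const_mul _).aemeasurable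
    _ = _ := by
        rw [← ENNReal.tsum_mul_left]
        congr 1 with n
        have : cn n ^ q = cn n ^ (q / 2) * cn n ^ (q / 2) := by
          rw [← ENNReal.rpow_add_of_nonneg _ _ (by positivity) (by positivity), add_halves]
        rw [this, ENNReal.div_eq_inv_mul, ENNReal.div_eq_inv_mul]
        ring

/-- For infinite `c`, either all `S n` are null and so is every level set, or the right side is
infinite; the latter needs the constant to be nonzero. Infinite heights must be allowed since
integrals of the profile over dyadic intervals may diverge. -/
theorem levelIntegral_le_of_geometric (μ : Measure X) {p q a : ℝ} (hp : 0 < p) (hq : 0 < q)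
    (ha : 0 < a) : ∃ C : ℝ≥0∞, C ≠ ∞ ∧ ∀ (c : ℝ≥0∞) (S : ℕ → Set X) (g : X → ℝ≥0∞),
      (∀ x, g x ≤ ⨆ n, (S n).indicator (fun _ => c * twoPow (-(n * a))) x) →
      levelIntegral μ p q g ≤ C * ∑' n : ℕ, (c * twoPow (-(n * a))) ^ q * μ (S n) ^ (q / p) := by
  obtain ⟨C, hC0, hC, h⟩ := levelIntegral_le_of_geometric_nnreal μ hp hq ha
  refine ⟨C, hC, fun c S g hg => ?_⟩
  induction c with
  | coe c => exact h c S g hg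
  | top =>
    by_cases hS : ∀ n, μ (S n) = 0
    · have : ∀ α : ℝ, μ {x | ENNReal.ofReal α < g x} = 0 := by
        refine fun α => measure_mono_null (fun x hx => ?_) (measure_iUnion_null hS)
        obtain ⟨n, hn⟩ := lt_iSup_iff.1 (lt_of_lt_of_le hx (hg x))
        by_cases hxn : x ∈ S n
        · exact mem_iUnion.2 ⟨n, hxn⟩
        · simp [hxn] at hn
      simp [levelIntegral, this, div_pos hq hp]
    · push Not at hS
      obtain ⟨n, hn⟩ := hS
      refine le_top.trans (le_of_eq (Eq.symm ?_))
      rw [ENNReal.mul_eq_top]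
      refine Or.inl ⟨hC0, top_le_iff.1 (le_trans (le_of_eq ?_) (ENNReal.le_tsum n))⟩
      rw [ENNReal.top_mul (twoPow_ne_zero _), ENNReal.top_rpow_of_pos hq, ENNReal.top_mul]
      simp [hn, (div_pos hq hp).le]

/-- The contribution of a single multiple of an indicator function. -/
theorem levelIntegral_indicator_rpow_le (μ : Measure X) {p q : ℝ} (hp : 0 < p) (hpq : p ≤ q) :
    ∃ C : ℝ≥0∞, C ≠ ∞ ∧ ∀ (c : ℝ≥0∞) (S : Set X),
      levelIntegral μ p q (S.indicator fun _ => c) ^ (p / q) ≤ C * (c ^ p * μ S) := by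
  have hq : 0 < q := hp.trans_le hpq
  obtain ⟨C, hC, h⟩ := levelIntegral_le_of_geometric μ hp hq one_pos
  have hpq0 : 0 < p / q := by positivity
  refine ⟨C ^ (p / q), ENNReal.rpow_ne_top_of_nonneg hpq0.le hC, fun c S => ?_⟩
  have := h c (fun n => if n = 0 then S else ∅) (S.indicator fun _ => c) fun x => by
    refine le_trans ?_ (le_iSup _ 0)
    simp [twoPow_zero]
  refine (ENNReal.rpow_le_rpow this hpq0.le).trans ?_
  rw [tsum_eq_single 0 fun n hn => by simp [hn, div_pos hq hp]]
  simp only [CharP.cast_eq_zero, neg_zero, twoPow_zero, mul_one, if_true]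
  rw [ENNReal.mul_rpow_of_nonneg _ _ hpq0.le, ENNReal.mul_rpow_of_nonneg _ _ hpq0.le,
    ← ENNReal.rpow_mul, ← ENNReal.rpow_mul, show q * (p / q) = p by field_simp,
    show q / p * (p / q) = 1 by field_simp, ENNReal.rpow_one]

/-! ### Polar coordinates and integrals over the sphere -/

section Polar

variable {V : Type*} [NormedAddCommGroup V] [NormedSpace ℝ V] [FiniteDimensional ℝ V]
  [MeasurableSpace V] [BorelSpace V] [Nontrivial V]

theorem lintegral_volumeIoiPow (n : ℕ) {G : ℝ → ℝ≥0∞} (hG : Measurable G) :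
    ∫⁻ s : Ioi (0 : ℝ), G s ∂(Measure.volumeIoiPow n) =
      ∫⁻ s in Ioi (0 : ℝ), ENNReal.ofReal (s ^ n) * G s := by
  refine (lintegral_withDensity_eq_lintegral_mul _ (by fun_prop)
    (hG.comp measurable_subtype_coe)).trans ?_
  exact lintegral_subtype_comap measurableSet_Ioi fun s => ENNReal.ofReal (s ^ n) * G s

theorem lintegral_eq_lintegral_sphere (μ : Measure V) [μ.IsAddHaarMeasure]
    {G : V → ℝ≥0∞} (hG : Measurable G) :
    ∫⁻ x, G x ∂μ = ∫⁻ y : Metric.sphere (0 : V) 1, (∫⁻ s in Ioi (0 : ℝ),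
      ENNReal.ofReal (s ^ (Module.finrank ℝ V - 1)) * G (s • (y : V))) ∂μ.toSphere := by
  have hm : Measurable fun z : Metric.sphere (0 : V) 1 × Ioi (0 : ℝ) =>
      G ((z.2 : ℝ) • (z.1 : V)) := by fun_prop
  calc ∫⁻ x, G x ∂μ = ∫⁻ x : ({(0)}ᶜ : Set V), G x ∂(μ.comap (↑)) := by
        rw [lintegral_subtype_comap (measurableSet_singleton _).compl, restrict_compl_singleton]
    _ = ∫⁻ z, G ((z.2 : ℝ) • (z.1 : V))
          ∂(μ.toSphere.prod (.volumeIoiPow (Module.finrank ℝ V - 1))) := by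
        rw [← μ.measurePreserving_homeomorphUnitSphereProd.lintegral_comp_emb
          (Homeomorph.measurableEmbedding _)]
        refine lintegral_congr fun x => ?_
        have hx : ‖(x : V)‖ ≠ 0 := norm_ne_zero_iff.2 x.2
        simp [smul_smul, hx]
    _ = _ := by
        rw [lintegral_prod _ hm.aemeasurable]
        refine lintegral_congr fun y => ?_
        exact lintegral_volumeIoiPow _ (G := fun s => G (s • (y : V))) (by fun_prop)

theorem lintegral_norm_eq (μ : Measure V) [μ.IsAddHaarMeasure]
    {G : ℝ → ℝ≥0∞} (hG : Measurable G) :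
    ∫⁻ x, G ‖x‖ ∂μ = μ.toSphere univ * ∫⁻ s in Ioi (0 : ℝ),
      ENNReal.ofReal (s ^ (Module.finrank ℝ V - 1)) * G s := by
  rw [lintegral_eq_lintegral_sphere μ (by fun_prop : Measurable fun x : V => G ‖x‖)]
  have : ∀ y : Metric.sphere (0 : V) 1, ∫⁻ s in Ioi (0 : ℝ),
      ENNReal.ofReal (s ^ (Module.finrank ℝ V - 1)) * G ‖s • (y : V)‖ =
      ∫⁻ s in Ioi (0 : ℝ), ENNReal.ofReal (s ^ (Module.finrank ℝ V - 1)) * G s := by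
    intro y
    refine setLIntegral_congr_fun measurableSet_Ioi fun s (hs : 0 < s) => ?_
    simp [norm_smul, abs_of_pos hs]
  simp_rw [this]
  rw [lintegral_const, mul_comm]

theorem toSphere_univ_ne_zero (μ : Measure V) [μ.IsAddHaarMeasure] : μ.toSphere univ ≠ 0 :=
  Measure.measure_univ_ne_zero.2 (Measure.toSphere_ne_zero μ)

theorem lintegral_Ioi_pow_indicator (n : ℕ) :
    ∫⁻ s in Ioi (0 : ℝ), ENNReal.ofReal (s ^ n) * (Iio (1 : ℝ)).indicator 1 s =
      ENNReal.ofReal (1 / (n + 1)) := by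
  have h := lintegral_Ioo_rpow_sub_one (s := n + 1) (b := 1) (by positivity) zero_le_one
  rw [Real.one_rpow] at h
  rw [← h]
  have : ∀ s : ℝ, ENNReal.ofReal (s ^ n) * (Iio (1 : ℝ)).indicator 1 s =
      (Iio (1 : ℝ)).indicator (fun s => ENNReal.ofReal (s ^ n)) s := fun s => by
    simp [indicator]
  simp_rw [this]
  rw [lintegral_indicator measurableSet_Iio, Measure.restrict_restrict measurableSet_Iio,
    inter_comm, Ioi_inter_Iio]
  simp

/-- Integrals over the sphere as integrals over the ball. -/
theorem lintegral_sphere_eq_lintegral_ball (μ : Measure V) [μ.IsAddHaarMeasure]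
    {G : V → ℝ≥0∞} (hG : Measurable G) :
    ∫⁻ x, (Iio (1 : ℝ)).indicator 1 ‖x‖ * G (‖x‖⁻¹ • x) ∂μ =
      ENNReal.ofReal (1 / ((Module.finrank ℝ V - 1 : ℕ) + 1)) *
        ∫⁻ y : Metric.sphere (0 : V) 1, G y ∂μ.toSphere := by
  have h1 : Measurable fun x : V => (Iio (1 : ℝ)).indicator (1 : ℝ → ℝ≥0∞) ‖x‖ :=
    (measurable_one.indicator measurableSet_Iio).comp measurable_norm
  have h2 : Measurable fun x : V => (Iio (1 : ℝ)).indicator 1 ‖x‖ * G (‖x‖⁻¹ • x) :=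
    h1.mul (by fun_prop)
  rw [lintegral_eq_lintegral_sphere μ h2, ← lintegral_const_mul]
  · refine lintegral_congr fun y => ?_
    rw [← lintegral_Ioi_pow_indicator, ← lintegral_mul_const]
    · refine setLIntegral_congr_fun measurableSet_Ioi fun s (hs : 0 < s) => ?_
      simp only [norm_smul, norm_eq_of_mem_sphere, Real.norm_eq_abs, abs_of_pos hs, mul_one,
        smul_smul, inv_mul_cancel₀ hs.ne', one_smul, mul_assoc]
    · exact (by fun_prop : Measurable fun s : ℝ => ENNReal.ofReal (s ^ _)).mul
        (measurable_one.indicator measurableSet_Iio)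
  · exact hG.comp measurable_subtype_coe

end Polar

/-- Integrals of functions of the first coordinate and of the norm of the others. -/
theorem lintegral_euclidean_succ (k : ℕ) {H : ℝ → ℝ → ℝ≥0∞}
    (hH : Measurable (Function.uncurry H)) :
    ∫⁻ z : EuclideanSpace ℝ (Fin (k + 2)), H (z 0) (√(‖z‖ ^ 2 - z 0 ^ 2)) =
      (volume : Measure (EuclideanSpace ℝ (Fin (k + 1)))).toSphere univ *
        ∫⁻ u : ℝ, ∫⁻ τ in Ioi (0 : ℝ), ENNReal.ofReal (τ ^ k) * H u τ := by
  have e1 := (PiLp.volume_preserving_ofLp (Fin (k + 2))).lintegral_comp_emb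
    (MeasurableEquiv.toLp 2 (Fin (k + 2) → ℝ)).symm.measurableEmbedding
    (fun z => H (z 0) (√(∑ i : Fin (k + 1), z i.succ ^ 2)))
  have e2 := (volume_preserving_piFinSuccAbove (fun _ : Fin (k + 2) => ℝ) 0).lintegral_comp_emb
    (MeasurableEquiv.measurableEmbedding _)
    (fun z => H z.1 (√(∑ i : Fin (k + 1), z.2 i ^ 2)))
  have hm : Measurable fun z : ℝ × (Fin (k + 1) → ℝ) => H z.1 (√(∑ i : Fin (k + 1), z.2 i ^ 2)) :=
    hH.comp (by fun_prop : Measurable fun z : ℝ × (Fin (k + 1) → ℝ) =>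
      (z.1, √(∑ i : Fin (k + 1), z.2 i ^ 2)))
  have e3 : ∀ u : ℝ, ∫⁻ w : Fin (k + 1) → ℝ, H u (√(∑ i : Fin (k + 1), w i ^ 2)) =
      (volume : Measure (EuclideanSpace ℝ (Fin (k + 1)))).toSphere univ *
        ∫⁻ τ in Ioi (0 : ℝ), ENNReal.ofReal (τ ^ k) * H u τ := by
    intro u
    have e4 := (PiLp.volume_preserving_ofLp (Fin (k + 1))).lintegral_comp_emb
      (MeasurableEquiv.toLp 2 (Fin (k + 1) → ℝ)).symm.measurableEmbedding
      (fun w => H u (√(∑ i : Fin (k + 1), w i ^ 2)))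
    have e5 := lintegral_norm_eq (volume : Measure (EuclideanSpace ℝ (Fin (k + 1))))
      (G := H u) (hH.comp measurable_prodMk_left)
    rw [← e4]
    simp only [finrank_euclideanSpace, Fintype.card_fin, Nat.add_sub_cancel,
      EuclideanSpace.norm_eq, Real.norm_eq_abs, sq_abs] at e5
    exact e5
  have e6 : ∀ z : EuclideanSpace ℝ (Fin (k + 2)),
      ‖z‖ ^ 2 - z 0 ^ 2 = ∑ i : Fin (k + 1), z i.succ ^ 2 := fun z => by
    rw [EuclideanSpace.real_norm_sq_eq, Fin.sum_univ_succ]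
    ring
  simp_rw [e6]
  refine e1.trans ?_
  refine e2.trans ?_
  rw [Measure.volume_eq_prod, lintegral_prod _ hm.aemeasurable]
  simp_rw [e3]
  rw [lintegral_const_mul]
  refine Measurable.lintegral_prod_right' (f := fun z : ℝ × ℝ => ENNReal.ofReal (z.2 ^ k) * H z.1 z.2) ?_
  exact (by fun_prop : Measurable fun z : ℝ × ℝ => ENNReal.ofReal (z.2 ^ k)).mul hH

/-- Planar polar coordinates applied to `H` extended by zero to the lower half plane, where the sine
is nonpositive. -/
theorem lintegral_halfPlane_polar {H : ℝ → ℝ → ℝ≥0∞} (hH : Measurable (Function.uncurry H)) :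
    ∫⁻ u : ℝ, ∫⁻ τ in Ioi (0 : ℝ), H u τ =
      ∫⁻ θ in Ioo (0 : ℝ) Real.pi, ∫⁻ s in Ioi (0 : ℝ), ENNReal.ofReal s *
        H (s * Real.cos θ) (s * Real.sin θ) := by
  have h := lintegral_comp_polarCoord_symm fun z : ℝ × ℝ => (Ioi (0 : ℝ)).indicator (H z.1) z.2
  have hm0 : Measurable fun z : ℝ × ℝ => (Ioi (0 : ℝ)).indicator (H z.1) z.2 := by
    have : (fun z : ℝ × ℝ => (Ioi (0 : ℝ)).indicator (H z.1) z.2) =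
        (Prod.snd ⁻¹' Ioi (0 : ℝ)).indicator (Function.uncurry H) := by
      ext z
      simp [indicator, Function.uncurry]
    rw [this]
    exact hH.indicator (measurable_snd measurableSet_Ioi)
  have hm1 : Measurable fun z : ℝ × ℝ => ENNReal.ofReal z.1 *
      (Ioi (0 : ℝ)).indicator (H (z.1 * Real.cos z.2)) (z.1 * Real.sin z.2) :=
    measurable_fst.ennreal_ofReal.mul (hm0.comp (by fun_prop : Measurable fun z : ℝ × ℝ =>
      (z.1 * Real.cos z.2, z.1 * Real.sin z.2)))
  rw [Measure.volume_eq_prod, lintegral_prod _ hm0.aemeasurable] at h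
  simp only [lintegral_indicator measurableSet_Ioi] at h
  rw [← h, polarCoord_target, ← Measure.prod_restrict]
  simp only [polarCoord_symm_apply, smul_eq_mul]
  rw [lintegral_prod_symm _ hm1.aemeasurable,
    ← lintegral_indicator measurableSet_Ioo, ← lintegral_indicator measurableSet_Ioo]
  refine lintegral_congr fun θ => ?_
  by_cases hθ : θ ∈ Ioo (0 : ℝ) Real.pi
  · have hθ' : θ ∈ Ioo (-Real.pi) Real.pi := ⟨by linarith [hθ.1, Real.pi_pos], hθ.2⟩
    rw [indicator_of_mem hθ, indicator_of_mem hθ']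
    refine setLIntegral_congr_fun measurableSet_Ioi fun s (hs : 0 < s) => ?_
    have : s * Real.sin θ ∈ Ioi (0 : ℝ) := mul_pos hs (Real.sin_pos_of_mem_Ioo hθ)
    simp only [indicator_of_mem this]
  · rw [indicator_of_notMem hθ]
    by_cases hθ' : θ ∈ Ioo (-Real.pi) Real.pi
    · rw [indicator_of_mem hθ']
      have hsin : Real.sin θ ≤ 0 := Real.sin_nonpos_of_nonpos_of_neg_pi_le
        (by by_contra! h0; exact hθ ⟨h0, hθ'.2⟩) hθ'.1.le
      rw [← lintegral_zero (μ := volume.restrict (Ioi (0 : ℝ)))]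
      refine setLIntegral_congr_fun measurableSet_Ioi fun s (hs : 0 < s) => ?_
      have : s * Real.sin θ ∉ Ioi (0 : ℝ) := by
        simpa using mul_nonpos_of_nonneg_of_nonpos hs.le hsin
      simp only [indicator_of_notMem this, mul_zero]
    · rw [indicator_of_notMem hθ']

/-- The distribution of the inner product with a fixed vector on the sphere. -/
theorem lintegral_sphere_inner (k : ℕ) : ∃ c : ℝ≥0∞, c ≠ 0 ∧ c ≠ ∞ ∧
    ∀ Φ : ℝ → ℝ≥0∞, Measurable Φ → ∀ x : EuclideanSpace ℝ (Fin (k + 2)),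
      ∫⁻ y, Φ (inner ℝ x (y : EuclideanSpace ℝ (Fin (k + 2)))) ∂(sphereMeasure (k + 2)) =
        c * ∫⁻ θ in Ioo (0 : ℝ) Real.pi, ENNReal.ofReal (Real.sin θ ^ k) *
          Φ (‖x‖ * Real.cos θ) := by
  set μ : Measure (EuclideanSpace ℝ (Fin (k + 2))) := volume with hμ
  set ω := (volume : Measure (EuclideanSpace ℝ (Fin (k + 1)))).toSphere univ with hω
  set a := ENNReal.ofReal (1 / ((k + 1 : ℕ) + 1)) with ha
  have hω0 : ω ≠ 0 := toSphere_univ_ne_zero _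
  have hωt : ω ≠ ∞ := measure_ne_top _ _
  have ha0 : a ≠ 0 := by
    rw [ha, Ne, ENNReal.ofReal_eq_zero, not_le]
    positivity
  have hat : a ≠ ∞ := ENNReal.ofReal_ne_top
  refine ⟨(μ.toSphere univ)⁻¹ * ω, mul_ne_zero (ENNReal.inv_ne_zero.2 (measure_ne_top _ _)) hω0,
    ENNReal.mul_ne_top (ENNReal.inv_ne_top.2 (toSphere_univ_ne_zero _)) hωt, fun Φ hΦ x => ?_⟩
  -- Extending the integrand to the ball, homogeneously of degree zero, replaces the sphere by
  -- Lebesgue measure, for which isometries and splitting off a coordinate are available.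
  have hball := lintegral_sphere_eq_lintegral_ball μ
    (G := fun z => Φ (inner ℝ x z)) (by fun_prop)
  simp only [finrank_euclideanSpace, Fintype.card_fin, inner_smul_right,
    show k + 2 - 1 = k + 1 by omega] at hball
  set v : EuclideanSpace ℝ (Fin (k + 2)) := ‖x‖ • EuclideanSpace.single 0 1 with hv
  have hvx : ‖v‖ = ‖x‖ := by simp [hv, norm_smul]
  -- This reflection maps `‖x‖ e₀` to `x`, so the inner product with `x` becomes `‖x‖` times the
  -- first coordinate.
  set L := Submodule.reflection (Submodule.span ℝ {v - x})ᗮ with hL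
  have hLv : L v = x := Submodule.reflection_sub hvx
  have hrot := L.measurePreserving.lintegral_comp_emb L.toHomeomorph.measurableEmbedding
    (fun z => (Iio (1 : ℝ)).indicator 1 ‖z‖ * Φ (‖z‖⁻¹ * inner ℝ x z))
  have hin : ∀ z, inner ℝ x (L z) = ‖x‖ * z 0 := fun z => by
    conv_lhs => rw [← hLv]
    rw [L.inner_map_map, hv, inner_smul_left, EuclideanSpace.inner_single_left]
    simp
  simp only [LinearIsometryEquiv.norm_map, hin] at hrot
  set H : ℝ → ℝ → ℝ≥0∞ := fun u τ => (Iio (1 : ℝ)).indicator 1 (√(u ^ 2 + τ ^ 2)) *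
    Φ ((√(u ^ 2 + τ ^ 2))⁻¹ * (‖x‖ * u)) with hHdef
  have hH : Measurable (Function.uncurry H) := by
    have h1 : Measurable fun z : ℝ × ℝ =>
        (Iio (1 : ℝ)).indicator (1 : ℝ → ℝ≥0∞) (√(z.1 ^ 2 + z.2 ^ 2)) :=
      (measurable_one.indicator measurableSet_Iio).comp (by fun_prop)
    exact h1.mul (hΦ.comp (by fun_prop))
  have hsplit := lintegral_euclidean_succ k hH
  have hnorm : ∀ z : EuclideanSpace ℝ (Fin (k + 2)),
      √(z 0 ^ 2 + √(‖z‖ ^ 2 - z 0 ^ 2) ^ 2) = ‖z‖ := fun z => by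
    rw [Real.sq_sqrt, add_sub_cancel, Real.sqrt_sq (norm_nonneg _)]
    rw [EuclideanSpace.real_norm_sq_eq, sub_nonneg]
    exact Finset.single_le_sum (f := fun i => z i ^ 2) (fun i _ => sq_nonneg _) (Finset.mem_univ 0)
  simp only [hHdef, hnorm] at hsplit
  have hpol := lintegral_halfPlane_polar (H := fun u τ => ENNReal.ofReal (τ ^ k) * H u τ)
    ((by fun_prop : Measurable fun z : ℝ × ℝ => ENNReal.ofReal (z.2 ^ k)).mul hH)
  have hinner : ∀ θ ∈ Ioo (0 : ℝ) Real.pi, ∫⁻ s in Ioi (0 : ℝ), ENNReal.ofReal s *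
      (ENNReal.ofReal ((s * Real.sin θ) ^ k) * H (s * Real.cos θ) (s * Real.sin θ)) =
      a * (ENNReal.ofReal (Real.sin θ ^ k) * Φ (‖x‖ * Real.cos θ)) := by
    intro θ hθ
    have hsin : 0 < Real.sin θ := Real.sin_pos_of_mem_Ioo hθ
    rw [ha, ← lintegral_Ioi_pow_indicator, ← lintegral_mul_const]
    · refine setLIntegral_congr_fun measurableSet_Ioi fun s (hs : 0 < s) => ?_
      have hs1 : √((s * Real.cos θ) ^ 2 + (s * Real.sin θ) ^ 2) = s := by
        rw [show (s * Real.cos θ) ^ 2 + (s * Real.sin θ) ^ 2 =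
          s ^ 2 * (Real.sin θ ^ 2 + Real.cos θ ^ 2) by ring, Real.sin_sq_add_cos_sq, mul_one,
          Real.sqrt_sq hs.le]
      have hs2 : s⁻¹ * (‖x‖ * (s * Real.cos θ)) = ‖x‖ * Real.cos θ := by field_simp
      simp only [hHdef, hs1, hs2]
      rw [mul_pow, ENNReal.ofReal_mul (by positivity), pow_succ, ENNReal.ofReal_mul (by positivity)]
      ring
    · exact (by fun_prop : Measurable fun s : ℝ => ENNReal.ofReal (s ^ _)).mul
        (measurable_one.indicator measurableSet_Iio)
  rw [setLIntegral_congr_fun measurableSet_Ioo hinner, lintegral_const_mul] at hpol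
  · have hfin : a * ∫⁻ y : Metric.sphere (0 : EuclideanSpace ℝ (Fin (k + 2))) 1,
        Φ (inner ℝ x (y : EuclideanSpace ℝ (Fin (k + 2)))) ∂μ.toSphere =
        a * (ω * ∫⁻ θ in Ioo (0 : ℝ) Real.pi, ENNReal.ofReal (Real.sin θ ^ k) *
          Φ (‖x‖ * Real.cos θ)) := by
      rw [← hball, ← hrot, hsplit, mul_left_comm, ← hpol]
    rw [ENNReal.mul_right_inj ha0 hat] at hfin
    rw [sphereMeasure, lintegral_smul_measure, hfin, smul_eq_mul, mul_assoc]
  · exact (by fun_prop : Measurable fun θ : ℝ => ENNReal.ofReal (Real.sin θ ^ k)).mul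
      (hΦ.comp (by fun_prop))

/-! ### Spherical means of radial functions -/

/-- The Euclidean space of dimension `k + 2`. -/
abbrev Euc (k : ℕ) := EuclideanSpace ℝ (Fin (k + 2))

/-- By the law of cosines `‖x - t y‖` depends on `y` only through the inner product with `x`. -/
theorem lintegral_sphere_norm_sub (k : ℕ) : ∃ c : ℝ≥0∞, c ≠ 0 ∧ c ≠ ∞ ∧
    ∀ F : ℝ → ℝ≥0∞, Measurable F → ∀ (x : Euc k) (t : ℝ),
      ∫⁻ y, F ‖x - t • (y : Euc k)‖ ∂(sphereMeasure (k + 2)) =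
        c * ∫⁻ θ in Ioo (0 : ℝ) Real.pi, ENNReal.ofReal (Real.sin θ ^ k) *
          F (√(‖x‖ ^ 2 + t ^ 2 - 2 * ‖x‖ * t * Real.cos θ)) := by
  obtain ⟨c, hc0, hct, h⟩ := lintegral_sphere_inner k
  refine ⟨c, hc0, hct, fun F hF x t => ?_⟩
  have := h (fun u => F (√(‖x‖ ^ 2 + t ^ 2 - 2 * t * u))) (by fun_prop) x
  have e1 : ∀ y : Metric.sphere (0 : Euc k) 1,
      ‖x - t • (y : Euc k)‖ =
        √(‖x‖ ^ 2 + t ^ 2 - 2 * t * inner ℝ x (y : Euc k)) := fun y => by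
    rw [← Real.sqrt_sq (norm_nonneg _), norm_sub_sq_real, inner_smul_right, norm_smul,
      norm_eq_of_mem_sphere, mul_one, Real.norm_eq_abs, sq_abs]
    congr 1
    ring
  simp_rw [e1]
  rw [this]
  congr 2 with θ
  ring_nf

/-- The sine of the angle opposite to the side `s` in the triangle with sides `r, t, s`. -/
noncomputable def sinAngle (r t s : ℝ) : ℝ :=
  √(((r + t) ^ 2 - s ^ 2) * (s ^ 2 - (r - t) ^ 2)) / (2 * r * t)

/-- The kernel of the spherical mean of radius `t`, as an operator on radial functions. -/
noncomputable def radialKernel (k : ℕ) (r t s : ℝ) : ℝ :=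
  sinAngle r t s ^ k / sinAngle r t s * (s / (r * t))

/-- Substitute the side `s` opposite to the angle `θ`: `s ds = r t sin θ dθ`. The Jacobian divides
by one power of the sine, which explains the quotient in `radialKernel`; for `k = 0` it is a true
singularity. An inequality suffices later, so the image of the substitution need only be contained
in the interval. -/
theorem lintegral_angle_le (k : ℕ) {r t : ℝ} (hr : 0 < r) (ht : 0 < t) (F : ℝ → ℝ≥0∞) :
    ∫⁻ θ in Ioo (0 : ℝ) Real.pi, ENNReal.ofReal (Real.sin θ ^ k) *
        F (√(r ^ 2 + t ^ 2 - 2 * r * t * Real.cos θ)) ≤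
      ∫⁻ s in Ioo |r - t| (r + t), ENNReal.ofReal (radialKernel k r t s) * F s := by
  set u : ℝ → ℝ := fun θ => √(r ^ 2 + t ^ 2 - 2 * r * t * Real.cos θ) with hu
  have hcos : ∀ θ ∈ Ioo (0 : ℝ) Real.pi, Real.cos θ < 1 ∧ -1 < Real.cos θ := by
    intro θ hθ
    constructor
    · rw [← Real.cos_zero]
      exact Real.strictAntiOn_cos ⟨le_rfl, Real.pi_pos.le⟩ ⟨hθ.1.le, hθ.2.le⟩ hθ.1
    · rw [← Real.cos_pi]
      exact Real.strictAntiOn_cos ⟨hθ.1.le, hθ.2.le⟩ ⟨Real.pi_pos.le, le_rfl⟩ hθ.2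
  have hrt : 0 < r * t := mul_pos hr ht
  have harg : ∀ θ ∈ Ioo (0 : ℝ) Real.pi,
      (r - t) ^ 2 < r ^ 2 + t ^ 2 - 2 * r * t * Real.cos θ ∧
      r ^ 2 + t ^ 2 - 2 * r * t * Real.cos θ < (r + t) ^ 2 := by
    intro θ hθ
    obtain ⟨h1, h2⟩ := hcos θ hθ
    constructor <;> nlinarith
  have hpos : ∀ θ ∈ Ioo (0 : ℝ) Real.pi, 0 < r ^ 2 + t ^ 2 - 2 * r * t * Real.cos θ :=
    fun θ hθ => (sq_nonneg _).trans_lt (harg θ hθ).1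
  have husq : ∀ θ ∈ Ioo (0 : ℝ) Real.pi, u θ ^ 2 = r ^ 2 + t ^ 2 - 2 * r * t * Real.cos θ :=
    fun θ hθ => Real.sq_sqrt (hpos θ hθ).le
  have hupos : ∀ θ ∈ Ioo (0 : ℝ) Real.pi, 0 < u θ := fun θ hθ => Real.sqrt_pos.2 (hpos θ hθ)
  have hderiv : ∀ θ ∈ Ioo (0 : ℝ) Real.pi,
      HasDerivWithinAt u (r * t * Real.sin θ / u θ) (Ioo 0 Real.pi) θ := by
    intro θ hθ
    have h1 : HasDerivAt (fun θ => r ^ 2 + t ^ 2 - 2 * r * t * Real.cos θ)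
        (2 * r * t * Real.sin θ) θ := by
      have := ((Real.hasDerivAt_cos θ).const_mul (2 * r * t)).const_sub (r ^ 2 + t ^ 2)
      simpa using this
    have h2 := (h1.sqrt (hpos θ hθ).ne').hasDerivWithinAt (s := Ioo 0 Real.pi)
    have h3 : 2 * r * t * Real.sin θ / (2 * √(r ^ 2 + t ^ 2 - 2 * r * t * Real.cos θ)) =
        r * t * Real.sin θ / u θ := by
      rw [mul_assoc 2 r t, mul_assoc 2, mul_div_mul_left _ _ two_ne_zero]
      simp only [hu, mul_assoc]
    rwa [h3] at h2
  have hinj : InjOn u (Ioo 0 Real.pi) := by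
    intro θ hθ φ hφ h
    have h1 : u θ ^ 2 = u φ ^ 2 := by rw [h]
    rw [husq θ hθ, husq φ hφ] at h1
    have h2 : Real.cos θ = Real.cos φ := by
      have : r * t * (Real.cos θ - Real.cos φ) = 0 := by linarith
      rcases mul_eq_zero.1 this with h | h
      · exact absurd h hrt.ne'
      · linarith
    exact Real.injOn_cos ⟨hθ.1.le, hθ.2.le⟩ ⟨hφ.1.le, hφ.2.le⟩ h2
  have himage : u '' Ioo 0 Real.pi ⊆ Ioo |r - t| (r + t) := by
    rintro _ ⟨θ, hθ, rfl⟩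
    refine ⟨?_, ?_⟩
    · rw [← Real.sqrt_sq_eq_abs]
      exact Real.sqrt_lt_sqrt (sq_nonneg _) (harg θ hθ).1
    · rw [← Real.sqrt_sq (by positivity : 0 ≤ r + t)]
      exact Real.sqrt_lt_sqrt (hpos θ hθ).le (harg θ hθ).2
  refine le_trans (le_of_eq ?_) (lintegral_mono_set himage)
  rw [lintegral_image_eq_lintegral_abs_deriv_mul measurableSet_Ioo hderiv hinj]
  refine setLIntegral_congr_fun measurableSet_Ioo fun θ hθ => ?_
  have hsin : 0 < Real.sin θ := Real.sin_pos_of_mem_Ioo hθ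
  have hw : sinAngle r t (u θ) = Real.sin θ := by
    rw [sinAngle, husq θ hθ, show ((r + t) ^ 2 - (r ^ 2 + t ^ 2 - 2 * r * t * Real.cos θ)) *
      (r ^ 2 + t ^ 2 - 2 * r * t * Real.cos θ - (r - t) ^ 2) =
      (2 * r * t) ^ 2 * (1 - Real.cos θ ^ 2) by ring, ← Real.sin_sq, ← mul_pow,
      Real.sqrt_sq (by positivity)]
    field_simp
  have hu0 := hupos θ hθ
  rw [← mul_assoc, ← ENNReal.ofReal_mul (abs_nonneg _), radialKernel, hw, abs_of_pos (by positivity)]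
  congr 2
  field_simp

theorem lintegral_sphere_le (k : ℕ) : ∃ c : ℝ≥0∞, c ≠ ∞ ∧
    ∀ F : ℝ → ℝ≥0∞, Measurable F → ∀ (x : Euc k) (t : ℝ), x ≠ 0 → 0 < t →
      ∫⁻ y, F ‖x - t • (y : Euc k)‖ ∂(sphereMeasure (k + 2)) ≤
        c * ∫⁻ s in Ioo |‖x‖ - t| (‖x‖ + t), ENNReal.ofReal (radialKernel k ‖x‖ t s) * F s := by
  obtain ⟨c, -, hc, h⟩ := lintegral_sphere_norm_sub k
  refine ⟨c, hc, fun F hF x t hx ht => ?_⟩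
  rw [h F hF]
  exact mul_le_mul' le_rfl (lintegral_angle_le k (norm_pos_iff.2 hx) ht F)

/-- In polar coordinates `f` is a.e. measurable on almost every ray, and by radiality any such ray
carries the profile. The density `s^{k+1}` is positive on `(0, ∞)`, so null sets for the radial
measure are Lebesgue null there. -/
theorem aestronglyMeasurable_radial {k : ℕ} {f : Euc k → ℂ}
    (hrad : IsRadial f) (hf : AEStronglyMeasurable f volume) :
    AEStronglyMeasurable (fun s : ℝ => f (s • EuclideanSpace.single 0 1))
      (volume.restrict (Ioi 0)) := by
  set μ : Measure (Euc k) := volume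
  have hv : MeasurableEmbedding (Subtype.val : ({0}ᶜ : Set (Euc k)) → (Euc k)) :=
    MeasurableEmbedding.subtype_coe (measurableSet_singleton _).compl
  have h1 : AEStronglyMeasurable (fun x : ({0}ᶜ : Set (Euc k)) => f x) (μ.comap (↑)) := by
    have : AEStronglyMeasurable f ((μ.comap (Subtype.val : ({0}ᶜ : Set (Euc k)) → (Euc k))).map (↑)) := by
      rw [map_comap_subtype_coe (measurableSet_singleton _).compl]
      exact hf.restrict
    exact this.comp_measurable hv.measurable
  have h2 := h1.comp_measurePreserving
    (MeasurePreserving.symm (homeomorphUnitSphereProd (Euc k)).toMeasurableEquiv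
      μ.measurePreserving_homeomorphUnitSphereProd)
  have h3 := h2.prodMk_left
  have : NeZero μ.toSphere := ⟨Measure.toSphere_ne_zero μ⟩
  obtain ⟨y, hy⟩ := h3.exists
  set g : ℝ → ℂ := fun s => f (s • EuclideanSpace.single 0 1)
  have h4 : AEStronglyMeasurable (fun s : Ioi (0 : ℝ) => g s)
      (Measure.volumeIoiPow (Module.finrank ℝ (Euc k) - 1)) := by
    refine hy.congr (Filter.Eventually.of_forall fun s => ?_)
    refine hrad _ _ ?_
    have : ((homeomorphUnitSphereProd (Euc k)).symm (y, s) : (Euc k)) = (s : ℝ) • (y : (Euc k)) :=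
      homeomorphUnitSphereProd_symm_apply_coe (Euc k) (y, s)
    change ‖((homeomorphUnitSphereProd (Euc k)).symm (y, s) : (Euc k))‖ = _
    rw [this, norm_smul, norm_smul]
    simp
  have h5 : AEStronglyMeasurable (fun s : Ioi (0 : ℝ) => g s)
      (Measure.comap Subtype.val volume) := by
    refine h4.mono_ac (withDensity_absolutelyContinuous' (by fun_prop) ?_)
    refine Filter.Eventually.of_forall fun s => ?_
    have : 0 < (s : ℝ) := s.2
    rw [Ne, ENNReal.ofReal_eq_zero, not_le]
    positivity
  rw [← map_comap_subtype_coe measurableSet_Ioi,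
    (MeasurableEmbedding.subtype_coe measurableSet_Ioi).aestronglyMeasurable_map_iff]
  exact h5

/-- A radial function in `L^p` is given almost everywhere by a measurable profile, and its
spherical means are dominated by those of the profile away from the origin. -/
theorem exists_profile {k : ℕ} {p : ℝ} (hp : 0 < p) {f : Euc k → ℂ}
    (hrad : IsRadial f) (hf : AEStronglyMeasurable f volume) :
    ∃ F : ℝ → ℝ≥0∞, Measurable F ∧
      (∀ x : Euc k, x ≠ 0 → ∀ t : ℝ, 0 < t → absSphericalMean t f x ≤
        ∫⁻ y, F ‖x - t • (y : Euc k)‖ ∂(sphereMeasure (k + 2))) ∧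
      ∫⁻ x : Euc k, F ‖x‖ ^ p =
        eLpNorm f (ENNReal.ofReal p) volume ^ p := by
  set g : ℝ → ℂ := fun s => f (s • EuclideanSpace.single 0 1)
  have hfg : ∀ x : Euc k, f x = g ‖x‖ := fun x => hrad _ _ (by simp [norm_smul])
  obtain ⟨h, hh, hgh⟩ := aestronglyMeasurable_radial hrad hf
  -- A measurable null set of bad radii; `0` is added because `g` and `h` are compared only at
  -- positive radii.
  set Z := toMeasurable volume ({s : ℝ | ¬(s ∈ Ioi (0 : ℝ) → g s = h s)} ∪ {0})
  have hZ : MeasurableSet Z := measurableSet_toMeasurable _ _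
  have hnull : volume Z = 0 := by
    rw [measure_toMeasurable, measure_union_null_iff]
    rw [Filter.EventuallyEq, ae_restrict_iff' measurableSet_Ioi] at hgh
    exact ⟨hgh, by simp⟩
  have hgood : ∀ s : ℝ, 0 ≤ s → s ∉ Z → g s = h s := by
    intro s hs hsZ
    by_contra hne
    refine hsZ (subset_toMeasurable _ _ ?_)
    rcases hs.eq_or_lt with rfl | hs
    · exact Or.inr rfl
    · exact Or.inl fun h' => hne (h' hs)
  have hF : Measurable fun s => ‖h s‖ₑ := hh.measurable.enorm
  refine ⟨fun s => ‖h s‖ₑ, hF, fun x hx t ht => ?_, ?_⟩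
  -- For `x ≠ 0` and `t > 0` the distribution of `‖x - t y‖` is absolutely continuous, so almost no
  -- point of the translated sphere has a bad radius.
  · have hae : ∀ᵐ y : Metric.sphere (0 : Euc k) 1 ∂(sphereMeasure (k + 2)),
        f (x - t • (y : Euc k)) = h ‖x - t • (y : Euc k)‖ := by
      obtain ⟨c, -, hc⟩ := lintegral_sphere_le k
      have h0 := hc (Z.indicator 1) (measurable_one.indicator hZ) x t hx ht
      have h1 : ∫⁻ s in Ioo |‖x‖ - t| (‖x‖ + t),
          ENNReal.ofReal (radialKernel k ‖x‖ t s) * Z.indicator 1 s = 0 := by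
        rw [lintegral_eq_zero_iff']
        · refine ae_restrict_of_ae ?_
          have : ∀ᵐ s : ℝ, s ∉ Z := measure_eq_zero_iff_ae_notMem.1 hnull
          filter_upwards [this] with s hs
          simp [hs]
        · refine Measurable.aemeasurable (Measurable.mul ?_ (measurable_one.indicator hZ))
          unfold radialKernel sinAngle
          fun_prop
      rw [h1, mul_zero, nonpos_iff_eq_zero, lintegral_eq_zero_iff] at h0
      · filter_upwards [h0] with y hy
        rw [hfg]
        refine hgood _ (norm_nonneg _) fun hyZ => ?_
        simp [hyZ] at hy
      · exact (measurable_one.indicator hZ).comp (by fun_prop)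
    have hm : AEStronglyMeasurable (fun y : Metric.sphere (0 : Euc k) 1 => f (x - t • (y : Euc k)))
        (sphereMeasure (k + 2)) := by
      refine AEStronglyMeasurable.congr ?_ (hae.mono fun y hy => hy.symm)
      exact (hh.comp_measurable (by fun_prop)).aestronglyMeasurable
    have he : ∫⁻ y, ‖h ‖x - t • (y : Euc k)‖‖ₑ ∂(sphereMeasure (k + 2)) =
        ∫⁻ y : Metric.sphere (0 : Euc k) 1, ‖f (x - t • (y : Euc k))‖ₑ ∂(sphereMeasure (k + 2)) :=
      lintegral_congr_ae (hae.mono fun y hy => by simp only [hy])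
    rw [he, absSphericalMean]
    split_ifs with hi
    · exact enorm_integral_le_lintegral_enorm _
    -- If the mean is infinite by convention, measurability leaves only divergence of the integral
    -- of the norm, so the right side is infinite too.
    · rw [Integrable, not_and] at hi
      rw [← not_lt_top_iff.1 (hi hm)]
  · have hae : ∀ᵐ x : Euc k, f x = h ‖x‖ := by
      have h0 := lintegral_norm_eq (volume : Measure (Euc k)) (measurable_one.indicator hZ)
      have h1 : ∫⁻ s in Ioi (0 : ℝ), ENNReal.ofReal (s ^ (Module.finrank ℝ (Euc k) - 1)) *
          Z.indicator 1 s = 0 := by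
        rw [lintegral_eq_zero_iff']
        · refine ae_restrict_of_ae ?_
          have : ∀ᵐ s : ℝ, s ∉ Z := measure_eq_zero_iff_ae_notMem.1 hnull
          filter_upwards [this] with s hs
          simp [hs]
        · exact Measurable.aemeasurable (Measurable.mul (by fun_prop)
            (measurable_one.indicator hZ))
      rw [h1, mul_zero, lintegral_eq_zero_iff] at h0
      · filter_upwards [h0] with y hy
        rw [hfg]
        refine hgood _ (norm_nonneg _) fun hyZ => ?_
        simp [hyZ] at hy
      · exact (measurable_one.indicator hZ).comp (by fun_prop)
    rw [eLpNorm_eq_lintegral_rpow_enorm_toReal (by simpa using hp) ENNReal.ofReal_ne_top,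
      ENNReal.toReal_ofReal hp.le, ← ENNReal.rpow_mul, one_div, inv_mul_cancel₀ hp.ne',
      ENNReal.rpow_one]
    exact lintegral_congr_ae (hae.mono fun x hx => by simp only [hx])

/-! ### Bounds for the radial kernel -/

theorem sinAngle_nonneg {r t : ℝ} (hr : 0 < r) (ht : 0 < t) (s : ℝ) : 0 ≤ sinAngle r t s := by
  unfold sinAngle
  positivity

theorem sinAngle_le_one {r t s : ℝ} (hr : 0 < r) (ht : 0 < t) : sinAngle r t s ≤ 1 := by
  rw [sinAngle, div_le_one (by positivity)]
  refine Real.sqrt_le_iff.2 ⟨by positivity, ?_⟩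
  nlinarith [sq_nonneg (((r + t) ^ 2 - s ^ 2) - (s ^ 2 - (r - t) ^ 2))]

theorem pow_succ_div_le {w : ℝ} (hw : 0 ≤ w) (k : ℕ) : w ^ (k + 1) / w ≤ w ^ k := by
  rcases hw.eq_or_lt with rfl | hw
  · simp
  · rw [pow_succ, mul_div_cancel_right₀ _ hw.ne']

theorem radialKernel_zero {r t s : ℝ} (hr : 0 < r) (ht : 0 < t) :
    radialKernel 0 r t s =
      2 * s / √(((r + t) ^ 2 - s ^ 2) * (s ^ 2 - (r - t) ^ 2)) := by
  rw [radialKernel, sinAngle, pow_zero, one_div_div]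
  rcases eq_or_ne (√(((r + t) ^ 2 - s ^ 2) * (s ^ 2 - (r - t) ^ 2))) 0 with h | h
  · simp [h]
  · field_simp

/-- The kernel near its singularity at `s = |r - t|`, for `s` small compared to `t`. -/
theorem radialKernel_le_of_lt_quarter (k : ℕ) {r t s : ℝ} (hr : 0 < r) (ht : 0 < t)
    (h1 : |r - t| < s) (h2 : s < t / 4) :
    radialKernel k r t s ≤
      2 ^ (k + 1) * s ^ k / t ^ (k + 1) * (s / (s - |r - t|)) ^ (1 / (k + 2 : ℝ)) := by
  set ρ := |r - t| with hρ
  have hρ0 : 0 ≤ ρ := abs_nonneg _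
  have hρsq : (r - t) ^ 2 = ρ ^ 2 := (sq_abs _).symm
  have hs : 0 < s := hρ0.trans_lt h1
  have hv : 0 < s - ρ := by linarith
  have hrt := abs_le.1 (le_refl |r - t|)
  rw [← hρ] at hrt
  have hone : 1 ≤ s / (s - ρ) := by rw [one_le_div hv]; linarith
  -- Only the planar kernel (`k = 0`) is singular, with exponent `1/2`. For larger `k` it is bounded
  -- by the first factor, and the last factor is at least `1`; the common exponent `1/(k+2)` treats
  -- all dimensions at once.
  rcases k with _ | k
  · rw [radialKernel_zero hr ht]
    have e1 : (t ^ 2) * (s * (s - ρ)) ≤ ((r + t) ^ 2 - s ^ 2) * (s ^ 2 - (r - t) ^ 2) := by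
      rw [hρsq]
      have a1 : t ^ 2 ≤ (r + t) ^ 2 - s ^ 2 := by nlinarith
      have a2 : s * (s - ρ) ≤ s ^ 2 - ρ ^ 2 := by nlinarith
      exact mul_le_mul a1 a2 (by positivity) (by nlinarith)
    have e2 : t * √(s * (s - ρ)) ≤ √(((r + t) ^ 2 - s ^ 2) * (s ^ 2 - (r - t) ^ 2)) := by
      rw [← Real.sqrt_sq ht.le, ← Real.sqrt_mul (sq_nonneg _)]
      refine Real.sqrt_le_sqrt ?_
      rwa [Real.sqrt_sq ht.le]
    have e3 : (s / (s - ρ)) ^ (1 / ((0 : ℕ) + 2 : ℝ)) = s / √(s * (s - ρ)) := by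
      rw [CharP.cast_eq_zero, zero_add, ← Real.sqrt_eq_rpow, Real.sqrt_div hs.le,
        Real.sqrt_mul hs.le]
      have := Real.sqrt_pos.2 hs
      have := Real.sqrt_pos.2 hv
      field_simp
      exact Real.sq_sqrt hs.le
    rw [e3]
    have hpos : 0 < √(s * (s - ρ)) := Real.sqrt_pos.2 (by positivity)
    calc 2 * s / √(((r + t) ^ 2 - s ^ 2) * (s ^ 2 - (r - t) ^ 2))
        ≤ 2 * s / (t * √(s * (s - ρ))) := by gcongr
      _ = _ := by field_simp; ring
  · have hw : sinAngle r t s ≤ 2 * s / t := by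
      rw [sinAngle, div_le_div_iff₀ (by positivity) ht]
      have : √(((r + t) ^ 2 - s ^ 2) * (s ^ 2 - (r - t) ^ 2)) ≤ (r + t) * s := by
        refine Real.sqrt_le_iff.2 ⟨by positivity, ?_⟩
        rw [mul_pow]
        refine mul_le_mul (by nlinarith [sq_nonneg s]) (by nlinarith [sq_nonneg (r - t)]) ?_ (by positivity)
        rw [hρsq]
        nlinarith
      nlinarith [mul_pos hs ht]
    have hw0 := sinAngle_nonneg hr ht s
    have hsrt : s / (r * t) ≤ 2 * s / t ^ 2 := by
      rw [div_le_div_iff₀ (by positivity) (by positivity)]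
      nlinarith [mul_pos hs ht]
    calc radialKernel (k + 1) r t s ≤ sinAngle r t s ^ k * (s / (r * t)) := by
          rw [radialKernel]
          gcongr
          exact pow_succ_div_le hw0 k
      _ ≤ (2 * s / t) ^ k * (2 * s / t ^ 2) := by gcongr
      _ ≤ 2 ^ (k + 1 + 1) * s ^ (k + 1) / t ^ (k + 1 + 1) := by
          rw [div_pow, mul_pow, div_mul_div_comm, ← pow_add]
          gcongr ?_ / _
          have : 0 < 2 ^ k * s ^ k * s := by positivity
          rw [pow_succ, pow_succ, pow_succ]
          nlinarith
      _ ≤ _ := le_mul_of_one_le_right (by positivity) (Real.one_le_rpow hone (by positivity))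

/-- The kernel in terms of the distance to its singularities. -/
theorem radialKernel_le_min (k : ℕ) {r t s : ℝ} (hr : 0 < r) (ht : 0 < t)
    (h1 : |r - t| < s) (h2 : s < r + t) :
    min (s - |r - t|) (r + t - s) ≤ min r t ∧
    radialKernel k r t s ≤
      2 / min r t * (min r t / min (s - |r - t|) (r + t - s)) ^ (1 / (k + 2 : ℝ)) := by
  set ρ := |r - t| with hρ
  set m := min r t with hm
  set v := min (s - ρ) (r + t - s) with hv
  have hρ0 : 0 ≤ ρ := abs_nonneg _
  have hρsq : (r - t) ^ 2 = ρ ^ 2 := (sq_abs _).symm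
  have hs : 0 < s := hρ0.trans_lt h1
  have hm0 : 0 < m := lt_min hr ht
  have hv0 : 0 < v := lt_min (by linarith) (by linarith)
  -- The endpoints `|r-t|` and `r+t` are `2 min(r,t)` apart: the smaller distance to an endpoint is
  -- at most `m` and the larger at least `m`.
  have hsum : (s - ρ) + (r + t - s) = 2 * m := by
    rcases le_total r t with h | h
    · rw [hm, min_eq_left h, hρ, abs_of_nonpos (by linarith)]; ring
    · rw [hm, min_eq_right h, hρ, abs_of_nonneg (by linarith)]; ring
  have hvm : v ≤ m := by
    have := min_le_left (s - ρ) (r + t - s)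
    have := min_le_right (s - ρ) (r + t - s)
    rw [hv]
    linarith
  refine ⟨hvm, ?_⟩
  have hprod : v * m ≤ (s - ρ) * (r + t - s) := by
    have : (s - ρ) * (r + t - s) = v * (2 * m - v) := by
      rcases le_total (s - ρ) (r + t - s) with h | h
      · rw [hv, min_eq_left h, ← hsum]; ring
      · rw [hv, min_eq_right h, ← hsum]; ring
    rw [this]
    gcongr
    linarith
  have hone : 1 ≤ m / v := by rwa [one_le_div hv0]
  rcases k with _ | k
  · rw [radialKernel_zero hr ht]
    have e1 : s ^ 2 * (v * m) ≤ ((r + t) ^ 2 - s ^ 2) * (s ^ 2 - (r - t) ^ 2) := by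
      rw [hρsq, show ((r + t) ^ 2 - s ^ 2) * (s ^ 2 - ρ ^ 2) =
        ((r + t + s) * (s + ρ)) * ((s - ρ) * (r + t - s)) by ring]
      refine mul_le_mul (by nlinarith) hprod (by positivity) (by positivity)
    have e2 : s * √(v * m) ≤ √(((r + t) ^ 2 - s ^ 2) * (s ^ 2 - (r - t) ^ 2)) := by
      refine Real.le_sqrt_of_sq_le ?_
      rwa [mul_pow, Real.sq_sqrt (by positivity)]
    have e3 : (m / v) ^ (1 / ((0 : ℕ) + 2 : ℝ)) = m / √(v * m) := by
      rw [CharP.cast_eq_zero, zero_add, ← Real.sqrt_eq_rpow, Real.sqrt_div hm0.le,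
        Real.sqrt_mul hv0.le]
      have := Real.sqrt_pos.2 hm0
      have := Real.sqrt_pos.2 hv0
      field_simp
      exact Real.sq_sqrt hm0.le
    rw [e3]
    have hpos : 0 < √(v * m) := Real.sqrt_pos.2 (by positivity)
    calc 2 * s / √(((r + t) ^ 2 - s ^ 2) * (s ^ 2 - (r - t) ^ 2))
        ≤ 2 * s / (s * √(v * m)) := by gcongr
      _ = _ := by field_simp
  · have hw0 := sinAngle_nonneg hr ht s
    have hw1 : sinAngle r t s ≤ 1 := sinAngle_le_one hr ht
    calc radialKernel (k + 1) r t s ≤ sinAngle r t s ^ k * (s / (r * t)) := by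
          rw [radialKernel]
          gcongr
          exact pow_succ_div_le hw0 k
      _ ≤ 1 * (2 / m) := by
          refine mul_le_mul (pow_le_one₀ hw0 hw1) ?_ (by positivity) zero_le_one
          rw [div_le_div_iff₀ (by positivity) hm0]
          rcases le_total r t with h | h
          · rw [hm, min_eq_left h]; nlinarith
          · rw [hm, min_eq_right h]; nlinarith
      _ = 2 / m := one_mul _
      _ ≤ _ := le_mul_of_one_le_right (by positivity) (Real.one_le_rpow hone (by positivity))

/-! ### Dyadic intervals -/

/-- The dyadic interval `[a 2^i, (a + 1) 2^i)`. -/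
def dyadicInterval (i a : ℤ) : Set ℝ := Ico (a * 2 ^ i) ((a + 1) * 2 ^ i)

theorem mem_dyadicInterval {i a : ℤ} {s : ℝ} : s ∈ dyadicInterval i a ↔ ⌊s / 2 ^ i⌋ = a := by
  have : (0 : ℝ) < 2 ^ i := by positivity
  rw [Int.floor_eq_iff, dyadicInterval, mem_Ico, le_div_iff₀ this, div_lt_iff₀ this]

theorem measurableSet_dyadicInterval (i a : ℤ) : MeasurableSet (dyadicInterval i a) :=
  measurableSet_Ico

theorem volume_dyadicInterval (i a : ℤ) : volume (dyadicInterval i a) = twoPow i := by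
  rw [dyadicInterval, Real.volume_Ico, twoPow_intCast]
  congr 1
  ring

theorem pairwise_disjoint_dyadicInterval (i : ℤ) :
    Pairwise (Function.onFun Disjoint (dyadicInterval i)) := by
  intro a b hab
  refine disjoint_left.2 fun s hs hs' => hab ?_
  rw [mem_dyadicInterval] at hs hs'
  exact hs.symm.trans hs'

theorem iUnion_dyadicInterval (i : ℤ) : ⋃ a, dyadicInterval i a = univ := by
  refine eq_univ_of_forall fun s => mem_iUnion.2 ⟨⌊s / 2 ^ i⌋, mem_dyadicInterval.2 rfl⟩

/-- The integral of `F` over a dyadic interval. -/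
noncomputable def mass (F : ℝ → ℝ≥0∞) (i a : ℤ) : ℝ≥0∞ := ∫⁻ s in dyadicInterval i a, F s

theorem lintegral_rpow_le_of_one_le {X : Type*} [MeasurableSpace X] {ν : Measure X} {p : ℝ}
    (hp : 1 ≤ p) {F : X → ℝ≥0∞} (hF : Measurable F) :
    (∫⁻ s, F s ∂ν) ^ p ≤ ν univ ^ (p - 1) * ∫⁻ s, F s ^ p ∂ν := by
  rcases hp.eq_or_lt with rfl | hp
  · simp
  have hp0 : 0 < p := by linarith
  have hq := Real.HolderConjugate.conjExponent hp
  have h := ENNReal.lintegral_mul_le_Lp_mul_Lq ν hq hF.aemeasurable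
    (aemeasurable_const (b := (1 : ℝ≥0∞)))
  simp only [Pi.mul_apply, mul_one, ENNReal.one_rpow, lintegral_one] at h
  refine (ENNReal.rpow_le_rpow h hp0.le).trans ?_
  rw [ENNReal.mul_rpow_of_nonneg _ _ hp0.le, ← ENNReal.rpow_mul, ← ENNReal.rpow_mul,
    one_div_mul_cancel hp0.ne', ENNReal.rpow_one, mul_comm]
  refine mul_le_mul' (le_of_eq ?_) le_rfl
  rw [one_div_mul_eq_div, (div_eq_iff hq.symm.pos.ne').2 hq.sub_one_mul_conj.symm]

theorem mass_rpow_le {p : ℝ} (hp : 1 ≤ p) {F : ℝ → ℝ≥0∞} (hF : Measurable F) (i a : ℤ) :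
    mass F i a ^ p ≤ twoPow (i * (p - 1)) * ∫⁻ s in dyadicInterval i a, F s ^ p := by
  refine (lintegral_rpow_le_of_one_le hp hF).trans ?_
  rw [Measure.restrict_apply_univ, volume_dyadicInterval, twoPow_rpow]

theorem tsum_mass_rpow_le {p : ℝ} (hp : 1 ≤ p) {F : ℝ → ℝ≥0∞} (hF : Measurable F) (i : ℤ) :
    ∑' a, mass F i a ^ p ≤ twoPow (i * (p - 1)) * ∫⁻ s, F s ^ p := by
  refine (ENNReal.tsum_le_tsum fun a => mass_rpow_le hp hF i a).trans ?_
  rw [ENNReal.tsum_mul_left, ← lintegral_iUnion (measurableSet_dyadicInterval i)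
    (pairwise_disjoint_dyadicInterval i), iUnion_dyadicInterval, setLIntegral_univ]

/-- Integration against a power singularity at `c`, in terms of dyadic intervals near `c`. -/
theorem lintegral_singular_le {κ δ : ℝ} (hκ : 0 < κ) (hδ : 0 < δ) : ∃ C : ℝ≥0∞, C ≠ ∞ ∧
    ∀ (F : ℝ → ℝ≥0∞) (c : ℝ) (i₀ : ℤ),
      ∫⁻ s in {s : ℝ | |s - c| < 2 ^ (i₀ + 1)}, ENNReal.ofReal ((2 ^ i₀ / |s - c|) ^ κ) * F s ≤
        C * ⨆ (l : ℕ) (a : ℤ) (_ : |c - a * 2 ^ (i₀ - l)| ≤ 3 * 2 ^ (i₀ - l)),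
          twoPow (l * (κ + δ)) * mass F (i₀ - l) a := by
  refine ⟨(∑' l : ℕ, twoPow (-(l * δ))) * 5, ENNReal.mul_ne_top (tsum_twoPow_lt_top hδ).ne
    (by simp), fun F c i₀ => ?_⟩
  set P : ℕ → Set ℝ := fun l =>
    {s | (2 : ℝ) ^ (i₀ - l) ≤ |s - c| ∧ |s - c| < 2 ^ (i₀ - l + 1)} with hP
  have hcover : {s : ℝ | |s - c| < 2 ^ (i₀ + 1)} ⊆ {c} ∪ ⋃ l, P l := by
    intro s hs
    rcases eq_or_ne s c with rfl | hne
    · exact Or.inl rfl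
    · right
      obtain ⟨i, hi1, hi2⟩ := exists_mem_Ico_zpow (abs_pos.2 (sub_ne_zero.2 hne))
        (one_lt_two : (1 : ℝ) < 2)
      have hi : i < i₀ + 1 := (zpow_lt_zpow_iff_right₀ (one_lt_two : (1 : ℝ) < 2)).1
        (lt_of_le_of_lt hi1 hs)
      have e : i₀ - ((i₀ - i).toNat : ℤ) = i := by
        rw [Int.toNat_of_nonneg (by omega)]; ring
      refine mem_iUnion.2 ⟨(i₀ - i).toNat, ?_⟩
      simp only [hP, mem_ofPred_eq, e]
      exact ⟨hi1, hi2⟩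
  set Y : ℕ → ℝ≥0∞ := fun l =>
    ⨆ (a : ℤ) (_ : |c - a * 2 ^ (i₀ - l)| ≤ 3 * 2 ^ (i₀ - l)),
      twoPow (l * κ) * mass F (i₀ - l) a with hY
  have hpiece : ∀ l : ℕ, ∫⁻ s in P l, ENNReal.ofReal ((2 ^ i₀ / |s - c|) ^ κ) * F s ≤ 5 * Y l := by
    intro l
    set i : ℤ := i₀ - l with hi
    have h2i : (0 : ℝ) < 2 ^ i := by positivity
    set a₀ := ⌊c / 2 ^ i⌋ with ha₀
    -- As `|s - c| < 2 · 2^i`, the dyadic index of `s` differs from that of `c` by at most `2`.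
    have hsub : P l ⊆ ⋃ b ∈ Finset.Icc (-2 : ℤ) 2, dyadicInterval i (a₀ + b) := by
      rintro s ⟨-, hs⟩
      rw [← hi, zpow_add_one₀ two_ne_zero, abs_lt] at hs
      have e1 : s / 2 ^ i < c / 2 ^ i + 2 := by
        rw [div_add' _ _ _ h2i.ne']
        gcongr
        linarith
      have e2 : c / 2 ^ i - 2 < s / 2 ^ i := by
        rw [div_sub' h2i.ne']
        gcongr
        linarith
      have f1 : ⌊s / 2 ^ i⌋ ≤ a₀ + 2 := by
        rw [ha₀, ← Int.floor_add_ofNat]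
        exact Int.floor_le_floor e1.le
      have f2 : a₀ - 2 ≤ ⌊s / 2 ^ i⌋ := by
        rw [ha₀, ← Int.floor_sub_ofNat]
        exact Int.floor_le_floor e2.le
      refine mem_biUnion (x := ⌊s / 2 ^ i⌋ - a₀) (by simp; omega) ?_
      rw [mem_dyadicInterval]
      ring
    have hker : ∀ s ∈ P l, (2 ^ i₀ / |s - c|) ^ κ ≤ (2 : ℝ) ^ (l * κ) := by
      rintro s ⟨hs, -⟩
      have e : (2 : ℝ) ^ i₀ = 2 ^ l * 2 ^ i := by
        rw [hi, ← zpow_natCast, ← zpow_add₀ two_ne_zero]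
        congr 1
        ring
      rw [Real.rpow_mul (by norm_num), Real.rpow_natCast]
      have hpos := h2i.trans_le hs
      gcongr
      rw [div_le_iff₀ hpos, e]
      gcongr
    have hPm : MeasurableSet (P l) :=
      (by fun_prop : Measurable fun s : ℝ => |s - c|) measurableSet_Ico
    calc ∫⁻ s in P l, ENNReal.ofReal ((2 ^ i₀ / |s - c|) ^ κ) * F s
        ≤ ∫⁻ s in P l, twoPow (l * κ) * F s := by
          refine setLIntegral_mono' hPm fun s hs => ?_
          rw [twoPow_eq_ofReal]
          gcongr
          exact hker s hs
      _ = twoPow (l * κ) * ∫⁻ s in P l, F s := lintegral_const_mul' _ _ (twoPow_ne_top _)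
      _ ≤ twoPow (l * κ) * ∑ b ∈ Finset.Icc (-2 : ℤ) 2, mass F i (a₀ + b) := by
          gcongr
          refine (lintegral_mono_set hsub).trans ?_
          rw [lintegral_biUnion_finset (t := fun b => dyadicInterval i (a₀ + b)) (fun b _ b' _ hbb' =>
            pairwise_disjoint_dyadicInterval i (by simpa using hbb'))
            fun b _ => measurableSet_dyadicInterval i _]
          exact le_rfl
      _ ≤ ∑ b ∈ Finset.Icc (-2 : ℤ) 2, Y l := by
          rw [Finset.mul_sum]
          refine Finset.sum_le_sum fun b hb => ?_
          refine le_trans ?_ (le_iSup₂ (f := fun (a : ℤ)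
            (_ : |c - a * 2 ^ (i₀ - l)| ≤ 3 * 2 ^ (i₀ - l)) =>
            twoPow (l * κ) * mass F (i₀ - l) a) (a₀ + b) ?_)
          · exact le_rfl
          · rw [← hi]
            have g1 := Int.floor_le (c / 2 ^ i)
            have g2 := (Int.lt_floor_add_one (c / 2 ^ i)).le
            rw [← ha₀, le_div_iff₀ h2i] at g1
            rw [← ha₀, div_le_iff₀ h2i] at g2
            rw [Finset.mem_Icc] at hb
            have b1 : (-2 : ℝ) ≤ b := by exact_mod_cast hb.1
            have b2 : (b : ℝ) ≤ 2 := by exact_mod_cast hb.2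
            rw [abs_le]
            push_cast
            constructor <;> nlinarith
      _ = 5 * Y l := by
          rw [Finset.sum_const, nsmul_eq_mul]
          rfl
  calc ∫⁻ s in {s : ℝ | |s - c| < 2 ^ (i₀ + 1)}, ENNReal.ofReal ((2 ^ i₀ / |s - c|) ^ κ) * F s
      ≤ ∫⁻ s in {c} ∪ ⋃ l, P l, ENNReal.ofReal ((2 ^ i₀ / |s - c|) ^ κ) * F s :=
        lintegral_mono_set hcover
    _ ≤ (∫⁻ s in {c}, ENNReal.ofReal ((2 ^ i₀ / |s - c|) ^ κ) * F s) +
        ∫⁻ s in ⋃ l, P l, ENNReal.ofReal ((2 ^ i₀ / |s - c|) ^ κ) * F s := lintegral_union_le _ _ _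
    _ ≤ 0 + ∑' l, ∫⁻ s in P l, ENNReal.ofReal ((2 ^ i₀ / |s - c|) ^ κ) * F s := by
        gcongr
        · simp
        · exact lintegral_iUnion_le _ _
    _ ≤ ∑' l, 5 * Y l := by
        rw [zero_add]
        exact ENNReal.tsum_le_tsum hpiece
    _ = 5 * ∑' l, Y l := ENNReal.tsum_mul_left
    _ ≤ 5 * ((∑' l : ℕ, twoPow (-(l * δ))) * ⨆ l : ℕ, twoPow (l * δ) * Y l) := by
        gcongr
        exact tsum_le_mul_iSup_twoPow δ Y
    _ = (∑' l : ℕ, twoPow (-(l * δ))) * 5 * ⨆ l : ℕ, twoPow (l * δ) * Y l := by ring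
    _ ≤ _ := by
        refine mul_le_mul' le_rfl (iSup_mono fun l => ?_)
        rw [hY]
        simp only [ENNReal.mul_iSup]
        refine iSup₂_mono fun a _ => ?_
        rw [← mul_assoc, twoPow_mul]
        refine le_of_eq ?_
        ring_nf

/-! ### Entropy numbers and volumes of radial sets -/

theorem exists_cover_grid {S : Set ℝ} {u v a : ℝ} (hS : S ⊆ Icc u v) (ha : 0 < a) :
    ∃ s : Finset ℝ, S ⊆ ⋃ c ∈ s, Icc c (c + a) := by
  classical
  refine ⟨(Finset.Icc ⌊u / a⌋ ⌊v / a⌋).image fun n : ℤ => (n : ℝ) * a, fun x hx => ?_⟩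
  have hfl1 := Int.floor_le (x / a)
  have hfl2 := Int.lt_floor_add_one (x / a)
  rw [le_div_iff₀ ha] at hfl1
  rw [div_lt_iff₀ ha] at hfl2
  have hx' := hS hx
  refine mem_biUnion (x := (⌊x / a⌋ : ℝ) * a) ?_ ⟨hfl1, by linarith⟩
  rw [Finset.mem_coe, Finset.mem_image]
  refine ⟨⌊x / a⌋, Finset.mem_Icc.2 ⟨?_, ?_⟩, rfl⟩
  · exact Int.floor_le_floor (by gcongr; exact hx'.1)
  · exact Int.floor_le_floor (by gcongr; exact hx'.2)

theorem exists_cover_card_eq {S : Set ℝ} {u v a : ℝ} (hS : S ⊆ Icc u v) (ha : 0 < a) :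
    ∃ s : Finset ℝ, s.card = entropyNumber S a ∧ S ⊆ ⋃ c ∈ s, Icc c (c + a) := by
  obtain ⟨s, hs⟩ := exists_cover_grid hS ha
  exact Nat.sInf_mem (s := {n : ℕ | ∃ s : Finset ℝ, s.card = n ∧ S ⊆ ⋃ c ∈ s, Icc c (c + a)})
    ⟨s.card, s, rfl, hs⟩

theorem entropyNumber_le {S : Set ℝ} {a : ℝ} {s : Finset ℝ} (h : S ⊆ ⋃ c ∈ s, Icc c (c + a)) :
    entropyNumber S a ≤ s.card :=
  Nat.sInf_le ⟨s, rfl, h⟩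

theorem dyadicPart_subset (E : Set ℝ) (m : ℤ) :
    dyadicPart E m ⊆ Icc ((2 : ℝ) ^ m) ((2 : ℝ) ^ (m + 1)) := inter_subset_left

/-- `b` is within `h` of one of `r - t`, `t - r`, `r + t`. -/
def Near (r t b h : ℝ) : Prop := |r - t - b| ≤ h ∨ |r - t + b| ≤ h ∨ |r + t - b| ≤ h

theorem near_of_abs_abs_sub_le {r t b h : ℝ} (H : |(|r - t|) - b| ≤ h) : Near r t b h := by
  rcases le_total t r with h1 | h1
  · left
    rwa [abs_of_nonneg (sub_nonneg.2 h1)] at H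
  · right; left
    rw [abs_of_nonpos (sub_nonpos.2 h1), ← abs_neg] at H
    convert H using 2
    ring

/-- Each covering interval of `E^m` confines `r` to three intervals, one per alternative in `Near`,
of half-width `3 · 2^i` plus the covering length `2^i`. This gives `3 · 8 = 24`. -/
theorem volume_near_le (E : Set ℝ) (m i : ℤ) (b : ℝ) :
    volume {r : ℝ | ∃ t ∈ dyadicPart E m, Near r t b (3 * 2 ^ i)} ≤
      24 * (entropyNumber (dyadicPart E m) (2 ^ i) : ℝ≥0∞) * twoPow i := by
  have h2 : (0 : ℝ) < 2 ^ i := by positivity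
  obtain ⟨s, hcard, hs⟩ := exists_cover_card_eq (dyadicPart_subset E m) h2
  have hsub : {r : ℝ | ∃ t ∈ dyadicPart E m, Near r t b (3 * 2 ^ i)} ⊆
      ⋃ c ∈ s, (Icc (c + b - 4 * 2 ^ i) (c + b + 4 * 2 ^ i) ∪
        (Icc (c - b - 4 * 2 ^ i) (c - b + 4 * 2 ^ i) ∪
        Icc (b - c - 4 * 2 ^ i) (b - c + 4 * 2 ^ i))) := by
    rintro r ⟨t, ht, hr⟩
    obtain ⟨c, hc, htc⟩ := mem_iUnion₂.1 (hs ht)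
    refine mem_iUnion₂.2 ⟨c, hc, ?_⟩
    obtain ⟨h3, h4⟩ := htc
    rcases hr with hr | hr | hr <;> rw [abs_le] at hr
    · exact Or.inl ⟨by linarith, by linarith⟩
    · exact Or.inr (Or.inl ⟨by linarith, by linarith⟩)
    · exact Or.inr (Or.inr ⟨by linarith, by linarith⟩)
  have hvol : ∀ y : ℝ, volume (Icc (y - 4 * 2 ^ i) (y + 4 * 2 ^ i)) = 8 * twoPow i := fun y => by
    rw [Real.volume_Icc, twoPow_intCast, show y + 4 * 2 ^ i - (y - 4 * 2 ^ i) = 8 * 2 ^ i by ring,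
      ENNReal.ofReal_mul (by norm_num)]
    simp
  calc _ ≤ ∑ c ∈ s, (8 * twoPow i + (8 * twoPow i + 8 * twoPow i)) := by
        refine (measure_mono hsub).trans ((measure_biUnion_finset_le _ _).trans ?_)
        refine Finset.sum_le_sum fun c _ => ?_
        refine (measure_union_le _ _).trans (add_le_add (hvol _).le ?_)
        exact (measure_union_le _ _).trans (add_le_add (hvol _).le (hvol _).le)
    _ = _ := by
        rw [Finset.sum_const, hcard, nsmul_eq_mul]
        ring

/-- The area of the unit sphere in dimension `k + 2`. -/
noncomputable def sphereArea (k : ℕ) : ℝ≥0∞ := (volume : Measure (Euc k)).toSphere univ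

theorem sphereArea_ne_top (k : ℕ) : sphereArea k ≠ ∞ := measure_ne_top _ _

theorem sphereArea_ne_zero (k : ℕ) : sphereArea k ≠ 0 := toSphere_univ_ne_zero _

theorem lintegral_radial (k : ℕ) {G : ℝ → ℝ≥0∞} (hG : Measurable G) :
    ∫⁻ x : Euc k, G ‖x‖ = sphereArea k * ∫⁻ s in Ioi (0 : ℝ), ENNReal.ofReal (s ^ (k + 1)) * G s := by
  rw [lintegral_norm_eq _ hG]
  simp [sphereArea]

/-- The radial density is at most `2^{u(k+1)}` for `s < 2^u`. Since `E` is arbitrary, `B` may be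
nonmeasurable and is replaced by a measurable hull. -/
theorem volume_radial_le (k : ℕ) (u : ℤ) (B : Set ℝ) :
    volume {x : Euc k | ‖x‖ < 2 ^ u ∧ ‖x‖ ∈ B} ≤
      sphereArea k * twoPow (u * (k + 1)) * volume B := by
  set B' := toMeasurable volume B
  have hB' : MeasurableSet B' := measurableSet_toMeasurable _ _
  have hm : MeasurableSet (Iio ((2 : ℝ) ^ u) ∩ B') := measurableSet_Iio.inter hB'
  calc volume {x : Euc k | ‖x‖ < 2 ^ u ∧ ‖x‖ ∈ B}
      ≤ volume ((fun x : Euc k => ‖x‖) ⁻¹' (Iio (2 ^ u) ∩ B')) :=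
        measure_mono fun x hx => ⟨hx.1, subset_toMeasurable _ _ hx.2⟩
    _ = ∫⁻ x : Euc k, (Iio ((2 : ℝ) ^ u) ∩ B').indicator 1 ‖x‖ := by
        rw [← lintegral_indicator_one (measurable_norm hm)]
        rfl
    _ = sphereArea k * ∫⁻ s in Ioi (0 : ℝ), ENNReal.ofReal (s ^ (k + 1)) *
          (Iio ((2 : ℝ) ^ u) ∩ B').indicator 1 s :=
        lintegral_radial k (measurable_one.indicator hm)
    _ ≤ sphereArea k * ∫⁻ s, twoPow (u * (k + 1)) * B'.indicator 1 s := by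
        refine mul_le_mul' le_rfl (le_trans ?_ (setLIntegral_le_lintegral (Ioi 0) _))
        refine setLIntegral_mono' measurableSet_Ioi fun s (hs : 0 < s) => ?_
        by_cases h : s ∈ Iio ((2 : ℝ) ^ u) ∩ B'
        · rw [indicator_of_mem h, indicator_of_mem h.2]
          gcongr
          rw [← Nat.cast_succ, mul_comm, twoPow_natCast_mul, twoPow_intCast,
            ← ENNReal.ofReal_pow (by positivity)]
          exact ENNReal.ofReal_le_ofReal (pow_le_pow_left₀ hs.le (le_of_lt h.1) _)
        · rw [indicator_of_notMem h]
          simp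
    _ = _ := by
        rw [lintegral_const_mul _ (measurable_one.indicator hB'), lintegral_indicator_one hB',
          measure_toMeasurable, mul_assoc]

/-- The points `x` with `|x| < 2^u` and some `t ∈ E^m` such that `b` is within `3 * 2^i` of one of
`±(|x| - t)`, `|x| + t`. -/
def nearSet (k : ℕ) (E : Set ℝ) (u m i : ℤ) (b : ℝ) : Set (Euc k) :=
  {x | ‖x‖ < 2 ^ u ∧ ‖x‖ ∈ {r : ℝ | ∃ t ∈ dyadicPart E m, Near r t b (3 * 2 ^ i)}}

theorem volume_nearSet_le (k : ℕ) (E : Set ℝ) (u m i : ℤ) (b : ℝ) :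
    volume (nearSet k E u m i b) ≤ 24 * sphereArea k * (twoPow (u * (k + 1)) *
      (entropyNumber (dyadicPart E m) (2 ^ i) : ℝ≥0∞) * twoPow i) := by
  refine (volume_radial_le k u _).trans ?_
  refine (mul_le_mul' le_rfl (volume_near_le E m i b)).trans (le_of_eq ?_)
  ring

/-! ### Consequences of the entropy condition -/

/-- The entropy condition with constant `A`. -/
def EntropyBound (k : ℕ) (p q : ℝ) (E : Set ℝ) (A : ℝ≥0∞) : Prop :=
  ∀ j : ℤ, ∑' n : ℕ, (entropyNumber (dyadicPart E (j + n)) ((2 : ℝ) ^ j) : ℝ≥0∞) ^ (q / p) *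
    twoPow (-(n * (k + 1) * q * (1 - 1 / p))) ≤ A

theorem entropySup_term_eq {k : ℕ} {p q : ℝ} (hp : 0 < p) (hq : 0 < q) (N n : ℕ) :
    ENNReal.ofReal ((N : ℝ) ^ (q / p) *
      (2 : ℝ) ^ (-((n : ℝ) * (((k + 2 : ℕ) : ℝ) - 1) * q * (1 - 1 / p)))) =
      (N : ℝ≥0∞) ^ (q / p) * twoPow (-(n * (k + 1) * q * (1 - 1 / p))) := by
  have hs : 0 < q / p := div_pos hq hp
  rw [ENNReal.ofReal_mul (by positivity), ← ENNReal.ofReal_rpow_of_nonneg (by positivity) hs.le,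
    ENNReal.ofReal_natCast, twoPow_eq_ofReal]
  congr 4
  push_cast
  ring

theorem entropySup_lt_top_iff {k : ℕ} {p q : ℝ} (hp : 0 < p) (hq : 0 < q) {E : Set ℝ} :
    entropySup (k + 2) p q E < ∞ ↔ ∃ A : ℝ≥0∞, A ≠ ∞ ∧ EntropyBound k p q E A := by
  unfold entropySup EntropyBound
  simp_rw [entropySup_term_eq hp hq]
  constructor
  · intro h
    refine ⟨_, ENNReal.rpow_ne_top_of_nonneg hq.le h.ne, fun j => ?_⟩
    rw [← ENNReal.rpow_inv_le_iff hq, ← one_div]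
    exact le_iSup (fun j : ℤ => (∑' n : ℕ,
      (entropyNumber (dyadicPart E (j + n)) ((2 : ℝ) ^ j) : ℝ≥0∞) ^ (q / p) *
        twoPow (-(n * (k + 1) * q * (1 - 1 / p)))) ^ (1 / q)) j
  · rintro ⟨A, hA, h⟩
    refine lt_of_le_of_lt (iSup_le fun j => ENNReal.rpow_le_rpow (h j) (by positivity))
      (ENNReal.rpow_lt_top_of_nonneg (by positivity) hA)

/-- Keeps one term of the series. This is all that the regions with `s ≥ t/4` need. -/
theorem EntropyBound.entropyNumber_le {k : ℕ} {p q : ℝ} (hp : 0 < p) (hq : 0 < q) {E : Set ℝ}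
    {A : ℝ≥0∞} (h : EntropyBound k p q E A) {i m : ℤ} (him : i ≤ m) :
    (entropyNumber (dyadicPart E m) ((2 : ℝ) ^ i) : ℝ≥0∞) ≤
      A ^ (p / q) * twoPow ((m - i) * ((k + 1) * (p - 1))) := by
  have h1 := (ENNReal.le_tsum (m - i).toNat).trans (h i)
  have e : ((m - i).toNat : ℤ) = m - i := Int.toNat_of_nonneg (by omega)
  have e' : ((m - i).toNat : ℝ) = m - i := by exact_mod_cast e
  rw [e, e', add_sub_cancel] at h1
  have h2 := ENNReal.rpow_le_rpow h1 (by positivity : 0 ≤ p / q)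
  rw [ENNReal.mul_rpow_of_nonneg _ _ (by positivity), ← ENNReal.rpow_mul,
    show q / p * (p / q) = 1 by field_simp, ENNReal.rpow_one, twoPow_rpow] at h2
  calc _ = (entropyNumber (dyadicPart E m) ((2 : ℝ) ^ i) : ℝ≥0∞) *
        twoPow (-((m - i) * (k + 1) * q * (1 - 1 / p)) * (p / q)) *
        twoPow ((m - i) * ((k + 1) * (p - 1))) := by
        rw [mul_assoc, twoPow_mul]
        have : -((m - i : ℝ) * (k + 1) * q * (1 - 1 / p)) * (p / q) +
            (m - i) * ((k + 1) * (p - 1)) = 0 := by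
          field_simp
          ring
        rw [this, twoPow_zero, mul_one]
    _ ≤ _ := by gcongr

/-- Sets at geometrically spaced radii, at a fixed scale `2^i`. -/
theorem levelIntegral_nearSet_le {k : ℕ} {p q : ℝ} (hp : 0 < p) (hpq : p ≤ q) {E : Set ℝ}
    {A : ℝ≥0∞} (hA : A ≠ ∞) (h : EntropyBound k p q E A) (v : ℤ) :
    ∃ C : ℝ≥0∞, C ≠ ∞ ∧ ∀ (c : ℝ≥0∞) (i : ℤ) (b : ℝ),
      levelIntegral volume p q (fun x => ⨆ n : ℕ, (nearSet k E (i + n + v) (i + n) i b).indicator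
        (fun _ => c * twoPow (-(n * (k + 1)))) x) ^ (p / q) ≤ C * (c ^ p * twoPow (i * (k + 2))) := by
  have hq : 0 < q := hp.trans_le hpq
  have hs : 0 < q / p := div_pos hq hp
  have hs' : 0 < p / q := div_pos hp hq
  obtain ⟨C, hC, H⟩ := levelIntegral_le_of_geometric (volume : Measure (Euc k)) hp hq
    (by positivity : (0 : ℝ) < k + 1)
  set D := 24 * sphereArea k * twoPow (v * (k + 1)) with hD
  have hDt : D ≠ ∞ := ENNReal.mul_ne_top (ENNReal.mul_ne_top (by simp) (sphereArea_ne_top k))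
    (twoPow_ne_top _)
  clear_value D
  refine ⟨(C * D ^ (q / p) * A) ^ (p / q), ?_, fun c i b => ?_⟩
  · refine ENNReal.rpow_ne_top_of_nonneg hs'.le (ENNReal.mul_ne_top (ENNReal.mul_ne_top hC ?_) hA)
    exact ENNReal.rpow_ne_top_of_nonneg hs.le hDt
  have key : levelIntegral volume p q (fun x => ⨆ n : ℕ, (nearSet k E (i + n + v) (i + n) i b).indicator
        (fun _ => c * twoPow (-(n * (k + 1)))) x) ≤
      C * D ^ (q / p) * A * (c ^ q * twoPow (i * (k + 2) * (q / p))) := by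
    refine (H c (fun n : ℕ => nearSet k E (i + n + v) (i + n) i b) _ fun x => le_rfl).trans ?_
    -- The heights give `2^{-n(k+1)q}` and the volumes `2^{n(k+1)q/p}`; together they are exactly
    -- the weight of the entropy series. The shift `v` enters only the constant.
    have hterm : ∀ n : ℕ, (c * twoPow (-(n * (k + 1)))) ^ q *
        volume (nearSet k E (i + n + v) (i + n) i b) ^ (q / p) ≤
        D ^ (q / p) * (c ^ q * twoPow (i * (k + 2) * (q / p))) *
        ((entropyNumber (dyadicPart E (i + n)) ((2 : ℝ) ^ i) : ℝ≥0∞) ^ (q / p) *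
          twoPow (-(n * (k + 1) * q * (1 - 1 / p)))) := by
      intro n
      have hv := ENNReal.rpow_le_rpow (volume_nearSet_le k E (i + n + v) (i + n) i b) hs.le
      refine (mul_le_mul' le_rfl hv).trans (le_of_eq ?_)
      have e1 : twoPow (((i + n + v : ℤ) : ℝ) * (k + 1)) =
          twoPow (v * (k + 1)) * twoPow ((i + n) * (k + 1)) := by
        rw [twoPow_mul]
        push_cast
        ring_nf
      rw [e1, show ∀ a b c d e : ℝ≥0∞, 24 * a * (b * c * d * e) = (24 * a * b) * (d * (c * e)) from
        fun a b c d e => by ring, ← hD, twoPow_mul, ENNReal.mul_rpow_of_nonneg _ _ hs.le,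
        ENNReal.mul_rpow_of_nonneg _ _ hs.le, ENNReal.mul_rpow_of_nonneg _ _ hq.le, twoPow_rpow,
        twoPow_rpow]
      have e2 : ∀ a b c x y z w : ℝ≥0∞, x * y = z * w →
          a * x * (b * (c * y)) = b * (a * z) * (c * w) := by
        intro a b c x y z w hxy
        calc a * x * (b * (c * y)) = a * b * c * (x * y) := by ring
          _ = _ := by rw [hxy]; ring
      refine e2 _ _ _ _ _ _ _ ?_
      rw [twoPow_mul, twoPow_mul]
      congr 1
      field_simp
      ring
    calc _ ≤ C * ∑' n : ℕ, D ^ (q / p) * (c ^ q * twoPow (i * (k + 2) * (q / p))) *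
        ((entropyNumber (dyadicPart E (i + n)) ((2 : ℝ) ^ i) : ℝ≥0∞) ^ (q / p) *
          twoPow (-(n * (k + 1) * q * (1 - 1 / p)))) := by
          exact mul_le_mul' le_rfl (ENNReal.tsum_le_tsum hterm)
      _ ≤ C * (D ^ (q / p) * (c ^ q * twoPow (i * (k + 2) * (q / p))) * A) := by
          rw [ENNReal.tsum_mul_left]
          gcongr
          exact h i
      _ = _ := by ring
  refine (ENNReal.rpow_le_rpow key hs'.le).trans (le_of_eq ?_)
  rw [ENNReal.mul_rpow_of_nonneg _ _ hs'.le, ENNReal.mul_rpow_of_nonneg (c ^ q) _ hs'.le,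
    ← ENNReal.rpow_mul, twoPow_rpow, show q * (p / q) = p by field_simp, mul_assoc (i * _ : ℝ),
    show q / p * (p / q) = 1 by field_simp, mul_one]

/-! ### Localization to annuli -/

/-- `∫_0^∞ F(s)^p s^{k+1} ds`, the `p`-th power of the norm of a radial profile. -/
noncomputable def profileIntegral (k : ℕ) (p : ℝ) (F : ℝ → ℝ≥0∞) : ℝ≥0∞ :=
  ∫⁻ s in Ioi (0 : ℝ), ENNReal.ofReal (s ^ (k + 1)) * F s ^ p

/-- The part of `profileIntegral` over `[2^a, 2^b)`. -/
noncomputable def annulusIntegral (k : ℕ) (p : ℝ) (F : ℝ → ℝ≥0∞) (a b : ℤ) : ℝ≥0∞ :=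
  ∫⁻ s in Ico ((2 : ℝ) ^ a) (2 ^ b), ENNReal.ofReal (s ^ (k + 1)) * F s ^ p

theorem lintegral_annulus_le (k : ℕ) (p : ℝ) (F : ℝ → ℝ≥0∞) (a b : ℤ) :
    ∫⁻ s in Ico ((2 : ℝ) ^ a) (2 ^ b), F s ^ p ≤
      twoPow (-(a * (k + 1))) * annulusIntegral k p F a b := by
  rw [annulusIntegral, ← lintegral_const_mul' _ _ (twoPow_ne_top _)]
  refine setLIntegral_mono' measurableSet_Ico fun s hs => ?_
  rw [← mul_assoc]
  refine le_mul_of_one_le_left zero_le ?_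
  calc (1 : ℝ≥0∞) = twoPow (-(a * (k + 1))) * twoPow (a * (k + 1)) := by
        rw [twoPow_mul, neg_add_cancel, twoPow_zero]
    _ ≤ _ := by
        gcongr
        rw [← Nat.cast_succ, mul_comm, twoPow_natCast_mul, twoPow_intCast,
          ← ENNReal.ofReal_pow (by positivity)]
        exact ENNReal.ofReal_le_ofReal (pow_le_pow_left₀ (by positivity) hs.1 _)

theorem lintegral_indicator_annulus_le (k : ℕ) {p : ℝ} (hp : 0 < p) (F : ℝ → ℝ≥0∞) (a b : ℤ) :
    ∫⁻ s, (Ico ((2 : ℝ) ^ a) (2 ^ b)).indicator F s ^ p ≤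
      twoPow (-(a * (k + 1))) * annulusIntegral k p F a b := by
  refine le_trans (le_of_eq ?_) (lintegral_annulus_le k p F a b)
  rw [← lintegral_indicator measurableSet_Ico]
  congr 1 with s
  by_cases h : s ∈ Ico ((2 : ℝ) ^ a) (2 ^ b) <;> simp [h, hp]

/-- Every positive radius lies in exactly `n` of the annuli, so bounded overlap costs a factor `n`.
-/
theorem tsum_annulusIntegral_le (k : ℕ) (p : ℝ) (F : ℝ → ℝ≥0∞) (a : ℤ) (n : ℕ) :
    ∑' j : ℤ, annulusIntegral k p F (j + a) (j + a + n) ≤ n * profileIntegral k p F := by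
  induction n with
  | zero => simp [annulusIntegral]
  | succ n ih =>
    have hsplit : ∀ j : ℤ, annulusIntegral k p F (j + a) (j + a + (n + 1 : ℕ)) ≤
        annulusIntegral k p F (j + a) (j + a + n) +
          annulusIntegral k p F (j + (a + n)) (j + (a + n) + 1) := by
      intro j
      refine le_trans (lintegral_mono_set ?_) (lintegral_union_le _ _ _)
      intro s hs
      rcases lt_or_ge s (2 ^ (j + a + n)) with h | h
      · exact Or.inl ⟨hs.1, h⟩
      · refine Or.inr ⟨by rwa [← add_assoc], ?_⟩
        rw [← add_assoc]
        have := hs.2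
        push_cast at this
        rwa [← add_assoc] at this
    have hone : ∑' j : ℤ, annulusIntegral k p F (j + (a + n)) (j + (a + n) + 1) ≤
        profileIntegral k p F := by
      have e := (Equiv.addRight (a + n : ℤ)).tsum_eq fun j : ℤ => annulusIntegral k p F j (j + 1)
      simp only [Equiv.coe_addRight] at e
      rw [e]
      unfold annulusIntegral
      rw [← lintegral_iUnion fun _ => measurableSet_Ico]
      · refine lintegral_mono_set (iUnion_subset fun j s hs => ?_)
        exact lt_of_lt_of_le (by positivity) hs.1
      · intro i j hij
        refine disjoint_left.2 fun s hs hs' => hij ?_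
        have h1 := (zpow_lt_zpow_iff_right₀ (one_lt_two : (1 : ℝ) < 2)).1 (hs.1.trans_lt hs'.2)
        have h2 := (zpow_lt_zpow_iff_right₀ (one_lt_two : (1 : ℝ) < 2)).1 (hs'.1.trans_lt hs.2)
        omega
    calc _ ≤ ∑' j : ℤ, (annulusIntegral k p F (j + a) (j + a + n) +
          annulusIntegral k p F (j + (a + n)) (j + (a + n) + 1)) := ENNReal.tsum_le_tsum hsplit
      _ ≤ n * profileIntegral k p F + profileIntegral k p F := by
          rw [ENNReal.tsum_add]
          exact add_le_add ih hone
      _ = _ := by push_cast; ring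

/-- Sums of annular integrals with geometric weights. -/
theorem tsum_twoPow_mul_annulusIntegral_le (k : ℕ) (p : ℝ) (F : ℝ → ℝ≥0∞) (a : ℤ) (n : ℕ) (lam : ℝ) :
    ∑' z : ℤ × ℕ, twoPow (-(z.2 * lam)) *
      annulusIntegral k p F (z.1 + z.2 + a) (z.1 + z.2 + a + n) ≤
      (∑' l : ℕ, twoPow (-(l * lam))) * n * profileIntegral k p F := by
  rw [ENNReal.tsum_prod (f := fun (j : ℤ) (l : ℕ) => twoPow (-(l * lam)) *
    annulusIntegral k p F (j + l + a) (j + l + a + n)), ENNReal.tsum_comm, mul_assoc, ← ENNReal.tsum_mul_right]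
  refine ENNReal.tsum_le_tsum fun l => ?_
  rw [ENNReal.tsum_mul_left]
  gcongr
  have e := (Equiv.addRight (l : ℤ)).tsum_eq
    fun j : ℤ => annulusIntegral k p F (j + a) (j + a + n)
  simp only [Equiv.coe_addRight] at e
  rw [e]
  exact tsum_annulusIntegral_le k p F a n

/-! ### Small `s`, away from the singularity -/

/-- The geometric weight is counted backwards from the last valid index `V` of a partial sum,
because the available decay is away from `V` and not away from `0`. -/
theorem tsum_le_iSup_reflected {η : ℝ} (x : ℕ → ℝ≥0∞) (valid : ℕ → Prop)
    (hx : ∀ v, ¬valid v → x v = 0) :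
    ∑' v, x v ≤ (∑' l : ℕ, twoPow (-(l * η))) *
      ⨆ (V : ℕ) (_ : valid V) (l : ℕ) (_ : l ≤ V), twoPow (l * η) * x (V - l) := by
  refine ENNReal.tsum_le_of_sum_range_le fun N => ?_
  induction N with
  | zero => simp
  | succ N ih =>
    by_cases hN : valid N
    · rw [← Finset.sum_range_reflect]
      have h1 := tsum_le_mul_iSup_twoPow η fun l => if l ≤ N then x (N - l) else 0
      have h2 : ∑ l ∈ Finset.range (N + 1), x (N + 1 - 1 - l) ≤
          ∑' l, if l ≤ N then x (N - l) else 0 := by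
        refine le_trans (le_of_eq (Finset.sum_congr rfl fun l hl => ?_)) (ENNReal.sum_le_tsum _)
        rw [if_pos (Nat.lt_succ_iff.1 (Finset.mem_range.1 hl)), Nat.add_sub_cancel]
      refine h2.trans (h1.trans ?_)
      refine mul_le_mul' le_rfl (iSup_le fun l => ?_)
      split_ifs with hl
      · exact le_iSup_of_le N (le_iSup_of_le hN (le_iSup_of_le l (le_iSup_of_le hl le_rfl)))
      · simp
    · rw [Finset.sum_range_succ, hx N hN, add_zero]
      exact ih

theorem exists_dyadic_scale {t : ℝ} (ht : 0 < t) : ∃ m : ℤ, (2 : ℝ) ^ m ≤ t ∧ t < 2 ^ (m + 1) :=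
  exists_mem_Ico_zpow ht one_lt_two

theorem ofReal_zpow_pow (j : ℤ) (n : ℕ) :
    ENNReal.ofReal (((2 : ℝ) ^ j) ^ n) = twoPow (j * n) := by
  rw [ENNReal.ofReal_pow (by positivity), ← twoPow_intCast, mul_comm, twoPow_natCast_mul]

theorem ofReal_div_zpow_pow (a b : ℤ) (u v : ℕ) :
    ENNReal.ofReal (((2 : ℝ) ^ a) ^ u / (2 ^ b) ^ v) = twoPow (a * u - b * v) := by
  rw [ENNReal.ofReal_div_of_pos (by positivity), ofReal_zpow_pow, ofReal_zpow_pow,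
    sub_eq_add_neg, ← twoPow_mul, div_eq_mul_inv]
  congr 1
  unfold twoPow
  rw [ENNReal.rpow_neg]

/-- Here `s ≥ 2|r-t|` keeps `s` off the singularity, so the kernel is about `s^k / t^{k+1}` and one
splits only according to the dyadic size of `s`. Sizes `2^{m-v}` below `|r-t|` do not occur, which
makes `V` a measure of how close `r` is to `t`. -/
theorem lintegral_kernel_far_le (k : ℕ) {η : ℝ} (F : ℝ → ℝ≥0∞) {r t : ℝ} {m : ℤ}
    (hr : 0 < r) (ht : 0 < t) (hm1 : (2 : ℝ) ^ m ≤ t) (hm2 : t < 2 ^ (m + 1)) :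
    ∫⁻ s in {s : ℝ | |r - t| < s ∧ 2 * |r - t| ≤ s ∧ s < t / 4},
      ENNReal.ofReal (radialKernel k r t s) * F s ≤
    (∑' l : ℕ, twoPow (-(l * η))) *
      ⨆ (V : ℕ) (_ : |r - t| ≤ 2 ^ (m - V)) (l : ℕ) (_ : l ≤ V), twoPow (l * η) *
        (twoPow (2 * k + 2) * twoPow ((m - V + l) * k - m * (k + 1)) * mass F (m - V + l) 1) := by
  classical
  set ρ := |r - t| with hρ
  have hρ0 : 0 ≤ ρ := abs_nonneg _
  set x : ℕ → ℝ≥0∞ := fun v => if ρ ≤ 2 ^ (m - v) then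
    twoPow (2 * k + 2) * twoPow ((m - v) * k - m * (k + 1)) * mass F (m - v) 1 else 0 with hx
  set S := {s : ℝ | ρ < s ∧ 2 * ρ ≤ s ∧ s < t / 4} with hS
  have hSm : MeasurableSet S :=
    measurableSet_Ioi.inter (measurableSet_Ici.inter measurableSet_Iio)
  have hpos : ∀ s ∈ S, 0 < s := fun s hs => hρ0.trans_lt hs.1
  have hcover : S ⊆ ⋃ v : ℕ, S ∩ dyadicInterval (m - v) 1 := by
    intro s hs
    obtain ⟨j, hj1, hj2⟩ := exists_dyadic_scale (hpos s hs)
    have hjm : j < m + 1 := by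
      refine (zpow_lt_zpow_iff_right₀ (one_lt_two : (1 : ℝ) < 2)).1 (hj1.trans_lt ?_)
      linarith [hs.2.2]
    have e : m - ((m - j).toNat : ℤ) = j := by rw [Int.toNat_of_nonneg (by omega)]; ring
    refine mem_iUnion.2 ⟨(m - j).toNat, hs, ?_⟩
    rw [e, dyadicInterval, mem_Ico]
    rw [zpow_add_one₀ two_ne_zero] at hj2
    push_cast
    constructor <;> linarith
  have hpiece : ∀ v : ℕ, ∫⁻ s in S ∩ dyadicInterval (m - v) 1,
      ENNReal.ofReal (radialKernel k r t s) * F s ≤ x v := by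
    intro v
    have hDm : MeasurableSet (S ∩ dyadicInterval (m - v) 1) :=
      hSm.inter (measurableSet_dyadicInterval _ _)
    by_cases hv : ρ ≤ 2 ^ (m - v)
    · simp only [hx, if_pos hv, mass]
      rw [← lintegral_const_mul' _ _ (ENNReal.mul_ne_top (twoPow_ne_top _) (twoPow_ne_top _))]
      refine le_trans ?_ (lintegral_mono_set (inter_subset_right (s := S)))
      refine setLIntegral_mono' hDm fun s hs => ?_
      gcongr
      have hs0 := hpos s hs.1
      obtain ⟨h1, h2, h3⟩ := hs.1
      have hs2 : s ≤ 2 ^ (m - v) * 2 := by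
        have := hs.2.2.le
        push_cast at this
        linarith
      have hv0 : 0 < s - ρ := by linarith
      have hratio : (s / (s - ρ)) ^ (1 / (k + 2 : ℝ)) ≤ 2 := by
        calc (s / (s - ρ)) ^ (1 / (k + 2 : ℝ)) ≤ 2 ^ (1 / (k + 2 : ℝ)) := by
              gcongr
              rw [div_le_iff₀ hv0]
              linarith
          _ ≤ 2 ^ (1 : ℝ) := by
              gcongr
              · norm_num
              · rw [div_le_one (by positivity)]
                linarith [(Nat.cast_nonneg k : (0 : ℝ) ≤ k)]
          _ = 2 := by simp
      have hK : radialKernel k r t s ≤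
          2 ^ (2 * k + 2) * ((2 ^ (m - v)) ^ k / (2 ^ m) ^ (k + 1)) := by
        refine (radialKernel_le_of_lt_quarter k hr ht h1 h3).trans ?_
        calc 2 ^ (k + 1) * s ^ k / t ^ (k + 1) * (s / (s - ρ)) ^ (1 / (k + 2 : ℝ))
            ≤ 2 ^ (k + 1) * (2 ^ (m - v) * 2) ^ k / (2 ^ m) ^ (k + 1) * 2 := by gcongr
          _ = _ := by
              rw [mul_pow]
              ring
      refine (ENNReal.ofReal_le_ofReal hK).trans (le_of_eq ?_)
      rw [ENNReal.ofReal_mul (by positivity), ofReal_div_zpow_pow, ENNReal.ofReal_pow (by norm_num)]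
      congr 1
      · unfold twoPow
        rw [show (2 * k + 2 : ℝ) = ((2 * k + 2 : ℕ) : ℝ) by push_cast; ring, ENNReal.rpow_natCast]
        simp
      · push_cast
        rfl
    · have : S ∩ dyadicInterval (m - v) 1 = ∅ := by
        refine eq_empty_of_forall_notMem fun s hs => hv ?_
        have h1 := hs.1.2.1
        have h2 := hs.2.2
        push_cast at h2
        linarith
      rw [this]
      simp
  calc _ ≤ ∑' v : ℕ, ∫⁻ s in S ∩ dyadicInterval (m - v) 1,
        ENNReal.ofReal (radialKernel k r t s) * F s :=
        (lintegral_mono_set hcover).trans (lintegral_iUnion_le _ _)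
    _ ≤ ∑' v, x v := ENNReal.tsum_le_tsum hpiece
    _ ≤ _ := tsum_le_iSup_reflected (η := η) x (fun v => ρ ≤ 2 ^ (m - v))
        fun v hv => by simp only [hx, if_neg hv]
    _ ≤ _ := by
        gcongr with V hV l hl
        simp only [hx]
        split_ifs
        · have e : m - ((V - l : ℕ) : ℤ) = m - V + l := by
            rw [Nat.cast_sub hl]; ring
          have e' : (m : ℝ) - ((V - l : ℕ) : ℝ) = m - V + l := by
            rw [Nat.cast_sub hl]; ring
          rw [e, e']
        · exact zero_le

theorem dyadicInterval_one (i : ℤ) : dyadicInterval i 1 = Ico ((2 : ℝ) ^ i) (2 ^ (i + 1)) := by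
  rw [dyadicInterval, zpow_add_one₀ two_ne_zero]
  push_cast
  ring_nf

theorem mass_one_rpow_le (k : ℕ) {p : ℝ} (hp : 1 ≤ p) {F : ℝ → ℝ≥0∞} (hF : Measurable F) (i : ℤ) :
    mass F i 1 ^ p ≤ twoPow (i * (p - 1) - i * (k + 1)) * annulusIntegral k p F i (i + 1) := by
  refine (mass_rpow_le hp hF i 1).trans ?_
  rw [dyadicInterval_one, sub_eq_add_neg (i * (p - 1) : ℝ), ← twoPow_mul, mul_assoc]
  gcongr
  exact lintegral_annulus_le k p F i (i + 1)

theorem mem_dyadicPart {E : Set ℝ} {t : ℝ} {m : ℤ} (ht : t ∈ E) (h1 : (2 : ℝ) ^ m ≤ t)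
    (h2 : t < 2 ^ (m + 1)) : t ∈ dyadicPart E m := ⟨⟨h1, h2.le⟩, ht⟩

theorem ae_norm_pos (k : ℕ) : ∀ᵐ x : Euc k, 0 < ‖x‖ := by
  have : ∀ᵐ x : Euc k, x ≠ 0 := by simp [ae_iff]
  filter_upwards [this] with x hx using norm_pos_iff.2 hx

/-- The part of the maximal function with `s < t / 4` and `s ≥ 2 |r - t|`. -/
theorem levelIntegral_far_le {k : ℕ} {p q : ℝ} (hp : 1 ≤ p) (hpd : p * (k + 1) < k + 2)
    (hpq : p ≤ q) {E : Set ℝ} (hE : E ⊆ Ioi 0) {A : ℝ≥0∞} (hA : A ≠ ∞)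
    (h : EntropyBound k p q E A) :
    ∃ C : ℝ≥0∞, C ≠ ∞ ∧ ∀ F : ℝ → ℝ≥0∞, Measurable F →
      levelIntegral volume p q (fun x : Euc k => ⨆ t ∈ E,
        ∫⁻ s in {s : ℝ | |‖x‖ - t| < s ∧ 2 * |‖x‖ - t| ≤ s ∧ s < t / 4},
          ENNReal.ofReal (radialKernel k ‖x‖ t s) * F s) ^ (p / q) ≤
      C * profileIntegral k p F := by
  have hp0 : 0 < p := by linarith
  -- Half of the available decay: the exponent of `2^l` after all factors are collected is `ηp - 2ηp
  -- = -ηp`.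
  set η : ℝ := ((k + 2) - p * (k + 1)) / (2 * p) with hη
  have hη0 : 0 < η := div_pos (by linarith) (by linarith)
  have hηp : 2 * (η * p) = (k + 2) - p * (k + 1) := by rw [hη]; field_simp
  set K := ∑' l : ℕ, twoPow (-(l * η)) with hK
  have hKt : K ≠ ∞ := (tsum_twoPow_lt_top hη0).ne
  clear_value K
  obtain ⟨C, hC, H⟩ := levelIntegral_nearSet_le hp0 hpq hA h 2
  refine ⟨C * (K * twoPow (2 * k + 2)) ^ p * ((∑' l : ℕ, twoPow (-(l * (η * p)))) * (1 : ℕ)), ?_,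
    fun F hF => ?_⟩
  · refine ENNReal.mul_ne_top (ENNReal.mul_ne_top hC (ENNReal.rpow_ne_top_of_nonneg hp0.le
      (ENNReal.mul_ne_top hKt (twoPow_ne_top _)))) (ENNReal.mul_ne_top ?_ (by simp))
    exact (tsum_twoPow_lt_top (by positivity)).ne
  -- Here `z = (m - V, l)`. Once `2^{-V(k+1)}` is split off, the height no longer depends on `m`, so
  -- for fixed `z` all sizes of `t` form one geometric family with `n = V`.
  set c : ℤ × ℕ → ℝ≥0∞ := fun z => (K * twoPow (2 * k + 2)) *
    (twoPow (z.2 * η + (z.1 + z.2) * k - z.1 * (k + 1)) * mass F (z.1 + z.2) 1) with hc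
  have hpt : ∀ᵐ x : Euc k, (⨆ t ∈ E,
        ∫⁻ s in {s : ℝ | |‖x‖ - t| < s ∧ 2 * |‖x‖ - t| ≤ s ∧ s < t / 4},
          ENNReal.ofReal (radialKernel k ‖x‖ t s) * F s) ≤
      ⨆ z : ℤ × ℕ, ⨆ n : ℕ, (nearSet k E (z.1 + n + 2) (z.1 + n) z.1 0).indicator
        (fun _ => c z * twoPow (-(n * (k + 1)))) x := by
    filter_upwards [ae_norm_pos k] with x hx
    refine iSup₂_le fun t htE => ?_
    have ht : 0 < t := hE htE
    obtain ⟨m, hm1, hm2⟩ := exists_dyadic_scale ht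
    refine (lintegral_kernel_far_le k (η := η) F hx ht hm1 hm2).trans ?_
    rw [← hK]
    simp only [ENNReal.mul_iSup]
    refine iSup₂_le fun V hV => iSup₂_le fun l hl => ?_
    refine le_iSup_of_le ((m - V : ℤ), l) (le_iSup_of_le V ?_)
    have hmem : x ∈ nearSet k E ((m - V : ℤ) + V + 2) ((m - V : ℤ) + V) (m - V) 0 := by
      rw [sub_add_cancel]
      refine ⟨?_, t, mem_dyadicPart htE hm1 hm2, Or.inl ?_⟩
      · have h1 : (2 : ℝ) ^ (m - V : ℤ) ≤ 2 ^ m := zpow_le_zpow_right₀ one_le_two (by omega)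
        have h2 := (abs_le.1 hV).2
        rw [zpow_add_one₀ two_ne_zero] at hm2
        rw [zpow_add₀ two_ne_zero]
        have : (0 : ℝ) < 2 ^ m := by positivity
        norm_num
        linarith
      · rw [sub_zero]
        have : (0 : ℝ) < 2 ^ (m - V : ℤ) := by positivity
        linarith
    rw [indicator_of_mem hmem]
    simp only [hc]
    have e : twoPow (l * η) * twoPow ((m - V + l) * k - m * (k + 1)) =
        twoPow (l * η + ((m - V : ℤ) + l) * k - (m - V : ℤ) * (k + 1)) * twoPow (-(V * (k + 1))) := by
      rw [twoPow_mul, twoPow_mul]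
      push_cast
      ring_nf
    refine le_of_eq ?_
    calc _ = K * twoPow (2 * k + 2) * mass F (m - V + l) 1 *
          (twoPow (l * η) * twoPow ((m - V + l) * k - m * (k + 1))) := by ring
      _ = _ := by rw [e]; ring
  refine (levelIntegral_rpow_le_tsum volume hp0 hpq hpt).trans ?_
  have hterm : ∀ z : ℤ × ℕ, levelIntegral volume p q (fun x : Euc k => ⨆ n : ℕ,
      (nearSet k E (z.1 + n + 2) (z.1 + n) z.1 0).indicator
        (fun _ => c z * twoPow (-(n * (k + 1)))) x) ^ (p / q) ≤
      C * (K * twoPow (2 * k + 2)) ^ p * (twoPow (-(z.2 * (η * p))) *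
        annulusIntegral k p F (z.1 + z.2 + 0) (z.1 + z.2 + 0 + (1 : ℕ))) := by
    rintro ⟨j, l⟩
    refine (H _ _ _).trans ?_
    simp only [hc, add_zero, Nat.cast_one]
    rw [ENNReal.mul_rpow_of_nonneg _ _ hp0.le, ENNReal.mul_rpow_of_nonneg (twoPow _) _ hp0.le,
      twoPow_rpow]
    have hm := mass_one_rpow_le k hp hF (j + l)
    calc _ ≤ C * ((K * twoPow (2 * k + 2)) ^ p *
        (twoPow ((l * η + (j + l) * k - j * (k + 1)) * p) *
        (twoPow ((j + l : ℤ) * (p - 1) - (j + l : ℤ) * (k + 1)) *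
          annulusIntegral k p F (j + l) (j + l + 1))) * twoPow (j * (k + 2))) := by gcongr
      _ = C * (K * twoPow (2 * k + 2)) ^ p *
        ((twoPow ((l * η + (j + l) * k - j * (k + 1)) * p) *
        twoPow ((j + l : ℤ) * (p - 1) - (j + l : ℤ) * (k + 1)) * twoPow (j * (k + 2))) *
          annulusIntegral k p F (j + l) (j + l + 1)) := by ring
      _ = _ := by
        rw [twoPow_mul, twoPow_mul]
        congr 3
        push_cast
        linear_combination (l : ℝ) * hηp
  refine (ENNReal.tsum_le_tsum hterm).trans ?_
  rw [ENNReal.tsum_mul_left, mul_assoc _ _ (profileIntegral k p F)]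
  gcongr
  exact tsum_twoPow_mul_annulusIntegral_le k p F 0 1 (η * p)

/-! ### Small `s`, near the singularity -/

/-- With `2^j` the dyadic size of `|r-t|`, the range of `s` lies in `[2^j, 2^{j+2})` and the kernel
is `2^{jk - m(k+1)}` times a power singularity at `|r-t|`, to which `lintegral_singular_le` applies.
-/
theorem lintegral_kernel_near_le (k : ℕ) {δ : ℝ} (hδ : 0 < δ) : ∃ C : ℝ≥0∞, C ≠ ∞ ∧
    ∀ (F : ℝ → ℝ≥0∞) {r t : ℝ} {m : ℤ}, 0 < r → 0 < t → (2 : ℝ) ^ m ≤ t → t < 2 ^ (m + 1) →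
      ∫⁻ s in {s : ℝ | |r - t| < s ∧ s < 2 * |r - t| ∧ s < t / 4},
        ENNReal.ofReal (radialKernel k r t s) * F s ≤
      C * ⨆ (j : ℤ) (_ : j ≤ m) (_ : |r - t| ≤ 2 ^ (m + 1)) (l : ℕ) (a : ℤ)
        (_ : |(|r - t|) - a * 2 ^ (j - l)| ≤ 3 * 2 ^ (j - l)),
          twoPow (j * k - m * (k + 1)) * (twoPow (l * (1 / (k + 2) + δ)) *
            mass ((Ico ((2 : ℝ) ^ j) (2 ^ (j + 2))).indicator F) (j - l) a) := by
  have hκ : (0 : ℝ) < 1 / (k + 2) := by positivity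
  obtain ⟨C, hC, H⟩ := lintegral_singular_le hκ hδ
  refine ⟨ENNReal.ofReal (2 ^ (3 * k + 3)) * C, ENNReal.mul_ne_top ENNReal.ofReal_ne_top hC,
    fun F r t m hr ht hm1 hm2 => ?_⟩
  set ρ := |r - t| with hρ
  by_cases hρ' : 0 < ρ ∧ ρ < t / 4
  swap
  · have : {s : ℝ | ρ < s ∧ s < 2 * ρ ∧ s < t / 4} = ∅ := by
      refine eq_empty_of_forall_notMem fun s hs => hρ' ⟨?_, ?_⟩
      · linarith [hs.1, hs.2.1]
      · linarith [hs.1, hs.2.2]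
    rw [this]
    simp
  obtain ⟨hρ0, hρ1⟩ := hρ'
  obtain ⟨j, hj1, hj2⟩ := exists_dyadic_scale hρ0
  have hjm : j ≤ m := by
    have : j < m + 1 := by
      refine (zpow_lt_zpow_iff_right₀ (one_lt_two : (1 : ℝ) < 2)).1 (hj1.trans_lt ?_)
      linarith
    omega
  have hρm : ρ ≤ 2 ^ (m + 1) := by linarith
  have hj3 : (2 : ℝ) ^ (j + 2) = 2 ^ j * 4 := by rw [zpow_add₀ two_ne_zero]; norm_num
  rw [zpow_add_one₀ two_ne_zero] at hj2
  have hj0 : (0 : ℝ) < 2 ^ j := by positivity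
  set F' := (Ico ((2 : ℝ) ^ j) (2 ^ (j + 2))).indicator F with hF'
  have hSm : MeasurableSet {s : ℝ | ρ < s ∧ s < 2 * ρ ∧ s < t / 4} :=
    measurableSet_Ioi.inter (measurableSet_Iio.inter measurableSet_Iio)
  calc ∫⁻ s in {s : ℝ | ρ < s ∧ s < 2 * ρ ∧ s < t / 4}, ENNReal.ofReal (radialKernel k r t s) * F s
      ≤ ∫⁻ s in {s : ℝ | ρ < s ∧ s < 2 * ρ ∧ s < t / 4}, ENNReal.ofReal (2 ^ (3 * k + 3)) *
          twoPow (j * k - m * (k + 1)) *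
          (ENNReal.ofReal ((2 ^ j / |s - ρ|) ^ (1 / (k + 2 : ℝ))) * F' s) := by
        refine setLIntegral_mono' hSm fun s hs => ?_
        obtain ⟨h1, h2, h3⟩ := hs
        have hs0 : 0 < s := by linarith
        have hmem : s ∈ Ico ((2 : ℝ) ^ j) (2 ^ (j + 2)) := ⟨by linarith, by rw [hj3]; linarith⟩
        have hv : 0 < s - ρ := by linarith
        rw [hF', indicator_of_mem hmem, ← mul_assoc]
        gcongr
        have e := ofReal_div_zpow_pow j m k (k + 1)
        push_cast at e
        rw [← e, ← ENNReal.ofReal_mul (by positivity), ← ENNReal.ofReal_mul (by positivity)]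
        refine ENNReal.ofReal_le_ofReal ?_
        refine (radialKernel_le_of_lt_quarter k hr ht h1 h3).trans ?_
        rw [abs_of_pos hv]
        have h4 : (s / (s - ρ)) ^ (1 / (k + 2 : ℝ)) ≤
            4 * (2 ^ j / (s - ρ)) ^ (1 / (k + 2 : ℝ)) := by
          calc (s / (s - ρ)) ^ (1 / (k + 2 : ℝ)) ≤ (4 * (2 ^ j / (s - ρ))) ^ (1 / (k + 2 : ℝ)) := by
                gcongr
                rw [← mul_div_assoc]
                gcongr
                linarith
            _ = 4 ^ (1 / (k + 2 : ℝ)) * (2 ^ j / (s - ρ)) ^ (1 / (k + 2 : ℝ)) :=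
                Real.mul_rpow (by norm_num) (by positivity)
            _ ≤ 4 ^ (1 : ℝ) * (2 ^ j / (s - ρ)) ^ (1 / (k + 2 : ℝ)) := by
                gcongr
                · norm_num
                · rw [div_le_one (by positivity)]
                  linarith [(Nat.cast_nonneg k : (0 : ℝ) ≤ k)]
            _ = _ := by simp
        calc _ ≤ 2 ^ (k + 1) * (2 ^ j * 4) ^ k / (2 ^ m) ^ (k + 1) *
              (4 * (2 ^ j / (s - ρ)) ^ (1 / (k + 2 : ℝ))) := by
              gcongr
              linarith
          _ = _ := by
              rw [mul_pow, show (4 : ℝ) = 2 ^ 2 by norm_num, ← pow_mul]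
              ring
    _ = ENNReal.ofReal (2 ^ (3 * k + 3)) * twoPow (j * k - m * (k + 1)) *
          ∫⁻ s in {s : ℝ | ρ < s ∧ s < 2 * ρ ∧ s < t / 4},
            ENNReal.ofReal ((2 ^ j / |s - ρ|) ^ (1 / (k + 2 : ℝ))) * F' s :=
        lintegral_const_mul' _ _ (ENNReal.mul_ne_top ENNReal.ofReal_ne_top (twoPow_ne_top _))
    _ ≤ ENNReal.ofReal (2 ^ (3 * k + 3)) * twoPow (j * k - m * (k + 1)) *
          ∫⁻ s in {s : ℝ | |s - ρ| < 2 ^ (j + 1)},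
            ENNReal.ofReal ((2 ^ j / |s - ρ|) ^ (1 / (k + 2 : ℝ))) * F' s := by
        refine mul_le_mul' le_rfl (lintegral_mono_set fun s hs => ?_)
        rw [mem_ofPred_eq, zpow_add_one₀ two_ne_zero, abs_lt]
        constructor <;> linarith [hs.1, hs.2.1]
    _ ≤ ENNReal.ofReal (2 ^ (3 * k + 3)) * twoPow (j * k - m * (k + 1)) *
          (C * ⨆ (l : ℕ) (a : ℤ) (_ : |ρ - a * 2 ^ (j - l)| ≤ 3 * 2 ^ (j - l)),
            twoPow (l * (1 / (k + 2) + δ)) * mass F' (j - l) a) :=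
        mul_le_mul' le_rfl (H F' ρ j)
    _ = ENNReal.ofReal (2 ^ (3 * k + 3)) * C * (twoPow (j * k - m * (k + 1)) *
          ⨆ (l : ℕ) (a : ℤ) (_ : |ρ - a * 2 ^ (j - l)| ≤ 3 * 2 ^ (j - l)),
            twoPow (l * (1 / (k + 2) + δ)) * mass F' (j - l) a) := by ring
    _ ≤ _ := by
        refine mul_le_mul' le_rfl ?_
        refine le_iSup_of_le j (le_iSup_of_le hjm (le_iSup_of_le hρm ?_))
        simp only [ENNReal.mul_iSup]
        exact le_rfl

/-- The decay exponent left after summation over scales. -/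
theorem decay_pos {k : ℕ} {p : ℝ} (hpd : p * (k + 1) < k + 2) :
    (k + 1 : ℝ) * (p - 1) < (1 - 1 / (k + 2)) * p := by
  have hk : (0 : ℝ) < k + 2 := by positivity
  have hk1 : (0 : ℝ) < k + 1 := by positivity
  -- The exponent `1/(k+2)` is the largest for which this gap is positive in the whole range `p <
  -- (k+2)/(k+1)`; for `k = 0` it equals the `1/2` forced by the kernel.
  have : (1 - 1 / (k + 2 : ℝ)) * p - (k + 1) * (p - 1) =
      (k + 1) * ((k + 2) - p * (k + 1)) / (k + 2) := by
    field_simp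
    ring
  have h2 : 0 < (k + 1 : ℝ) * ((k + 2) - p * (k + 1)) / (k + 2) :=
    div_pos (mul_pos hk1 (by linarith)) hk
  linarith

/-- The part of the maximal function with `s < t / 4` and `s < 2 |r - t|`. -/
theorem levelIntegral_near_le {k : ℕ} {p q : ℝ} (hp : 1 ≤ p) (hpd : p * (k + 1) < k + 2)
    (hpq : p ≤ q) {E : Set ℝ} (hE : E ⊆ Ioi 0) {A : ℝ≥0∞} (hA : A ≠ ∞)
    (h : EntropyBound k p q E A) :
    ∃ C : ℝ≥0∞, C ≠ ∞ ∧ ∀ F : ℝ → ℝ≥0∞, Measurable F →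
      levelIntegral volume p q (fun x : Euc k => ⨆ t ∈ E,
        ∫⁻ s in {s : ℝ | |‖x‖ - t| < s ∧ s < 2 * |‖x‖ - t| ∧ s < t / 4},
          ENNReal.ofReal (radialKernel k ‖x‖ t s) * F s) ^ (p / q) ≤
      C * profileIntegral k p F := by
  have hp0 : 0 < p := by linarith
  set δ : ℝ := ((1 - 1 / (k + 2)) * p - (k + 1) * (p - 1)) / (2 * p) with hδ
  have hδ0 : 0 < δ := div_pos (by linarith [decay_pos hpd]) (by linarith)
  have hδp : 2 * (δ * p) = (1 - 1 / (k + 2)) * p - (k + 1) * (p - 1) := by rw [hδ]; field_simp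
  clear_value δ
  set κ : ℝ := 1 / (k + 2) with hκ
  obtain ⟨K, hK, Hpt⟩ := lintegral_kernel_near_le k hδ0
  obtain ⟨C, hC, H⟩ := levelIntegral_nearSet_le hp0 hpq hA h 2
  refine ⟨C * K ^ p * ((∑' l : ℕ, twoPow (-(l * (δ * p)))) * (2 : ℕ)), ?_, fun F hF => ?_⟩
  · refine ENNReal.mul_ne_top (ENNReal.mul_ne_top hC (ENNReal.rpow_ne_top_of_nonneg hp0.le hK))
      (ENNReal.mul_ne_top (tsum_twoPow_lt_top (by positivity)).ne (by simp))
  set G : ℤ → ℝ → ℝ≥0∞ := fun j => (Ico ((2 : ℝ) ^ j) (2 ^ (j + 2))).indicator F with hG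
  have hGm : ∀ j, Measurable (G j) := fun j => hF.indicator measurableSet_Ico
  -- Here `z = ((i, l), a)` with `i = j - l` the scale of the small interval, so the annulus index
  -- `j` is `i + l`. The size of `t` is again left to the geometric family, with `n = m - i`.
  set c : (ℤ × ℕ) × ℤ → ℝ≥0∞ := fun z => K *
    (twoPow ((z.1.1 + z.1.2) * k - z.1.1 * (k + 1) + z.1.2 * (κ + δ)) *
      mass (G (z.1.1 + z.1.2)) z.1.1 z.2) with hc
  have hpt : ∀ᵐ x : Euc k, (⨆ t ∈ E,
        ∫⁻ s in {s : ℝ | |‖x‖ - t| < s ∧ s < 2 * |‖x‖ - t| ∧ s < t / 4},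
          ENNReal.ofReal (radialKernel k ‖x‖ t s) * F s) ≤
      ⨆ z : (ℤ × ℕ) × ℤ, ⨆ n : ℕ,
        (nearSet k E (z.1.1 + n + 2) (z.1.1 + n) z.1.1 (z.2 * 2 ^ z.1.1)).indicator
        (fun _ => c z * twoPow (-(n * (k + 1)))) x := by
    filter_upwards [ae_norm_pos k] with x hx
    refine iSup₂_le fun t htE => ?_
    have ht : 0 < t := hE htE
    obtain ⟨m, hm1, hm2⟩ := exists_dyadic_scale ht
    refine (Hpt F hx ht hm1 hm2).trans ?_
    simp only [ENNReal.mul_iSup]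
    refine iSup₂_le fun j hj => iSup_le fun hρ => iSup₂_le fun l a => iSup_le fun hla => ?_
    have hn : ((m - (j - l)).toNat : ℤ) = m - (j - l) := Int.toNat_of_nonneg (by omega)
    have hn' : ((m - (j - l)).toNat : ℝ) = m - (j - l) := by exact_mod_cast hn
    refine le_iSup_of_le (((j - l : ℤ), l), a) (le_iSup_of_le (m - (j - l)).toNat ?_)
    simp only [hn]
    have hmem : x ∈ nearSet k E ((j - l) + (m - (j - l)) + 2) ((j - l) + (m - (j - l))) (j - l)
        (a * 2 ^ (j - l : ℤ)) := by
      rw [add_sub_cancel]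
      refine ⟨?_, t, mem_dyadicPart htE hm1 hm2, near_of_abs_abs_sub_le hla⟩
      have h2 := (abs_le.1 hρ).2
      rw [show m + 2 = m + 1 + 1 by ring, zpow_add_one₀ two_ne_zero (m + 1)]
      linarith
    rw [indicator_of_mem hmem]
    simp only [hc, sub_add_cancel, hn']
    refine le_of_eq ?_
    have e : twoPow (j * k - m * (k + 1)) * twoPow (l * (κ + δ)) =
        twoPow (((j - l : ℤ) + l) * k - (j - l : ℤ) * (k + 1) + l * (κ + δ)) *
          twoPow (-((m - (j - l)) * (k + 1))) := by
      rw [twoPow_mul, twoPow_mul]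
      push_cast
      ring_nf
    calc _ = K * mass (G j) (j - l) a * (twoPow (j * k - m * (k + 1)) * twoPow (l * (κ + δ))) := by
          ring
      _ = _ := by rw [e]; ring
  refine (levelIntegral_rpow_le_tsum volume hp0 hpq hpt).trans ?_
  refine (ENNReal.tsum_le_tsum fun z => H (c z) z.1.1 (z.2 * 2 ^ z.1.1)).trans ?_
  rw [ENNReal.tsum_prod (f := fun (z : ℤ × ℕ) (a : ℤ) => C * (c (z, a) ^ p * twoPow (z.1 * (k + 2))))]
  -- At a fixed scale the intervals are disjoint, so by Hölder the `p`-th powers of the masses add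
  -- up to an integral of `F^p` over one annulus; the remaining powers of two are `2^{-lδp}`.
  have hterm : ∀ z : ℤ × ℕ, ∑' a : ℤ, C * (c (z, a) ^ p * twoPow (z.1 * (k + 2))) ≤
      C * K ^ p * (twoPow (-(z.2 * (δ * p))) *
        annulusIntegral k p F (z.1 + z.2 + 0) (z.1 + z.2 + 0 + (2 : ℕ))) := by
    rintro ⟨i, l⟩
    simp only [hc, add_zero]
    have e1 : ∀ a : ℤ, C * ((K * (twoPow ((i + l) * k - i * (k + 1) + l * (κ + δ)) *
        mass (G (i + l)) i a)) ^ p * twoPow (i * (k + 2))) =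
        C * K ^ p * (twoPow (((i + l) * k - i * (k + 1) + l * (κ + δ)) * p) *
          twoPow (i * (k + 2))) * mass (G (i + l)) i a ^ p := by
      intro a
      rw [ENNReal.mul_rpow_of_nonneg _ _ hp0.le, ENNReal.mul_rpow_of_nonneg _ _ hp0.le, twoPow_rpow]
      ring
    simp_rw [e1]
    rw [ENNReal.tsum_mul_left]
    calc _ ≤ C * K ^ p * (twoPow (((i + l) * k - i * (k + 1) + l * (κ + δ)) * p) *
          twoPow (i * (k + 2))) * (twoPow (i * (p - 1)) * (twoPow (-((i + l : ℤ) * (k + 1))) *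
            annulusIntegral k p F (i + l) (i + l + 2))) := by
          gcongr
          refine (tsum_mass_rpow_le hp (hGm _) i).trans ?_
          gcongr
          exact lintegral_indicator_annulus_le k hp0 F _ _
      _ = C * K ^ p * ((twoPow (((i + l) * k - i * (k + 1) + l * (κ + δ)) * p) *
          twoPow (i * (k + 2)) * twoPow (i * (p - 1)) * twoPow (-((i + l : ℤ) * (k + 1)))) *
            annulusIntegral k p F (i + l) (i + l + 2)) := by ring
      _ = _ := by
          rw [twoPow_mul, twoPow_mul, twoPow_mul]
          congr 3
          push_cast
          linear_combination (l : ℝ) * hδp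
  refine (ENNReal.tsum_le_tsum hterm).trans ?_
  rw [ENNReal.tsum_mul_left, mul_assoc _ _ (profileIntegral k p F)]
  gcongr
  exact tsum_twoPow_mul_annulusIntegral_le k p F 0 2 (δ * p)

/-! ### Large `s` -/

/-- The interval of integration has length `2 min(r,t)`. Cut it at its midpoint; each half carries a
single power singularity, at its own endpoint, treated at top scale `2^i`. -/
theorem lintegral_kernel_le (k : ℕ) {δ : ℝ} (hδ : 0 < δ) : ∃ C : ℝ≥0∞, C ≠ ∞ ∧
    ∀ (F : ℝ → ℝ≥0∞) {r t : ℝ} {i : ℤ}, 0 < r → 0 < t → (2 : ℝ) ^ i ≤ min r t →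
      min r t < 2 ^ (i + 1) →
      ∫⁻ s in Ioo |r - t| (r + t), ENNReal.ofReal (radialKernel k r t s) * F s ≤
      C * ⨆ (l : ℕ) (a : ℤ) (_ : Near r t (a * 2 ^ (i - l)) (3 * 2 ^ (i - l))),
          twoPow (-i) * (twoPow (l * (1 / (k + 2) + δ)) * mass F (i - l) a) := by
  have hκ : (0 : ℝ) < 1 / (k + 2) := by positivity
  obtain ⟨C, hC, H⟩ := lintegral_singular_le hκ hδ
  refine ⟨4 * C + 4 * C, by finiteness, fun F r t i hr ht hi1 hi2 => ?_⟩
  set ρ := |r - t| with hρ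
  set M := ⨆ (l : ℕ) (a : ℤ) (_ : Near r t (a * 2 ^ (i - l)) (3 * 2 ^ (i - l))),
          twoPow (-i) * (twoPow (l * (1 / (k + 2) + δ)) * mass F (i - l) a) with hM
  have h2i : (0 : ℝ) < 2 ^ i := by positivity
  have hmin : 0 < min r t := lt_min hr ht
  have hbound : ∀ (c : ℝ) (S : Set ℝ), MeasurableSet S → (∀ s ∈ S, s ∈ Ioo ρ (r + t) ∧
      |s - c| = min (s - ρ) (r + t - s)) → (∀ (l : ℕ) (a : ℤ),
        |c - a * 2 ^ (i - l)| ≤ 3 * 2 ^ (i - l) → Near r t (a * 2 ^ (i - l)) (3 * 2 ^ (i - l))) →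
      ∫⁻ s in S, ENNReal.ofReal (radialKernel k r t s) * F s ≤ 4 * C * M := by
    intro c S hS hSc hnear
    calc ∫⁻ s in S, ENNReal.ofReal (radialKernel k r t s) * F s
        ≤ ∫⁻ s in S, 4 * twoPow (-i) *
          (ENNReal.ofReal ((2 ^ i / |s - c|) ^ (1 / (k + 2 : ℝ))) * F s) := by
          refine setLIntegral_mono' hS fun s hs => ?_
          obtain ⟨⟨h1, h2⟩, h3⟩ := hSc s hs
          rw [← mul_assoc]
          gcongr
          have hv : 0 < |s - c| := by rw [h3]; exact lt_min (by linarith) (by linarith)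
          have e : (4 : ℝ≥0∞) * twoPow (-i) = ENNReal.ofReal (4 / 2 ^ i) := by
            rw [ENNReal.ofReal_div_of_pos h2i, ← twoPow_intCast, div_eq_mul_inv]
            congr 1
            · simp
            · unfold twoPow
              rw [ENNReal.rpow_neg]
          rw [e, ← ENNReal.ofReal_mul (by positivity)]
          refine ENNReal.ofReal_le_ofReal ?_
          refine (radialKernel_le_min k hr ht h1 h2).2.trans ?_
          rw [← hρ, ← h3]
          have hκ1 : (1 / (k + 2 : ℝ)) ≤ 1 := by
            rw [div_le_one (by positivity)]
            linarith [(Nat.cast_nonneg k : (0 : ℝ) ≤ k)]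
          rw [zpow_add_one₀ two_ne_zero] at hi2
          calc 2 / min r t * (min r t / |s - c|) ^ (1 / (k + 2 : ℝ))
              ≤ 2 / 2 ^ i * (2 * (2 ^ i / |s - c|)) ^ (1 / (k + 2 : ℝ)) := by
                gcongr
                rw [← mul_div_assoc]
                gcongr
                linarith
            _ = 2 / 2 ^ i * (2 ^ (1 / (k + 2 : ℝ)) * (2 ^ i / |s - c|) ^ (1 / (k + 2 : ℝ))) := by
                rw [Real.mul_rpow (by norm_num) (by positivity)]
            _ ≤ 2 / 2 ^ i * (2 ^ (1 : ℝ) * (2 ^ i / |s - c|) ^ (1 / (k + 2 : ℝ))) := by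
                gcongr
                norm_num
            _ = _ := by
                rw [Real.rpow_one]
                ring
      _ = 4 * twoPow (-i) * ∫⁻ s in S,
            ENNReal.ofReal ((2 ^ i / |s - c|) ^ (1 / (k + 2 : ℝ))) * F s :=
          lintegral_const_mul' _ _ (ENNReal.mul_ne_top (by simp) (twoPow_ne_top _))
      _ ≤ 4 * twoPow (-i) * ∫⁻ s in {s : ℝ | |s - c| < 2 ^ (i + 1)},
            ENNReal.ofReal ((2 ^ i / |s - c|) ^ (1 / (k + 2 : ℝ))) * F s := by
          refine mul_le_mul' le_rfl (lintegral_mono_set fun s hs => ?_)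
          obtain ⟨⟨h1, h2⟩, h3⟩ := hSc s hs
          rw [mem_ofPred_eq, h3]
          exact (radialKernel_le_min k hr ht h1 h2).1.trans_lt hi2
      _ ≤ 4 * twoPow (-i) * (C * ⨆ (l : ℕ) (a : ℤ) (_ : |c - a * 2 ^ (i - l)| ≤ 3 * 2 ^ (i - l)),
          twoPow (l * (1 / (k + 2) + δ)) * mass F (i - l) a) := mul_le_mul' le_rfl (H F c i)
      _ = 4 * C * (twoPow (-i) * ⨆ (l : ℕ) (a : ℤ) (_ : |c - a * 2 ^ (i - l)| ≤ 3 * 2 ^ (i - l)),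
          twoPow (l * (1 / (k + 2) + δ)) * mass F (i - l) a) := by ring
      _ ≤ 4 * C * M := by
          refine mul_le_mul' le_rfl ?_
          simp only [ENNReal.mul_iSup]
          refine iSup₂_le fun l a => iSup_le fun hla => ?_
          exact le_iSup₂_of_le l a (le_iSup_of_le (hnear l a hla) le_rfl)
  have hm1 : MeasurableSet (Ioo ρ (r + t) ∩ {s | s - ρ ≤ r + t - s}) :=
    measurableSet_Ioo.inter (measurableSet_le (by fun_prop) (by fun_prop))
  have hm2 : MeasurableSet (Ioo ρ (r + t) ∩ {s | r + t - s ≤ s - ρ}) :=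
    measurableSet_Ioo.inter (measurableSet_le (by fun_prop) (by fun_prop))
  have b1 := hbound ρ _ hm1 (fun s hs => ⟨hs.1, by
    have h := hs.1.1
    have h' : s - ρ ≤ r + t - s := hs.2
    rw [min_eq_left h', abs_of_pos (by linarith)]⟩) fun l a hla => near_of_abs_abs_sub_le hla
  have b2 := hbound (r + t) _ hm2 (fun s hs => ⟨hs.1, by
    have h := hs.1.2
    have h' : r + t - s ≤ s - ρ := hs.2
    rw [min_eq_right h', abs_of_neg (by linarith), neg_sub]⟩) fun l a hla => Or.inr (Or.inr hla)
  calc _ ≤ ∫⁻ s in (Ioo ρ (r + t) ∩ {s | s - ρ ≤ r + t - s}) ∪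
        (Ioo ρ (r + t) ∩ {s | r + t - s ≤ s - ρ}), ENNReal.ofReal (radialKernel k r t s) * F s := by
        refine lintegral_mono_set fun s hs => ?_
        rcases le_total (s - ρ) (r + t - s) with h | h
        · exact Or.inl ⟨hs, h⟩
        · exact Or.inr ⟨hs, h⟩
    _ ≤ 4 * C * M + 4 * C * M := (lintegral_union_le _ _ _).trans (add_le_add b1 b2)
    _ = _ := by ring

theorem setLIntegral_kernel_le_indicator {k : ℕ} {F : ℝ → ℝ≥0∞} {r t : ℝ} {S I : Set ℝ}
    (hS : MeasurableSet S) (h1 : S ⊆ Ioo |r - t| (r + t)) (h2 : S ⊆ I) :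
    ∫⁻ s in S, ENNReal.ofReal (radialKernel k r t s) * F s ≤
      ∫⁻ s in Ioo |r - t| (r + t), ENNReal.ofReal (radialKernel k r t s) * I.indicator F s := by
  refine le_trans ?_ (lintegral_mono_set h1)
  refine setLIntegral_mono' hS fun s hs => ?_
  rw [indicator_of_mem (h2 hs)]

/-- The part of the maximal function with `s ≥ t / 4` and `r ≤ 8 t`. -/
theorem levelIntegral_comparable_le {k : ℕ} {p q : ℝ} (hp : 1 ≤ p) (hpd : p * (k + 1) < k + 2)
    (hpq : p ≤ q) {E : Set ℝ} (hE : E ⊆ Ioi 0) {A : ℝ≥0∞} (hA : A ≠ ∞)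
    (h : EntropyBound k p q E A) :
    ∃ C : ℝ≥0∞, C ≠ ∞ ∧ ∀ F : ℝ → ℝ≥0∞, Measurable F →
      levelIntegral volume p q (fun x : Euc k => ⨆ t ∈ E, ⨆ _ : ‖x‖ ≤ 8 * t,
        ∫⁻ s in {s : ℝ | |‖x‖ - t| < s ∧ s < ‖x‖ + t ∧ t / 4 ≤ s},
          ENNReal.ofReal (radialKernel k ‖x‖ t s) * F s) ^ (p / q) ≤
      C * profileIntegral k p F := by
  have hp0 : 0 < p := by linarith
  have hq0 : 0 < q := by linarith
  set δ : ℝ := ((1 - 1 / (k + 2)) * p - (k + 1) * (p - 1)) / (2 * p) with hδ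
  have hδ0 : 0 < δ := div_pos (by linarith [decay_pos hpd]) (by linarith)
  have hδp : 2 * (δ * p) = (1 - 1 / (k + 2)) * p - (k + 1) * (p - 1) := by rw [hδ]; field_simp
  clear_value δ
  set κ : ℝ := 1 / (k + 2) with hκ
  -- `p < d/(d-1) ≤ 2`. This gives the decay in `v`, where `2^v` compares `t` with `min r t`: the
  -- entropy costs `2^{v(k+1)(p-1)}` and the annulus at radius about `2^{i+v}` gains `2^{-v(k+1)}`.
  have hp2 : 0 < (k + 1 : ℝ) * (2 - p) := by
    have : (0 : ℝ) ≤ k := Nat.cast_nonneg k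
    nlinarith
  obtain ⟨K, hK, Hpt⟩ := lintegral_kernel_le k hδ0
  obtain ⟨C, hC, H⟩ := levelIntegral_indicator_rpow_le (volume : Measure (Euc k)) hp0 hpq
  set D := C * K ^ p * (24 * sphereArea k) * A ^ (p / q) * twoPow (6 * (k + 1)) with hD
  have hDt : D ≠ ∞ := by
    have h1 := sphereArea_ne_top k
    have h2 := twoPow_ne_top (6 * (k + 1))
    have h3 : K ^ p ≠ ∞ := ENNReal.rpow_ne_top_of_nonneg hp0.le hK
    have h4 : A ^ (p / q) ≠ ∞ := ENNReal.rpow_ne_top_of_nonneg (by positivity) hA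
    finiteness
  refine ⟨D * ((∑' l : ℕ, twoPow (-(l * (δ * p)))) *
    ((∑' v : ℕ, twoPow (-(v * ((k + 1) * (2 - p))))) * (7 : ℕ))), ?_, fun F hF => ?_⟩
  · have h1 := (tsum_twoPow_lt_top (by positivity : 0 < δ * p)).ne
    have h2 := (tsum_twoPow_lt_top hp2).ne
    refine ENNReal.mul_ne_top hDt (ENNReal.mul_ne_top h1 (ENNReal.mul_ne_top h2 (by simp)))
  set G : ℤ → ℝ → ℝ≥0∞ := fun m => (Ico ((2 : ℝ) ^ (m - 2)) (2 ^ (m + 5))).indicator F with hG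
  have hGm : ∀ j, Measurable (G j) := fun j => hF.indicator measurableSet_Ico
  set c : (ℕ × (ℤ × ℕ)) × ℤ → ℝ≥0∞ := fun z => K * (twoPow (-z.1.2.1 + z.1.1 * (κ + δ)) *
      mass (G (z.1.2.1 + z.1.2.2)) (z.1.2.1 - z.1.1) z.2) with hc
  set S : (ℕ × (ℤ × ℕ)) × ℤ → Set (Euc k) := fun z => nearSet k E (z.1.2.1 + 4)
    (z.1.2.1 + z.1.2.2) (z.1.2.1 - z.1.1) (z.2 * 2 ^ (z.1.2.1 - z.1.1)) with hS
  have hpt : ∀ᵐ x : Euc k, (⨆ t ∈ E, ⨆ _ : ‖x‖ ≤ 8 * t,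
        ∫⁻ s in {s : ℝ | |‖x‖ - t| < s ∧ s < ‖x‖ + t ∧ t / 4 ≤ s},
          ENNReal.ofReal (radialKernel k ‖x‖ t s) * F s) ≤
      ⨆ z, (S z).indicator (fun _ => c z) x := by
    filter_upwards [ae_norm_pos k] with x hx
    refine iSup₂_le fun t htE => iSup_le fun hxt => ?_
    have ht : 0 < t := hE htE
    obtain ⟨m, hm1, hm2⟩ := exists_dyadic_scale ht
    obtain ⟨i, hi1, hi2⟩ := exists_dyadic_scale (lt_min hx ht)
    have him : i ≤ m := by
      have : i < m + 1 := (zpow_lt_zpow_iff_right₀ (one_lt_two : (1 : ℝ) < 2)).1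
        (hi1.trans_lt ((min_le_right _ _).trans_lt hm2))
      omega
    have hsub : {s : ℝ | |‖x‖ - t| < s ∧ s < ‖x‖ + t ∧ t / 4 ≤ s} ⊆
        Ico ((2 : ℝ) ^ (m - 2)) (2 ^ (m + 5)) := by
      intro s hs
      have e1 : (2 : ℝ) ^ (m - 2) = 2 ^ m / 4 := by rw [zpow_sub₀ two_ne_zero]; norm_num
      have e2 : (2 : ℝ) ^ (m + 5) = 2 ^ m * 32 := by rw [zpow_add₀ two_ne_zero]; norm_num
      rw [zpow_add_one₀ two_ne_zero] at hm2
      rw [mem_Ico, e1, e2]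
      constructor <;> linarith [hs.2.1, hs.2.2]
    have hSm : MeasurableSet {s : ℝ | |‖x‖ - t| < s ∧ s < ‖x‖ + t ∧ t / 4 ≤ s} :=
      measurableSet_Ioi.inter (measurableSet_Iio.inter measurableSet_Ici)
    refine (setLIntegral_kernel_le_indicator hSm (fun s hs => ⟨hs.1, hs.2.1⟩) hsub).trans ?_
    refine (Hpt (G m) hx ht hi1 hi2).trans ?_
    simp only [ENNReal.mul_iSup]
    refine iSup₂_le fun l a => iSup_le fun hla => ?_
    refine le_iSup_of_le ((l, (i, (m - i).toNat)), a) ?_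
    have hn : ((m - i).toNat : ℤ) = m - i := Int.toNat_of_nonneg (by omega)
    have hmem : x ∈ S ((l, (i, (m - i).toNat)), a) := by
      simp only [hS, hn, add_sub_cancel]
      refine ⟨?_, t, mem_dyadicPart htE hm1 hm2, hla⟩
      -- This puts `x` in the ball of radius `2^{i+4}`, whose small volume is needed when `r` is
      -- much smaller than `t`.
      have h8 : ‖x‖ ≤ 8 * min ‖x‖ t := by
        rcases min_cases ‖x‖ t with ⟨e, _⟩ | ⟨e, _⟩ <;> rw [e] <;> linarith
      rw [zpow_add_one₀ two_ne_zero] at hi2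
      rw [zpow_add₀ two_ne_zero]
      norm_num
      linarith
    rw [indicator_of_mem hmem]
    simp only [hc, hn, add_sub_cancel]
    rw [← twoPow_mul, mul_assoc (twoPow _)]
  refine (levelIntegral_rpow_le_tsum volume hp0 hpq hpt).trans ?_
  refine (ENNReal.tsum_le_tsum fun z => H (c z) (S z)).trans ?_
  rw [ENNReal.tsum_prod (f := fun (z : ℕ × (ℤ × ℕ)) (a : ℤ) =>
    C * (c (z, a) ^ p * volume (S (z, a))))]
  have hterm : ∀ z : ℕ × (ℤ × ℕ), ∑' a : ℤ, C * (c (z, a) ^ p * volume (S (z, a))) ≤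
      D * (twoPow (-(z.1 * (δ * p))) * (twoPow (-(z.2.2 * ((k + 1) * (2 - p)))) *
        annulusIntegral k p F (z.2.1 + z.2.2 + (-2)) (z.2.1 + z.2.2 + (-2) + (7 : ℕ)))) := by
    rintro ⟨l, i, v⟩
    have hvol : ∀ a : ℤ, volume (S ((l, i, v), a)) ≤ 24 * sphereArea k *
        (twoPow ((i + 4 : ℤ) * (k + 1)) * (A ^ (p / q) * twoPow (((i + v : ℤ) - (i - l : ℤ)) *
          ((k + 1) * (p - 1)))) * twoPow (i - l : ℤ)) := by
      intro a
      refine (volume_nearSet_le k E _ _ _ _).trans ?_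
      refine mul_le_mul' le_rfl (mul_le_mul' (mul_le_mul' le_rfl ?_) le_rfl)
      exact h.entropyNumber_le hp0 hq0 (by simp only; omega)
    have e1 : ∀ a : ℤ, C * (c ((l, i, v), a) ^ p * volume (S ((l, i, v), a))) ≤
        C * K ^ p * (24 * sphereArea k) * A ^ (p / q) * (twoPow ((-i + l * (κ + δ)) * p) *
          twoPow ((i + 4 : ℤ) * (k + 1)) *
          twoPow (((i + v : ℤ) - (i - l : ℤ)) * ((k + 1) * (p - 1))) * twoPow (i - l : ℤ)) *
          mass (G (i + v)) (i - l) a ^ p := by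
      intro a
      refine (mul_le_mul' le_rfl (mul_le_mul' le_rfl (hvol a))).trans (le_of_eq ?_)
      simp only [hc]
      rw [ENNReal.mul_rpow_of_nonneg K _ hp0.le, ENNReal.mul_rpow_of_nonneg (twoPow _) _ hp0.le,
        twoPow_rpow]
      ring
    refine (ENNReal.tsum_le_tsum e1).trans ?_
    rw [ENNReal.tsum_mul_left]
    have e2 : ∑' a, mass (G (i + v)) (i - l) a ^ p ≤ twoPow ((i - l : ℤ) * (p - 1)) *
        (twoPow (-((i + v - 2 : ℤ) * (k + 1))) * annulusIntegral k p F (i + v - 2) (i + v + 5)) :=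
      (tsum_mass_rpow_le hp (hGm _) _).trans
        (mul_le_mul' le_rfl (lintegral_indicator_annulus_le k hp0 F _ _))
    refine (mul_le_mul' le_rfl e2).trans (le_of_eq ?_)
    rw [show i + (v : ℤ) + (-2) + (7 : ℕ) = i + v + 5 by push_cast; ring, ← sub_eq_add_neg, hD,
      twoPow_mul, twoPow_mul, twoPow_mul]
    set X := annulusIntegral k p F (i + v - 2) (i + v + 5)
    calc _ = C * K ^ p * (24 * sphereArea k) * A ^ (p / q) *
          (twoPow ((-i + l * (κ + δ)) * p + (i + 4 : ℤ) * (k + 1) +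
            ((i + v : ℤ) - (i - l : ℤ)) * ((k + 1) * (p - 1)) + (i - l : ℤ)) *
            twoPow ((i - l : ℤ) * (p - 1)) * twoPow (-((i + v - 2 : ℤ) * (k + 1)))) * X := by ring
      _ = C * K ^ p * (24 * sphereArea k) * A ^ (p / q) *
          (twoPow (6 * (k + 1)) * twoPow (-(l * (δ * p))) *
            twoPow (-(v * ((k + 1) * (2 - p))))) * X := by
          rw [twoPow_mul, twoPow_mul, twoPow_mul, twoPow_mul]
          congr 3
          push_cast
          linear_combination (l : ℝ) * hδp
      _ = _ := by ring
  refine (ENNReal.tsum_le_tsum hterm).trans ?_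
  rw [ENNReal.tsum_mul_left, mul_assoc D]
  refine mul_le_mul' le_rfl ?_
  rw [ENNReal.tsum_prod (f := fun (l : ℕ) (z : ℤ × ℕ) => twoPow (-(l * (δ * p))) *
    (twoPow (-(z.2 * ((k + 1) * (2 - p)))) *
        annulusIntegral k p F (z.1 + z.2 + (-2)) (z.1 + z.2 + (-2) + (7 : ℕ))))]
  simp_rw [ENNReal.tsum_mul_left]
  rw [ENNReal.tsum_mul_right, mul_assoc (∑' l : ℕ, twoPow (-(l * (δ * p))))]
  exact mul_le_mul' le_rfl (tsum_twoPow_mul_annulusIntegral_le k p F (-2) 7 _)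

/-! ### Maximal dyadic intervals -/

theorem dyadicInterval_subset {i j a b : ℤ} (hij : i ≤ j) {s : ℝ} (h1 : s ∈ dyadicInterval i a)
    (h2 : s ∈ dyadicInterval j b) : dyadicInterval i a ⊆ dyadicInterval j b := by
  obtain ⟨n, rfl⟩ : ∃ n : ℕ, j = i + n := ⟨(j - i).toNat, by rw [Int.toNat_of_nonneg (by omega)]; ring⟩
  intro u hu
  have hfl : ∀ w : ℝ, ⌊w / 2 ^ (i + n : ℤ)⌋ = ⌊w / 2 ^ i⌋ / (2 ^ n : ℕ) := by
    intro w
    rw [← Int.floor_div_natCast, div_div, zpow_add₀ two_ne_zero]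
    simp
  rw [mem_dyadicInterval] at *
  rw [hfl] at *
  rw [hu, ← h1, h2]

/-- The maximal dyadic intervals of scale at most `2^M` on which the average of `G` exceeds
`2^lam`. -/
def maximalIntervals (G : ℝ → ℝ≥0∞) (M lam : ℤ) : Set (ℤ × ℤ) :=
  {J | J.1 ≤ M ∧ twoPow (lam + J.1 : ℤ) < mass G J.1 J.2 ∧
    ∀ j b : ℤ, J.1 < j → j ≤ M → dyadicInterval J.1 J.2 ⊆ dyadicInterval j b →
      mass G j b ≤ twoPow (lam + j : ℤ)}

theorem left_mem_dyadicInterval (i a : ℤ) : (a * 2 ^ i : ℝ) ∈ dyadicInterval i a := by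
  have : (0 : ℝ) < 2 ^ i := by positivity
  exact ⟨le_rfl, by linarith⟩

/-- The cap `M` on the scales guarantees a largest one, so no integrability of `G` is required. -/
theorem exists_maximalInterval {G : ℝ → ℝ≥0∞} {M lam i a : ℤ} (hi : i ≤ M)
    (h : twoPow (lam + i : ℤ) < mass G i a) :
    ∃ J ∈ maximalIntervals G M lam, i ≤ J.1 ∧ dyadicInterval i a ⊆ dyadicInterval J.1 J.2 := by
  obtain ⟨j, ⟨hj1, hj2, b, hj3, hj4⟩, hmax⟩ := Int.exists_greatest_of_bdd
    (P := fun j => j ≤ M ∧ i ≤ j ∧ ∃ b, dyadicInterval i a ⊆ dyadicInterval j b ∧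
      twoPow (lam + j : ℤ) < mass G j b) ⟨M, fun z hz => hz.1⟩ ⟨i, hi, le_rfl, a, subset_rfl, h⟩
  refine ⟨(j, b), ⟨hj1, hj4, fun j' b' h1 h2 h3 => ?_⟩, hj2, hj3⟩
  by_contra hcon
  have := hmax j' ⟨h2, by simp only at h1; omega, b', hj3.trans h3, not_le.1 hcon⟩
  simp only at h1
  omega

theorem disjoint_maximalIntervals {G : ℝ → ℝ≥0∞} {M lam : ℤ} :
    Pairwise (Function.onFun Disjoint
      fun J : maximalIntervals G M lam => dyadicInterval J.1.1 J.1.2) := by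
  rintro ⟨⟨i, a⟩, hi1, hi2, hi3⟩ ⟨⟨j, b⟩, hj1, hj2, hj3⟩ hne
  refine disjoint_left.2 fun s hs hs' => hne ?_
  simp only at *
  rcases lt_trichotomy i j with hij | rfl | hij
  · exact absurd (hi3 j b hij hj1 (dyadicInterval_subset hij.le hs hs')) (not_le.2 hj2)
  · rw [mem_dyadicInterval] at hs hs'
    subst hs hs'
    rfl
  · exact absurd (hj3 i a hij hi1 (dyadicInterval_subset hij.le hs' hs)) (not_le.2 hi2)

/-- The part of `G` above the level `2^lam`. -/
noncomputable def upperPart (G : ℝ → ℝ≥0∞) (lam : ℤ) : ℝ → ℝ≥0∞ :=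
  {s | twoPow lam < G s}.indicator G

theorem measurable_upperPart {G : ℝ → ℝ≥0∞} (hG : Measurable G) (lam : ℤ) :
    Measurable (upperPart G lam) :=
  hG.indicator (measurableSet_lt measurable_const hG)

/-- The values of `G` up to `2^{lam-1}` contribute at most half of the threshold `2^{lam+i}`, so the
upper part carries the other half. -/
theorem twoPow_le_of_lt_mass {G : ℝ → ℝ≥0∞} {lam i a : ℤ}
    (h : twoPow (lam + i : ℤ) < mass G i a) :
    twoPow i ≤ twoPow (1 - lam) * ∫⁻ s in dyadicInterval i a, upperPart G (lam - 1) s := by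
  set X := ∫⁻ s in dyadicInterval i a, upperPart G (lam - 1) s
  have h1 : mass G i a ≤ X + twoPow (lam - 1 + i) := by
    calc mass G i a ≤ ∫⁻ s in dyadicInterval i a,
          (upperPart G (lam - 1) s + twoPow ((lam - 1 : ℤ) : ℝ)) := by
          refine lintegral_mono fun s => ?_
          by_cases hs : twoPow ((lam - 1 : ℤ) : ℝ) < G s
          · have : upperPart G (lam - 1) s = G s := by
              rw [upperPart, indicator_of_mem (show s ∈ {s | twoPow ((lam - 1 : ℤ) : ℝ) < G s} from hs)]
            rw [this]
            exact le_self_add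
          · exact (not_lt.1 hs).trans le_add_self
      _ = _ := by
          rw [lintegral_add_right _ measurable_const, setLIntegral_const, volume_dyadicInterval,
            twoPow_mul]
          push_cast
          rfl
  have h2 : twoPow (lam + i : ℤ) = twoPow (lam - 1 + i) + twoPow (lam - 1 + i) := by
    rw [← two_mul, show (2 : ℝ≥0∞) = twoPow 1 by simp [twoPow], twoPow_mul]
    push_cast
    ring_nf
  have h3 : twoPow (lam - 1 + i) ≤ X :=
    (ENNReal.add_le_add_iff_right (twoPow_ne_top _)).1 (h2 ▸ h.le.trans h1)
  calc twoPow i = twoPow (1 - lam) * twoPow (lam - 1 + i) := by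
        rw [twoPow_mul]
        ring_nf
    _ ≤ _ := mul_le_mul' le_rfl h3

theorem tsum_maximalIntervals_le (G : ℝ → ℝ≥0∞) (M lam : ℤ) :
    ∑' J : maximalIntervals G M lam, twoPow J.1.1 ≤
      twoPow (1 - lam) * ∫⁻ s, upperPart G (lam - 1) s := by
  refine (ENNReal.tsum_le_tsum fun J => twoPow_le_of_lt_mass J.2.2.1).trans ?_
  rw [ENNReal.tsum_mul_left, ← lintegral_iUnion (fun J => measurableSet_dyadicInterval _ _)
    disjoint_maximalIntervals]
  exact mul_le_mul' le_rfl (setLIntegral_le_lintegral _ _)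

/-- The radii at which some dyadic interval of length `2^(m-l)`, at distance about `t ∈ E^m`,
carries an average above `2^lam`. -/
def highRadii (E : Set ℝ) (G : ℝ → ℝ≥0∞) (M : ℤ) (l : ℕ) (lam : ℤ) : Set ℝ :=
  {r | ∃ m ≤ M, ∃ t ∈ dyadicPart E m, ∃ a : ℤ, Near r t (a * 2 ^ (m - l)) (3 * 2 ^ (m - l)) ∧
    twoPow (lam + (m - l) : ℤ) < mass G (m - l) a}

theorem highRadii_subset (E : Set ℝ) (G : ℝ → ℝ≥0∞) (M : ℤ) (l : ℕ) (lam : ℤ) :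
    highRadii E G M l lam ⊆ ⋃ J : maximalIntervals G M lam,
      (Icc (J.1.2 * 2 ^ J.1.1 - 6 * 2 ^ J.1.1) (J.1.2 * 2 ^ J.1.1 + 6 * 2 ^ J.1.1) ∪
        Icc (-(J.1.2 * 2 ^ J.1.1) - 6 * 2 ^ J.1.1) (-(J.1.2 * 2 ^ J.1.1) + 6 * 2 ^ J.1.1)) ∪
      ⋃ n ∈ Finset.range l, {r : ℝ | ∃ t ∈ dyadicPart E (J.1.1 + 1 + n),
        Near r t (J.1.2 * 2 ^ J.1.1) (3 * 2 ^ (J.1.1 + 1))} := by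
  rintro r ⟨m, hm, t, ht, a, hnear, hmass⟩
  obtain ⟨J, hJ, hiJ, hsub⟩ := exists_maximalInterval (M := M) (by omega) hmass
  refine mem_iUnion.2 ⟨⟨J, hJ⟩, ?_⟩
  obtain ⟨j, b⟩ := J
  simp only at *
  have hj0 : (0 : ℝ) < 2 ^ j := by positivity
  have hi : (2 : ℝ) ^ (m - l : ℤ) ≤ 2 ^ j := zpow_le_zpow_right₀ one_le_two hiJ
  have hab := hsub (left_mem_dyadicInterval _ _)
  rw [dyadicInterval, mem_Ico] at hab
  have ht0 : 0 < t := lt_of_lt_of_le (by positivity) ht.1.1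
  set y : ℝ := a * 2 ^ (m - l : ℤ)
  set w : ℝ := b * 2 ^ j with hw
  have hy1 : w ≤ y := hab.1
  have hy2 : y ≤ w + 2 ^ j := by rw [hw]; linarith [hab.2]
  -- If the maximal interval `J` has length `2^j ≥ 2^m`, then `t ≤ 2 · 2^j` and `r` lies in a fixed
  -- dilate of `J` or its reflection, whatever `E` is: the errors are `3` from `Near`, `2` from `t`
  -- and `1` from the position in `J`, in units of `2^j`. Otherwise `j < m ≤ j + l`, and only `l`
  -- values of `m` remain.
  rcases le_or_gt m j with hmj | hmj
  · left
    have ht2 : t ≤ 2 ^ j * 2 := by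
      refine ht.1.2.trans ?_
      rw [← zpow_add_one₀ two_ne_zero]
      exact zpow_le_zpow_right₀ one_le_two (by omega)
    rcases hnear with hr | hr | hr <;> rw [abs_le] at hr
    · exact Or.inl ⟨by linarith, by linarith⟩
    · exact Or.inr ⟨by linarith, by linarith⟩
    · exact Or.inl ⟨by linarith, by linarith⟩
  · right
    refine mem_biUnion (x := (m - (j + 1)).toNat) ?_ ?_
    · rw [Finset.mem_coe, Finset.mem_range]
      omega
    · have e : j + 1 + ((m - (j + 1)).toNat : ℤ) = m := by
        rw [Int.toNat_of_nonneg (by omega)]; ring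
      rw [mem_ofPred_eq, e]
      refine ⟨t, ht, ?_⟩
      rw [zpow_add_one₀ two_ne_zero]
      rcases hnear with hr | hr | hr <;> rw [abs_le] at hr
      · exact Or.inl (abs_le.2 ⟨by linarith, by linarith⟩)
      · exact Or.inr (Or.inl (abs_le.2 ⟨by linarith, by linarith⟩))
      · exact Or.inr (Or.inr (abs_le.2 ⟨by linarith, by linarith⟩))

/-- A weak-type bound uniform in all `m ≤ M`. Each maximal interval accounts for radii of measure at
most its length times `(l+1) 2^{l(k+1)(p-1)}`, by the bound for single entropy numbers, and the
maximal intervals are disjoint. -/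
theorem volume_highRadii_le {k : ℕ} {p q : ℝ} (hp : 1 ≤ p) (hq : 0 < q) {E : Set ℝ}
    {A : ℝ≥0∞} (h : EntropyBound k p q E A) (G : ℝ → ℝ≥0∞) (M : ℤ) (l : ℕ) (lam : ℤ) :
    volume (highRadii E G M l lam) ≤ (24 + 48 * A ^ (p / q)) * (l + 1 : ℕ) *
      twoPow (l * ((k + 1) * (p - 1))) * (twoPow (1 - lam) * ∫⁻ s, upperPart G (lam - 1) s) := by
  have hp0 : 0 < p := by linarith
  set B := A ^ (p / q)
  set P := twoPow (l * ((k + 1) * (p - 1))) with hP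
  have hexp : (0 : ℝ) ≤ (k + 1) * (p - 1) := mul_nonneg (by positivity) (by linarith)
  have hP1 : 1 ≤ P := by
    rw [← twoPow_zero]
    exact twoPow_mono (by positivity)
  have hvol : ∀ (j : ℤ) (y : ℝ), volume (Icc (y - 6 * 2 ^ j) (y + 6 * 2 ^ j)) = 12 * twoPow j :=
    fun j y => by
      rw [Real.volume_Icc, twoPow_intCast, show y + 6 * 2 ^ j - (y - 6 * 2 ^ j) = 12 * 2 ^ j by ring,
        ENNReal.ofReal_mul (by norm_num)]
      simp
  refine (measure_mono (highRadii_subset E G M l lam)).trans ?_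
  refine (measure_iUnion_le _).trans ?_
  have hJ : ∀ J : maximalIntervals G M lam, volume
      ((Icc (J.1.2 * 2 ^ J.1.1 - 6 * 2 ^ J.1.1) (J.1.2 * 2 ^ J.1.1 + 6 * 2 ^ J.1.1) ∪
        Icc (-(J.1.2 * 2 ^ J.1.1) - 6 * 2 ^ J.1.1) (-(J.1.2 * 2 ^ J.1.1) + 6 * 2 ^ J.1.1)) ∪
      ⋃ n ∈ Finset.range l, {r : ℝ | ∃ t ∈ dyadicPart E (J.1.1 + 1 + n),
        Near r t (J.1.2 * 2 ^ J.1.1) (3 * 2 ^ (J.1.1 + 1))} : Set ℝ) ≤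
      (24 + 48 * B) * (l + 1 : ℕ) * P * twoPow J.1.1 := by
    intro J
    have hn : ∀ n ∈ Finset.range l, volume {r : ℝ | ∃ t ∈ dyadicPart E (J.1.1 + 1 + n),
        Near r t (J.1.2 * 2 ^ J.1.1) (3 * 2 ^ (J.1.1 + 1))} ≤ 48 * B * P * twoPow J.1.1 := by
      intro n hn
      refine (volume_near_le E _ _ _).trans ?_
      have h1 := h.entropyNumber_le hp0 hq (show J.1.1 + 1 ≤ J.1.1 + 1 + (n : ℤ) by omega)
      have h2 : twoPow (((J.1.1 + 1 + n : ℤ) - (J.1.1 + 1 : ℤ)) * ((k + 1) * (p - 1))) ≤ P := by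
        refine twoPow_mono (mul_le_mul_of_nonneg_right ?_ hexp)
        push_cast
        rw [add_sub_cancel_left]
        exact_mod_cast (Finset.mem_range.1 hn).le
      have h3 : twoPow (J.1.1 + 1 : ℤ) = 2 * twoPow J.1.1 := by
        rw [show (2 : ℝ≥0∞) = twoPow 1 by simp [twoPow], twoPow_mul]
        push_cast
        ring_nf
      rw [h3]
      calc _ ≤ 24 * (B * P) * (2 * twoPow J.1.1) :=
            mul_le_mul' (mul_le_mul' le_rfl (h1.trans (mul_le_mul' le_rfl h2))) le_rfl
        _ = _ := by ring
    calc _ ≤ (12 * twoPow J.1.1 + 12 * twoPow J.1.1) + ∑ n ∈ Finset.range l, 48 * B * P * twoPow J.1.1 := by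
          refine (measure_union_le _ _).trans (add_le_add ?_ ?_)
          · exact (measure_union_le _ _).trans (add_le_add (hvol _ _).le (hvol _ _).le)
          · exact (measure_biUnion_finset_le _ _).trans (Finset.sum_le_sum hn)
      _ = 24 * twoPow J.1.1 + l * (48 * B * P * twoPow J.1.1) := by
          rw [Finset.sum_const, Finset.card_range, nsmul_eq_mul]
          ring
      _ ≤ 24 * ((l + 1 : ℕ) * P * twoPow J.1.1) + (l + 1 : ℕ) * (48 * B * P * twoPow J.1.1) := by
          refine add_le_add (mul_le_mul' le_rfl ?_) (mul_le_mul' (by simp) le_rfl)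
          refine le_mul_of_one_le_left zero_le ?_
          exact one_le_mul (by simp) hP1
      _ = _ := by ring
  refine (ENNReal.tsum_le_tsum hJ).trans ?_
  rw [ENNReal.tsum_mul_left]
  exact mul_le_mul' le_rfl (tsum_maximalIntervals_le G M lam)

/-! ### Summation over levels, and the region `r > 8t` -/

theorem le_iSup_twoPow (x : ℝ≥0∞) :
    x ≤ ⨆ (lam : ℤ) (_ : twoPow lam < x), twoPow (lam + 1) := by
  rcases eq_or_ne x 0 with rfl | h0
  · exact zero_le
  rcases eq_or_ne x ∞ with rfl | ht
  · rw [top_le_iff, iSup_eq_top]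
    intro b hb
    obtain ⟨n, hn⟩ := ENNReal.exists_nat_gt hb.ne
    refine ⟨n, ?_⟩
    rw [iSup_pos (twoPow_ne_top _).lt_top]
    refine hn.trans_le ?_
    have h1 : twoPow ((n : ℤ) : ℝ) = 2 ^ n := by simp [twoPow]
    calc (n : ℝ≥0∞) ≤ (2 ^ n : ℕ) := by exact_mod_cast n.lt_two_pow_self.le
      _ = twoPow ((n : ℤ) : ℝ) := by rw [h1]; push_cast; rfl
      _ ≤ _ := twoPow_mono (by linarith)
  · obtain ⟨n, h1, h2⟩ := ENNReal.exists_mem_Ioc_zpow h0 ht (y := 2) (by norm_num) (by simp)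
    have e : ∀ z : ℤ, (2 : ℝ≥0∞) ^ z = twoPow z := fun z => by simp [twoPow]
    rw [e] at h1 h2
    refine h2.trans (le_iSup₂_of_le n h1 ?_)
    push_cast
    rfl

/-- Only levels with `2^{lam-1} < G s` contribute, and the weights `2^{lam(p-1)}` are dominated by
the largest such level. This passes from weak type to strong type and is where `p > 1` is
indispensable. -/
theorem tsum_upperPart_le {p : ℝ} (hp : 1 < p) : ∃ C : ℝ≥0∞, C ≠ ∞ ∧ ∀ (G : ℝ → ℝ≥0∞) (s : ℝ),
    ∑' lam : ℤ, twoPow (lam * (p - 1)) * upperPart G (lam - 1) s ≤ C * G s ^ p := by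
  have hp1 : 0 < p - 1 := by linarith
  set Z := ∑' l : ℕ, twoPow (-(l * (p - 1)))
  refine ⟨twoPow (p - 1) * Z, ENNReal.mul_ne_top (twoPow_ne_top _) (tsum_twoPow_lt_top hp1).ne,
    fun G s => ?_⟩
  have hZ0 : Z ≠ 0 := by
    refine (lt_of_lt_of_le ?_ (ENNReal.le_tsum 0)).ne'
    exact pos_iff_ne_zero.2 (twoPow_ne_zero _)
  rcases eq_or_ne (G s) 0 with h0 | h0
  · have : ∀ lam : ℤ, upperPart G lam s = 0 := fun lam => by
      simp [upperPart, h0]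
    simp [this]
  rcases eq_or_ne (G s) ∞ with ht | ht
  · rw [ht, ENNReal.top_rpow_of_pos (by linarith),
      ENNReal.mul_top (mul_ne_zero (twoPow_ne_zero _) hZ0)]
    exact le_top
  obtain ⟨n, h1, h2⟩ := ENNReal.exists_mem_Ioc_zpow h0 ht (y := 2) (by norm_num) (by simp)
  have e : ∀ z : ℤ, (2 : ℝ≥0∞) ^ z = twoPow z := fun z => by simp [twoPow]
  rw [e] at h1 h2
  set φ : ℤ → ℝ≥0∞ := fun lam => twoPow (lam * (p - 1)) * upperPart G (lam - 1) s with hφ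
  have hsupp : Function.support φ ⊆ range fun l : ℕ => n + 1 - (l : ℤ) := by
    intro lam hlam
    have hlt : twoPow ((lam - 1 : ℤ) : ℝ) < G s := by
      by_contra hcon
      refine hlam ?_
      simp only [hφ, upperPart]
      rw [indicator_of_notMem (show s ∉ {s | twoPow ((lam - 1 : ℤ) : ℝ) < G s} from hcon), mul_zero]
    have : lam - 1 < n + 1 := by
      by_contra hcon
      exact absurd (hlt.trans_le h2) (not_lt.2 (twoPow_mono (by exact_mod_cast not_lt.1 hcon)))
    exact ⟨(n + 1 - lam).toNat, by simp only; rw [Int.toNat_of_nonneg (by omega)]; ring⟩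
  have hinj : Function.Injective fun l : ℕ => n + 1 - (l : ℤ) := fun a b hab => by
    simp only at hab; omega
  rw [← hinj.tsum_eq hsupp]
  have hterm : ∀ l : ℕ, φ (n + 1 - l) ≤
      twoPow (p - 1) * G s ^ p * twoPow (-(l * (p - 1))) := by
    intro l
    have h3 : twoPow ((n + 1 - (l : ℤ) : ℤ) * (p - 1)) =
        twoPow (p - 1) * twoPow n ^ (p - 1) * twoPow (-(l * (p - 1))) := by
      rw [twoPow_rpow, twoPow_mul, twoPow_mul]
      push_cast
      ring_nf
    have h4 : G s ^ p = G s ^ (p - 1) * G s := by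
      conv_rhs => rw [← ENNReal.rpow_one (G s), ← ENNReal.rpow_mul, one_mul]
      rw [← ENNReal.rpow_add _ _ h0 ht, sub_add_cancel]
    simp only [hφ]
    rw [h3, h4]
    calc _ ≤ twoPow (p - 1) * G s ^ (p - 1) * twoPow (-(l * (p - 1))) * G s := by
          gcongr
          exact indicator_le_self _ _ _
      _ = _ := by ring
  refine (ENNReal.tsum_le_tsum hterm).trans (le_of_eq ?_)
  rw [ENNReal.tsum_mul_left]
  ring

/-- Absorbs the factor `l + 1` coming from the choices of `m` between `j` and `j + l`. -/
theorem natCast_succ_le_twoPow {ε : ℝ} (hε : 0 ≤ ε) (l : ℕ) :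
    ((l + 1 : ℕ) : ℝ≥0∞) ≤ (∑' n : ℕ, twoPow (-(n * ε))) * twoPow (l * ε) := by
  calc ((l + 1 : ℕ) : ℝ≥0∞) = ∑ n ∈ Finset.range (l + 1), 1 := by simp
    _ ≤ ∑ n ∈ Finset.range (l + 1), twoPow (-(n * ε)) * twoPow (l * ε) := by
        refine Finset.sum_le_sum fun n hn => ?_
        rw [twoPow_mul, ← twoPow_zero]
        refine twoPow_mono ?_
        have : (n : ℝ) ≤ l := by exact_mod_cast Nat.lt_succ_iff.1 (Finset.mem_range.1 hn)
        nlinarith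
    _ ≤ _ := by
        rw [← Finset.sum_mul]
        exact mul_le_mul' (ENNReal.sum_le_tsum _) le_rfl

/-- The part of the maximal function with `r > 8 t`. -/
theorem levelIntegral_outer_le {k : ℕ} {p q : ℝ} (hp1 : 1 < p) (hpd : p * (k + 1) < k + 2)
    (hpq : p ≤ q) {E : Set ℝ} (hE : E ⊆ Ioi 0) {A : ℝ≥0∞} (hA : A ≠ ∞)
    (h : EntropyBound k p q E A) :
    ∃ C : ℝ≥0∞, C ≠ ∞ ∧ ∀ F : ℝ → ℝ≥0∞, Measurable F →
      levelIntegral volume p q (fun x : Euc k => ⨆ t ∈ E, ⨆ _ : 8 * t < ‖x‖,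
        ∫⁻ s in Ioo |‖x‖ - t| (‖x‖ + t),
          ENNReal.ofReal (radialKernel k ‖x‖ t s) * F s) ^ (p / q) ≤
      C * profileIntegral k p F := by
  have hp : 1 ≤ p := hp1.le
  have hp0 : 0 < p := by linarith
  have hq0 : 0 < q := by linarith
  set δ : ℝ := ((1 - 1 / (k + 2)) * p - (k + 1) * (p - 1)) / (2 * p) with hδ
  have hδ0 : 0 < δ := div_pos (by linarith [decay_pos hpd]) (by linarith)
  have hδp : 2 * (δ * p) = (1 - 1 / (k + 2)) * p - (k + 1) * (p - 1) := by rw [hδ]; field_simp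
  clear_value δ
  set κ : ℝ := 1 / (k + 2) with hκ
  -- The spare decay is `2^{-lδp}`; half of it pays for the factor `l + 1`, the other half for the
  -- sum over `l`.
  set ε : ℝ := δ * p / 2 with hε
  have hε0 : 0 < ε := by positivity
  obtain ⟨K, hK, Hpt⟩ := lintegral_kernel_le k hδ0
  obtain ⟨C, hC, H⟩ := levelIntegral_indicator_rpow_le (volume : Measure (Euc k)) hp0 hpq
  obtain ⟨U, hU, HU⟩ := tsum_upperPart_le hp1
  set Z := ∑' n : ℕ, twoPow (-(n * ε)) with hZ
  have hZt : Z ≠ ∞ := (tsum_twoPow_lt_top hε0).ne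
  set B := (24 + 48 * A ^ (p / q)) with hB
  have hBt : B ≠ ∞ := by
    have h4 : A ^ (p / q) ≠ ∞ := ENNReal.rpow_ne_top_of_nonneg (by positivity) hA
    finiteness
  clear_value B Z
  set D := C * K ^ p * sphereArea k * B * Z * twoPow (p + 1 + 2 * (k + 1)) with hD
  have hDt : D ≠ ∞ := by
    have h1 := sphereArea_ne_top k
    have h2 := twoPow_ne_top (p + 1 + 2 * (k + 1))
    have h3 : K ^ p ≠ ∞ := ENNReal.rpow_ne_top_of_nonneg hp0.le hK
    finiteness
  refine ⟨D * (Z * (U * (3 : ℕ))), ?_, fun F hF => ?_⟩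
  · exact ENNReal.mul_ne_top hDt (ENNReal.mul_ne_top hZt (ENNReal.mul_ne_top hU (by simp)))
  -- Since `|s - r| < t < r/8`, the relevant annulus is determined by the size of `r` alone and
  -- serves all `t` simultaneously.
  set G : ℤ → ℝ → ℝ≥0∞ := fun m => (Ico ((2 : ℝ) ^ (m - 1)) (2 ^ (m + 2))).indicator F with hG
  have hGm : ∀ j, Measurable (G j) := fun j => hF.indicator measurableSet_Ico
  set c : (ℕ × ℤ) × ℤ → ℝ≥0∞ := fun z =>
    K * twoPow (z.1.1 * (κ + δ) - z.1.1 + (z.2 + 1)) with hc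
  set S : (ℕ × ℤ) × ℤ → Set (Euc k) := fun z =>
    {x | ‖x‖ < 2 ^ (z.1.2 + 1) ∧ ‖x‖ ∈ highRadii E (G z.1.2) z.1.2 z.1.1 z.2} with hS
  have hpt : ∀ᵐ x : Euc k, (⨆ t ∈ E, ⨆ _ : 8 * t < ‖x‖,
        ∫⁻ s in Ioo |‖x‖ - t| (‖x‖ + t),
          ENNReal.ofReal (radialKernel k ‖x‖ t s) * F s) ≤
      ⨆ z, (S z).indicator (fun _ => c z) x := by
    filter_upwards [ae_norm_pos k] with x hx
    refine iSup₂_le fun t htE => iSup_le fun hxt => ?_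
    have ht : 0 < t := hE htE
    obtain ⟨m, hm1, hm2⟩ := exists_dyadic_scale ht
    obtain ⟨M, hM1, hM2⟩ := exists_dyadic_scale hx
    have hmM : m ≤ M := by
      have : m < M + 1 := (zpow_lt_zpow_iff_right₀ (one_lt_two : (1 : ℝ) < 2)).1
        (hm1.trans_lt (by linarith))
      omega
    have hmin : min ‖x‖ t = t := min_eq_right (by linarith)
    have hsub : Ioo |‖x‖ - t| (‖x‖ + t) ⊆ Ico ((2 : ℝ) ^ (M - 1)) (2 ^ (M + 2)) := by
      intro s hs
      have e1 : (2 : ℝ) ^ (M - 1) = 2 ^ M / 2 := by rw [zpow_sub₀ two_ne_zero]; norm_num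
      have e2 : (2 : ℝ) ^ (M + 2) = 2 ^ M * 4 := by rw [zpow_add₀ two_ne_zero]; norm_num
      rw [zpow_add_one₀ two_ne_zero] at hM2
      have h1 := hs.1
      have h2 := hs.2
      rw [abs_of_pos (by linarith)] at h1
      rw [mem_Ico, e1, e2]
      constructor <;> linarith
    refine (setLIntegral_kernel_le_indicator measurableSet_Ioo subset_rfl hsub).trans ?_
    refine (Hpt (G M) hx ht (by rwa [hmin]) (by rwa [hmin])).trans ?_
    simp only [ENNReal.mul_iSup]
    refine iSup₂_le fun l a => iSup_le fun hla => ?_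
    -- The average over the dyadic interval. Replacing it by a dyadic level `lam` removes `m` and
    -- `a` from the height, so the supremum over them becomes a union of sets inside `highRadii`.
    set X := twoPow (-(m - l : ℤ)) * mass (G M) (m - l) a with hX
    have e : K * (twoPow (-m) * (twoPow (l * (κ + δ)) * mass (G M) (m - l) a)) =
        K * twoPow (l * (κ + δ) - l) * X := by
      have : twoPow (-m) * twoPow (l * (κ + δ)) =
          twoPow (l * (κ + δ) - l) * twoPow (-(m - l : ℤ)) := by
        rw [twoPow_mul, twoPow_mul]
        push_cast
        ring_nf
      calc _ = K * (twoPow (-m) * twoPow (l * (κ + δ))) * mass (G M) (m - l) a := by ring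
        _ = _ := by rw [this, hX]; ring
    rw [e]
    refine (mul_le_mul' le_rfl (le_iSup_twoPow X)).trans ?_
    simp only [ENNReal.mul_iSup]
    refine iSup₂_le fun lam hlam => ?_
    refine le_iSup_of_le ((l, M), lam) ?_
    have hmem : x ∈ S ((l, M), lam) := by
      refine ⟨hM2, m, hmM, t, mem_dyadicPart htE hm1 hm2, a, hla, ?_⟩
      simp only
      calc twoPow ((lam + (m - l) : ℤ) : ℝ) = twoPow (m - l : ℤ) * twoPow lam := by
            rw [twoPow_mul]
            push_cast
            ring_nf
        _ < twoPow (m - l : ℤ) * X :=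
            ENNReal.mul_lt_mul_right (twoPow_ne_zero _) (twoPow_ne_top _) hlam
        _ = _ := by
            rw [hX, ← mul_assoc, twoPow_mul, add_neg_cancel, twoPow_zero, one_mul]
    rw [indicator_of_mem hmem]
    simp only [hc]
    rw [mul_assoc, twoPow_mul]
  refine (levelIntegral_rpow_le_tsum volume hp0 hpq hpt).trans ?_
  refine (ENNReal.tsum_le_tsum fun z => H (c z) (S z)).trans ?_
  rw [ENNReal.tsum_prod (f := fun (z : ℕ × ℤ) (lam : ℤ) =>
    C * (c (z, lam) ^ p * volume (S (z, lam))))]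
  have hterm : ∀ z : ℕ × ℤ, ∑' lam : ℤ, C * (c (z, lam) ^ p * volume (S (z, lam))) ≤
      D * (twoPow (-(z.1 * ε)) * (U *
        annulusIntegral k p F (z.2 + (-1)) (z.2 + (-1) + (3 : ℕ)))) := by
    rintro ⟨l, M⟩
    set W : ℤ → ℝ≥0∞ := fun lam => ∫⁻ s, upperPart (G M) (lam - 1) s with hW
    set Y := C * K ^ p * sphereArea k * B * Z * twoPow (p + 1 + (M + 1) * (k + 1) - l * ε) with hY
    have e1 : ∀ lam : ℤ, C * (c ((l, M), lam) ^ p * volume (S ((l, M), lam))) ≤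
        Y * (twoPow (lam * (p - 1)) * W lam) := by
      intro lam
      have hvol : volume (S ((l, M), lam)) ≤ sphereArea k * twoPow ((M + 1 : ℤ) * (k + 1)) *
          (B * (Z * twoPow (l * ε)) * twoPow (l * ((k + 1) * (p - 1))) *
            (twoPow (1 - lam) * W lam)) := by
        refine (volume_radial_le k (M + 1) _).trans (mul_le_mul' le_rfl ?_)
        refine (volume_highRadii_le hp hq0 h (G M) M l lam).trans ?_
        refine mul_le_mul' (mul_le_mul' (mul_le_mul' hB.ge ?_) le_rfl) le_rfl
        rw [hZ]
        exact natCast_succ_le_twoPow hε0.le l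
      refine (mul_le_mul' le_rfl (mul_le_mul' le_rfl hvol)).trans (le_of_eq ?_)
      simp only [hc]
      rw [ENNReal.mul_rpow_of_nonneg K _ hp0.le, twoPow_rpow]
      calc _ = C * K ^ p * sphereArea k * B * Z *
            (twoPow ((l * (κ + δ) - l + (lam + 1)) * p) * twoPow ((M + 1 : ℤ) * (k + 1)) *
              twoPow (l * ε) * twoPow (l * ((k + 1) * (p - 1))) * twoPow (1 - lam)) * W lam := by
            ring
        _ = C * K ^ p * sphereArea k * B * Z *
            (twoPow (p + 1 + (M + 1) * (k + 1) - l * ε) * twoPow (lam * (p - 1))) * W lam := by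
            rw [twoPow_mul, twoPow_mul, twoPow_mul, twoPow_mul, twoPow_mul]
            congr 3
            push_cast
            rw [hε]
            linear_combination (l : ℝ) * hδp
        _ = _ := by rw [hY]; ring
    refine (ENNReal.tsum_le_tsum e1).trans ?_
    rw [ENNReal.tsum_mul_left]
    have e2 : ∑' lam : ℤ, twoPow (lam * (p - 1)) * W lam ≤
        U * (twoPow (-((M - 1 : ℤ) * (k + 1))) * annulusIntegral k p F (M - 1) (M + 2)) := by
      calc _ = ∫⁻ s, ∑' lam : ℤ, twoPow (lam * (p - 1)) * upperPart (G M) (lam - 1) s := by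
            rw [lintegral_tsum fun lam =>
              ((measurable_upperPart (hGm M) _).const_mul _).aemeasurable]
            refine tsum_congr fun lam => ?_
            rw [lintegral_const_mul' _ _ (twoPow_ne_top _)]
        _ ≤ ∫⁻ s, U * G M s ^ p := lintegral_mono fun s => HU (G M) s
        _ = U * ∫⁻ s, G M s ^ p := lintegral_const_mul' _ _ hU
        _ ≤ _ := mul_le_mul' le_rfl (lintegral_indicator_annulus_le k hp0 F _ _)
    refine (mul_le_mul' le_rfl e2).trans (le_of_eq ?_)
    rw [show M + (-1) + (3 : ℕ) = M + 2 by push_cast; ring, ← sub_eq_add_neg, hY, hD]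
    set X := annulusIntegral k p F (M - 1) (M + 2)
    calc _ = C * K ^ p * sphereArea k * B * Z * (twoPow (p + 1 + (M + 1) * (k + 1) - l * ε) *
          twoPow (-((M - 1 : ℤ) * (k + 1)))) * (U * X) := by ring
      _ = C * K ^ p * sphereArea k * B * Z * (twoPow (p + 1 + 2 * (k + 1)) *
          twoPow (-(l * ε))) * (U * X) := by
          rw [twoPow_mul, twoPow_mul]
          congr 3
          push_cast
          ring
      _ = _ := by ring
  refine (ENNReal.tsum_le_tsum hterm).trans ?_
  rw [ENNReal.tsum_mul_left, mul_assoc D]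
  refine mul_le_mul' le_rfl ?_
  rw [ENNReal.tsum_prod (f := fun (l : ℕ) (M : ℤ) => twoPow (-(l * ε)) *
    (U * annulusIntegral k p F (M + (-1)) (M + (-1) + (3 : ℕ))))]
  simp_rw [ENNReal.tsum_mul_left]
  rw [ENNReal.tsum_mul_right, mul_assoc Z, mul_assoc U, ← hZ]
  exact mul_le_mul' le_rfl (mul_le_mul' le_rfl (tsum_annulusIntegral_le k p F (-1) 3))

/-! ### Sufficiency of the entropy condition, `p > 1` -/

theorem profileIntegral_const_mul (k : ℕ) {p : ℝ} (hp : 0 < p) {c : ℝ≥0∞} (hc : c ≠ ∞)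
    (F : ℝ → ℝ≥0∞) :
    profileIntegral k p (fun s => c * F s) = c ^ p * profileIntegral k p F := by
  unfold profileIntegral
  rw [← lintegral_const_mul' _ _ (ENNReal.rpow_ne_top_of_nonneg hp.le hc)]
  refine lintegral_congr fun s => ?_
  rw [ENNReal.mul_rpow_of_nonneg _ _ hp.le]
  ring

theorem add_add_le_of_le {a b c x : ℝ≥0∞} (ha : 3 * a ≤ x) (hb : 3 * b ≤ x) (hc : 3 * c ≤ x) :
    a + b + c ≤ x := by
  have h : 3 * (a + b + c) ≤ 3 * x := by
    calc 3 * (a + b + c) = 3 * a + 3 * b + 3 * c := by ring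
      _ ≤ x + x + x := add_le_add (add_le_add ha hb) hc
      _ = 3 * x := by ring
  exact (ENNReal.mul_le_mul_iff_right (by simp) (by simp)).1 h

/-- For `r ≤ 8t` the integral splits into three pieces, for `r > 8t` it is a single piece; the four
corresponding maximal functions were bounded above, and the level integral of their supremum is
controlled by subadditivity. -/
theorem exists_levelIntegral_maximalFunction_le {k : ℕ} {p q : ℝ} (hp1 : 1 < p)
    (hpd : p * (k + 1) < k + 2) (hpq : p ≤ q) {E : Set ℝ} (hE : E ⊆ Ioi 0) {A : ℝ≥0∞}
    (hA : A ≠ ∞) (h : EntropyBound k p q E A) :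
    ∃ C : ℝ≥0∞, C ≠ ∞ ∧ ∀ f : Euc k → ℂ, IsRadial f → MemLp f (ENNReal.ofReal p) volume →
      levelIntegral volume p q (maximalFunction E f) ^ (p / q) ≤
        C * eLpNorm f (ENNReal.ofReal p) volume ^ p := by
  have hp0 : 0 < p := by linarith
  obtain ⟨C₁, hC₁, H₁⟩ := levelIntegral_far_le hp1.le hpd hpq hE hA h
  obtain ⟨C₂, hC₂, H₂⟩ := levelIntegral_near_le hp1.le hpd hpq hE hA h
  obtain ⟨C₃, hC₃, H₃⟩ := levelIntegral_comparable_le hp1.le hpd hpq hE hA h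
  obtain ⟨C₄, hC₄, H₄⟩ := levelIntegral_outer_le hp1 hpd hpq hE hA h
  obtain ⟨c, hc, Hc⟩ := lintegral_sphere_le k
  have hc3 : 3 * c ≠ ∞ := ENNReal.mul_ne_top (by simp) hc
  refine ⟨(C₁ + C₂ + C₃ + C₄) * ((3 * c) ^ p * (sphereArea k)⁻¹), ?_, fun f hrad hf => ?_⟩
  · have h1 : (3 * c) ^ p ≠ ∞ := ENNReal.rpow_ne_top_of_nonneg hp0.le hc3
    have h2 : (sphereArea k)⁻¹ ≠ ∞ := ENNReal.inv_ne_top.2 (sphereArea_ne_zero k)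
    finiteness
  obtain ⟨F, hF, HF, HFn⟩ := exists_profile hp0 hrad hf.1
  -- The factor `3` lets a sum of three pieces be bounded by the largest of the tripled ones, so
  -- that a supremum suffices.
  set F' : ℝ → ℝ≥0∞ := fun s => 3 * c * F s with hF'
  have hF'm : Measurable F' := hF.const_mul _
  set P : Fin 4 → Euc k → ℝ≥0∞ := ![
    fun x => ⨆ t ∈ E, ∫⁻ s in {s : ℝ | |‖x‖ - t| < s ∧ 2 * |‖x‖ - t| ≤ s ∧ s < t / 4},
      ENNReal.ofReal (radialKernel k ‖x‖ t s) * F' s,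
    fun x => ⨆ t ∈ E, ∫⁻ s in {s : ℝ | |‖x‖ - t| < s ∧ s < 2 * |‖x‖ - t| ∧ s < t / 4},
      ENNReal.ofReal (radialKernel k ‖x‖ t s) * F' s,
    fun x => ⨆ t ∈ E, ⨆ _ : ‖x‖ ≤ 8 * t,
      ∫⁻ s in {s : ℝ | |‖x‖ - t| < s ∧ s < ‖x‖ + t ∧ t / 4 ≤ s},
        ENNReal.ofReal (radialKernel k ‖x‖ t s) * F' s,
    fun x => ⨆ t ∈ E, ⨆ _ : 8 * t < ‖x‖, ∫⁻ s in Ioo |‖x‖ - t| (‖x‖ + t),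
      ENNReal.ofReal (radialKernel k ‖x‖ t s) * F' s] with hP
  have hpt : ∀ᵐ x : Euc k, maximalFunction E f x ≤ ⨆ i, P i x := by
    filter_upwards [ae_norm_pos k] with x hx
    refine iSup₂_le fun t htE => ?_
    have ht : 0 < t := hE htE
    have hx0 : x ≠ 0 := norm_pos_iff.1 hx
    refine (HF x hx0 t ht).trans ((Hc F hF x t hx0 ht).trans ?_)
    have hpull : ∀ S : Set ℝ, ∫⁻ s in S, ENNReal.ofReal (radialKernel k ‖x‖ t s) * F' s =
        3 * (c * ∫⁻ s in S, ENNReal.ofReal (radialKernel k ‖x‖ t s) * F s) := fun S => by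
      rw [← mul_assoc, ← lintegral_const_mul' _ _ hc3]
      refine lintegral_congr fun s => ?_
      simp only [hF']
      ring
    rcases le_or_gt ‖x‖ (8 * t) with hxt | hxt
    · calc c * ∫⁻ s in Ioo |‖x‖ - t| (‖x‖ + t), ENNReal.ofReal (radialKernel k ‖x‖ t s) * F s
          ≤ c * ((∫⁻ s in {s : ℝ | |‖x‖ - t| < s ∧ 2 * |‖x‖ - t| ≤ s ∧ s < t / 4},
              ENNReal.ofReal (radialKernel k ‖x‖ t s) * F s) +
            (∫⁻ s in {s : ℝ | |‖x‖ - t| < s ∧ s < 2 * |‖x‖ - t| ∧ s < t / 4},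
              ENNReal.ofReal (radialKernel k ‖x‖ t s) * F s) +
            ∫⁻ s in {s : ℝ | |‖x‖ - t| < s ∧ s < ‖x‖ + t ∧ t / 4 ≤ s},
              ENNReal.ofReal (radialKernel k ‖x‖ t s) * F s) := by
            refine mul_le_mul' le_rfl ?_
            refine le_trans (lintegral_mono_set ?_) ((lintegral_union_le _ _ _).trans
              (add_le_add (lintegral_union_le _ _ _) le_rfl))
            intro s hs
            rcases lt_or_ge s (t / 4) with h4 | h4
            · rcases lt_or_ge s (2 * |‖x‖ - t|) with h2 | h2
              · exact Or.inl (Or.inr ⟨hs.1, h2, h4⟩)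
              · exact Or.inl (Or.inl ⟨hs.1, h2, h4⟩)
            · exact Or.inr ⟨hs.1, hs.2, h4⟩
        _ ≤ _ := by
            rw [mul_add, mul_add]
            refine add_add_le_of_le ?_ ?_ ?_ <;> rw [← hpull]
            · exact le_iSup_of_le 0 (le_iSup₂ (f := fun t (_ : t ∈ E) =>
                ∫⁻ s in {s : ℝ | |‖x‖ - t| < s ∧ 2 * |‖x‖ - t| ≤ s ∧ s < t / 4},
                  ENNReal.ofReal (radialKernel k ‖x‖ t s) * F' s) t htE)
            · exact le_iSup_of_le 1 (le_iSup₂ (f := fun t (_ : t ∈ E) =>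
                ∫⁻ s in {s : ℝ | |‖x‖ - t| < s ∧ s < 2 * |‖x‖ - t| ∧ s < t / 4},
                  ENNReal.ofReal (radialKernel k ‖x‖ t s) * F' s) t htE)
            · refine le_iSup_of_le 2 (le_trans ?_ (le_iSup₂ (f := fun t (_ : t ∈ E) =>
                ⨆ _ : ‖x‖ ≤ 8 * t, ∫⁻ s in {s : ℝ | |‖x‖ - t| < s ∧ s < ‖x‖ + t ∧ t / 4 ≤ s},
                  ENNReal.ofReal (radialKernel k ‖x‖ t s) * F' s) t htE))
              rw [iSup_pos hxt]
    · refine le_iSup_of_le 3 (le_trans ?_ (le_iSup₂ (f := fun t (_ : t ∈ E) =>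
        ⨆ _ : 8 * t < ‖x‖, ∫⁻ s in Ioo |‖x‖ - t| (‖x‖ + t),
          ENNReal.ofReal (radialKernel k ‖x‖ t s) * F' s) t htE))
      rw [iSup_pos hxt, hpull]
      exact le_mul_of_one_le_left zero_le (by norm_num)
  have hnorm : profileIntegral k p F' =
      (3 * c) ^ p * (sphereArea k)⁻¹ * eLpNorm f (ENNReal.ofReal p) volume ^ p := by
    rw [hF', profileIntegral_const_mul k hp0 hc3, ← HFn, lintegral_radial k (hF.pow_const p),
      mul_assoc, ← mul_assoc (sphereArea k)⁻¹,
      ENNReal.inv_mul_cancel (sphereArea_ne_zero k) (sphereArea_ne_top k), one_mul]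
    rfl
  refine (levelIntegral_rpow_le_tsum volume hp0 hpq hpt).trans ?_
  rw [tsum_fintype, Fin.sum_univ_four, mul_assoc, ← hnorm, add_mul, add_mul, add_mul]
  exact add_le_add (add_le_add (add_le_add (H₁ F' hF'm) (H₂ F' hF'm)) (H₃ F' hF'm)) (H₄ F' hF'm)

/-! ### Sufficiency of the entropy condition, `p = 1` -/

theorem lintegral_measure_lt {X : Type*} [MeasurableSpace X] (μ : Measure X) [SFinite μ]
    {g : X → ℝ≥0∞} (hg : Measurable g) :
    ∫⁻ α in Ioi (0 : ℝ), μ {x | ENNReal.ofReal α < g x} = ∫⁻ x, g x ∂μ := by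
  have hm : MeasurableSet {z : ℝ × X | ENNReal.ofReal z.1 < g z.2} :=
    measurableSet_lt (by fun_prop) (by fun_prop)
  calc _ = ∫⁻ α in Ioi (0 : ℝ), ∫⁻ x, {z : ℝ × X | ENNReal.ofReal z.1 < g z.2}.indicator 1 (α, x) ∂μ := by
        refine lintegral_congr fun α => ?_
        rw [← lintegral_indicator_one (measurableSet_lt measurable_const hg)]
        rfl
    _ = ∫⁻ x, (∫⁻ α in Ioi (0 : ℝ), {z : ℝ × X | ENNReal.ofReal z.1 < g z.2}.indicator 1 (α, x)) ∂μ :=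
        lintegral_lintegral_swap (measurable_one.indicator hm).aemeasurable
    _ = _ := by
        refine lintegral_congr fun x => ?_
        have := lintegral_rpow_sub_one_lt one_pos (g x)
        simp only [sub_self, Real.rpow_zero, ENNReal.ofReal_one, ENNReal.rpow_one, div_one] at this
        exact this

/-- The embedding of `L^1` in `L^{1,q}`: bound `q - 1` of the factors `α μ {g > α}` by Chebyshev and
integrate the last one. -/
theorem levelIntegral_one_le {X : Type*} [MeasurableSpace X] (μ : Measure X) [SFinite μ] {q : ℝ}
    (hq : 1 ≤ q) {g : X → ℝ≥0∞} (hg : Measurable g) :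
    levelIntegral μ 1 q g ≤ (∫⁻ x, g x ∂μ) ^ q := by
  set I := ∫⁻ x, g x ∂μ with hI
  rcases eq_or_ne I ∞ with h | hIt
  · rw [h, ENNReal.top_rpow_of_pos (by linarith)]
    exact le_top
  have hsplit : ∀ y : ℝ≥0∞, y ^ q = y ^ (q - 1) * y := fun y => by
    conv_rhs => rw [← ENNReal.rpow_one y, ← ENNReal.rpow_mul, one_mul]
    rw [← ENNReal.rpow_add_of_nonneg _ _ (by linarith) zero_le_one, sub_add_cancel]
  calc levelIntegral μ 1 q g ≤ ∫⁻ α in Ioi (0 : ℝ), I ^ (q - 1) * μ {x | ENNReal.ofReal α < g x} := by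
        refine setLIntegral_mono' measurableSet_Ioi fun α (hα : 0 < α) => ?_
        rw [div_one, hsplit, ← mul_assoc, ← ENNReal.ofReal_rpow_of_pos hα,
          ← ENNReal.mul_rpow_of_nonneg _ _ (by linarith)]
        refine mul_le_mul' (ENNReal.rpow_le_rpow ?_ (by linarith)) le_rfl
        refine le_trans (mul_le_mul' le_rfl (measure_mono fun x hx => ?_))
          (mul_meas_ge_le_lintegral hg (ENNReal.ofReal α))
        rw [mem_ofPred_eq] at hx ⊢
        exact hx.le
    _ = I ^ (q - 1) * I := by
        rw [lintegral_const_mul' _ _ (ENNReal.rpow_ne_top_of_nonneg (by linarith) hIt),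
          lintegral_measure_lt μ hg]
    _ = I ^ q := (hsplit I).symm

theorem sphereMeasure_univ (k : ℕ) : sphereMeasure (k + 2) univ = 1 := by
  rw [sphereMeasure, Measure.smul_apply, smul_eq_mul]
  exact ENNReal.inv_mul_cancel (sphereArea_ne_zero k) (sphereArea_ne_top k)

theorem lintegral_sphere_mean_eq (k : ℕ) {F : ℝ → ℝ≥0∞} (hF : Measurable F) (t : ℝ) :
    ∫⁻ x : Euc k, (∫⁻ y, F ‖x - t • (y : Euc k)‖ ∂sphereMeasure (k + 2)) = ∫⁻ x : Euc k, F ‖x‖ := by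
  have : IsProbabilityMeasure (sphereMeasure (k + 2)) := ⟨sphereMeasure_univ k⟩
  have hm : Measurable (Function.uncurry fun (x : Euc k) (y : Metric.sphere (0 : Euc k) 1) =>
      F ‖x - t • (y : Euc k)‖) := hF.comp (by fun_prop)
  rw [lintegral_lintegral_swap hm.aemeasurable]
  have : ∀ y : Metric.sphere (0 : Euc k) 1, ∫⁻ x : Euc k, F ‖x - t • (y : Euc k)‖ =
      ∫⁻ x : Euc k, F ‖x‖ := fun y =>
    lintegral_sub_right_eq_self (fun x : Euc k => F ‖x‖) (t • (y : Euc k))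
  simp_rw [this]
  simp

/-- A covering interval of length `a` contains at most one point of an `a`-separated set. -/
theorem card_le_entropyNumber {S : Set ℝ} {u v a : ℝ} (hS : S ⊆ Icc u v) (ha : 0 < a)
    {T : Finset ℝ} (hT : (T : Set ℝ) ⊆ S) (hsep : ∀ s ∈ T, ∀ t ∈ T, s ≠ t → a < |s - t|) :
    T.card ≤ entropyNumber S a := by
  obtain ⟨s, hcard, hs⟩ := exists_cover_card_eq hS ha
  rw [← hcard]
  have hex : ∀ t ∈ T, ∃ c ∈ s, t ∈ Icc c (c + a) := fun t ht => by
    obtain ⟨c, hc, htc⟩ := mem_iUnion₂.1 (hs (hT ht))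
    exact ⟨c, hc, htc⟩
  choose! φ hφ1 hφ2 using hex
  refine Finset.card_le_card_of_injOn φ hφ1 fun x hx y hy hxy => ?_
  by_contra hne
  have h1 := hφ2 x hx
  have h2 := hφ2 y hy
  rw [← hxy] at h2
  refine absurd (hsep x hx y hy hne) (not_lt.2 (abs_le.2 ⟨?_, ?_⟩)) <;> linarith [h1.1, h1.2, h2.1, h2.2]

/-- For `p = 1` the weight is `1`. At a scale below all points and gaps of a finite `T ⊆ E`, the
entropy numbers count the points of `T`, and as `q ≥ 1` the series is at least their number; hence
`T` has at most `A` points. -/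
theorem EntropyBound.finite {k : ℕ} {q : ℝ} (hq : 1 ≤ q) {E : Set ℝ} (hE : E ⊆ Ioi 0) {A : ℝ≥0∞}
    (hA : A ≠ ∞) (h : EntropyBound k 1 q E A) : E.Finite := by
  classical
  by_contra hinf
  obtain ⟨n, hn⟩ := ENNReal.exists_nat_gt hA
  obtain ⟨T, hTE, hTn⟩ := Set.Infinite.exists_subset_card_eq hinf n
  have hlim : ∀ c : ℝ, 0 < c → ∀ᶠ N : ℕ in Filter.atTop, ((2 : ℝ) ^ (-(N : ℤ))) < c := by
    intro c hc
    have := (tendsto_pow_atTop_nhds_zero_of_lt_one (by norm_num : (0 : ℝ) ≤ 1 / 2)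
      (by norm_num)).eventually_lt_const hc
    filter_upwards [this] with N hN
    simpa using hN
  obtain ⟨N, hN1, hN2⟩ : ∃ N : ℕ, (∀ t ∈ T, (2 : ℝ) ^ (-(N : ℤ)) < t) ∧
      ∀ s ∈ T, ∀ t ∈ T, s ≠ t → (2 : ℝ) ^ (-(N : ℤ)) < |s - t| := by
    refine Filter.Eventually.exists (f := Filter.atTop) (.and ?_ ?_)
    · exact (Filter.eventually_all_finset T).2 fun t ht => hlim t (hE (hTE ht))
    · refine (Filter.eventually_all_finset T).2 fun s _ => (Filter.eventually_all_finset T).2 fun t _ => ?_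
      rcases eq_or_ne s t with rfl | hst
      · simp
      · filter_upwards [hlim |s - t| (abs_pos.2 (sub_ne_zero.2 hst))] with N hN _ using hN
  set j : ℤ := -(N : ℤ)
  have h1 : ∀ t ∈ T, (1 : ℝ≥0∞) ≤ ∑' n : ℕ, if t ∈ dyadicPart E (j + n) then 1 else 0 := by
    intro t ht
    obtain ⟨m, hm1, hm2⟩ := exists_dyadic_scale (hE (hTE ht))
    have hjm : j < m + 1 :=
      (zpow_lt_zpow_iff_right₀ (one_lt_two : (1 : ℝ) < 2)).1 ((hN1 t ht).trans hm2)
    refine le_trans ?_ (ENNReal.le_tsum (m - j).toNat)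
    rw [Int.toNat_of_nonneg (by omega), add_sub_cancel, if_pos (mem_dyadicPart (hTE ht) hm1 hm2)]
  have h2 : (T.card : ℝ≥0∞) ≤ A := by
    calc (T.card : ℝ≥0∞) = ∑ t ∈ T, 1 := by simp
      _ ≤ ∑ t ∈ T, ∑' n : ℕ, if t ∈ dyadicPart E (j + n) then 1 else 0 := Finset.sum_le_sum h1
      _ = ∑' n : ℕ, ∑ t ∈ T, if t ∈ dyadicPart E (j + n) then 1 else 0 :=
          (Summable.tsum_finsetSum fun _ _ => ENNReal.summable).symm
      _ ≤ _ := by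
          refine le_trans (ENNReal.tsum_le_tsum fun n => ?_) (h j)
          have hc := card_le_entropyNumber (dyadicPart_subset E (j + n))
            (by positivity : (0 : ℝ) < 2 ^ j) (T := T.filter (· ∈ dyadicPart E (j + n)))
            (fun t ht => (Finset.mem_filter.1 (Finset.mem_coe.1 ht)).2)
            fun s hs t ht => hN2 s (Finset.mem_filter.1 hs).1 t (Finset.mem_filter.1 ht).1
          rw [Finset.sum_boole, div_one, div_one, sub_self, mul_zero, neg_zero, twoPow_zero, mul_one]
          set M := entropyNumber (dyadicPart E (j + n)) (2 ^ j)
          rcases Nat.eq_zero_or_pos M with h0 | h0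
          · rw [Nat.le_zero.1 (hc.trans h0.le)]
            simp
          · calc _ ≤ (M : ℝ≥0∞) := by exact_mod_cast hc
              _ = (M : ℝ≥0∞) ^ (1 : ℝ) := by simp
              _ ≤ _ := ENNReal.rpow_le_rpow_of_exponent_le (by exact_mod_cast h0) hq
  rw [hTn] at h2
  exact absurd hn (not_lt.2 h2)

/-- A supremum of finitely many averages, each preserving the integral of the profile; the constant
is the number of points of `E`. -/
theorem exists_levelIntegral_maximalFunction_one_le {k : ℕ} {q : ℝ} (hq : 1 ≤ q) {E : Set ℝ}
    (hE : E ⊆ Ioi 0) {A : ℝ≥0∞} (hA : A ≠ ∞) (h : EntropyBound k 1 q E A) :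
    ∃ C : ℝ≥0∞, C ≠ ∞ ∧ ∀ f : Euc k → ℂ, IsRadial f → MemLp f (ENNReal.ofReal 1) volume →
      levelIntegral volume 1 q (maximalFunction E f) ^ (1 / q) ≤
        C * eLpNorm f (ENNReal.ofReal 1) volume ^ (1 : ℝ) := by
  have hfin := h.finite hq hE hA
  have : Fintype E := hfin.fintype
  refine ⟨Fintype.card E, by simp, fun f hrad hf => ?_⟩
  obtain ⟨F, hF, HF, HFn⟩ := exists_profile one_pos hrad hf.1
  have hpt : ∀ᵐ x : Euc k, maximalFunction E f x ≤
      ⨆ t : E, ∫⁻ y, F ‖x - (t : ℝ) • (y : Euc k)‖ ∂sphereMeasure (k + 2) := by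
    filter_upwards [ae_norm_pos k] with x hx
    refine iSup₂_le fun t htE => ?_
    exact (HF x (norm_pos_iff.1 hx) t (hE htE)).trans
      (le_iSup (fun t : E => ∫⁻ y, F ‖x - (t : ℝ) • (y : Euc k)‖ ∂sphereMeasure (k + 2)) ⟨t, htE⟩)
  refine (levelIntegral_rpow_le_tsum volume one_pos hq hpt).trans ?_
  have hp : IsProbabilityMeasure (sphereMeasure (k + 2)) := ⟨sphereMeasure_univ k⟩
  have hterm : ∀ t : E, levelIntegral volume 1 q (fun x : Euc k =>
      ∫⁻ y, F ‖x - (t : ℝ) • (y : Euc k)‖ ∂sphereMeasure (k + 2)) ^ (1 / q) ≤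
      eLpNorm f (ENNReal.ofReal 1) volume ^ (1 : ℝ) := by
    intro t
    have hm : Measurable fun x : Euc k =>
        ∫⁻ y, F ‖x - (t : ℝ) • (y : Euc k)‖ ∂sphereMeasure (k + 2) :=
      Measurable.lintegral_prod_right' (f := fun z : Euc k × Metric.sphere (0 : Euc k) 1 =>
        F ‖z.1 - (t : ℝ) • (z.2 : Euc k)‖) (hF.comp (by fun_prop))
    refine (ENNReal.rpow_le_rpow (levelIntegral_one_le volume hq hm) (by positivity)).trans ?_
    rw [← ENNReal.rpow_mul, mul_one_div_cancel (by linarith), ENNReal.rpow_one,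
      lintegral_sphere_mean_eq k hF, ← HFn]
    simp
  rw [tsum_fintype]
  refine (Finset.sum_le_sum fun t _ => hterm t).trans (le_of_eq ?_)
  rw [Finset.sum_const, Finset.card_univ, nsmul_eq_mul]

/-- The entropy condition implies the maximal inequality. -/
theorem exists_lorentzNorm_maximalFunction_le {k : ℕ} {p q : ℝ} (hp : 1 ≤ p)
    (hpd : p * (k + 1) < k + 2) (hpq : p ≤ q) {E : Set ℝ} (hE : E ⊆ Ioi 0) {A : ℝ≥0∞}
    (hA : A ≠ ∞) (h : EntropyBound k p q E A) :
    ∃ C : ℝ≥0, ∀ f : Euc k → ℂ, IsRadial f → MemLp f (ENNReal.ofReal p) volume →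
      lorentzNorm volume p q (maximalFunction E f) ≤ C * eLpNorm f (ENNReal.ofReal p) volume := by
  have hp0 : 0 < p := by linarith
  have hq0 : 0 < q := by linarith
  obtain ⟨C, hC, H⟩ : ∃ C : ℝ≥0∞, C ≠ ∞ ∧ ∀ f : Euc k → ℂ, IsRadial f →
      MemLp f (ENNReal.ofReal p) volume →
      levelIntegral volume p q (maximalFunction E f) ^ (p / q) ≤
        C * eLpNorm f (ENNReal.ofReal p) volume ^ p := by
    rcases hp.eq_or_lt with rfl | hp1
    · exact exists_levelIntegral_maximalFunction_one_le hpq hE hA h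
    · exact exists_levelIntegral_maximalFunction_le hp1 hpd hpq hE hA h
  set D := ENNReal.ofReal q ^ (1 / q) * C ^ (1 / p) with hD
  have hDt : D ≠ ∞ := ENNReal.mul_ne_top
    (ENNReal.rpow_ne_top_of_nonneg (by positivity) ENNReal.ofReal_ne_top)
    (ENNReal.rpow_ne_top_of_nonneg (by positivity) hC)
  refine ⟨D.toNNReal, fun f hrad hf => ?_⟩
  rw [ENNReal.coe_toNNReal hDt, lorentzNorm_eq volume hp0 hq0,
    ENNReal.mul_rpow_of_nonneg _ _ (by positivity), hD, mul_assoc]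
  refine mul_le_mul' le_rfl ?_
  have h1 := ENNReal.rpow_le_rpow (H f hrad hf) (by positivity : 0 ≤ 1 / p)
  rwa [← ENNReal.rpow_mul, ENNReal.mul_rpow_of_nonneg _ _ (by positivity), ← ENNReal.rpow_mul,
    show p / q * (1 / p) = 1 / q by field_simp, mul_one_div_cancel hp0.ne', ENNReal.rpow_one] at h1

/-! ### Necessity of the entropy condition -/

/-- Restrict `α` to the disjoint intervals between `γ (n+1)` and `γ n`. The halving condition makes
each at least as long as its left endpoint, and `g > α` on `S n` there. -/
theorem tsum_le_levelIntegral {X : Type*} [MeasurableSpace X] (μ : Measure X) {p q : ℝ}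
    (hp : 0 < p) (hq : 1 ≤ q) {γ : ℕ → ℝ} (hγ0 : ∀ n, 0 < γ n) (hγ : ∀ n, 2 * γ (n + 1) ≤ γ n)
    {S : ℕ → Set X} {g : X → ℝ≥0∞} (h : ∀ n, ∀ x ∈ S n, ENNReal.ofReal (γ n) ≤ g x) :
    ∑' n, ENNReal.ofReal (γ (n + 1)) ^ q * μ (S n) ^ (q / p) ≤ levelIntegral μ p q g := by
  have hanti : Antitone γ := antitone_nat_of_succ_le fun n => by linarith [hγ n, hγ0 (n + 1)]
  have hdisj : Pairwise (Function.onFun Disjoint fun n : ℕ => Ioo (γ (n + 1)) (γ n)) :=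
    hanti.pairwise_disjoint_on_Ioo_succ
  have hsub : (⋃ n, Ioo (γ (n + 1)) (γ n)) ⊆ Ioi 0 :=
    iUnion_subset fun n α hα => (hγ0 (n + 1)).trans hα.1
  refine le_trans ?_ (lintegral_mono_set hsub)
  rw [lintegral_iUnion (fun n => measurableSet_Ioo) hdisj]
  refine ENNReal.tsum_le_tsum fun n => ?_
  have h0 := hγ0 (n + 1)
  calc ENNReal.ofReal (γ (n + 1)) ^ q * μ (S n) ^ (q / p)
      ≤ ∫⁻ _ in Ioo (γ (n + 1)) (γ n), ENNReal.ofReal (γ (n + 1) ^ (q - 1)) * μ (S n) ^ (q / p) := by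
        rw [setLIntegral_const, Real.volume_Ioo, mul_right_comm]
        refine mul_le_mul' ?_ le_rfl
        rw [← ENNReal.ofReal_mul (by positivity), ENNReal.ofReal_rpow_of_pos h0]
        refine ENNReal.ofReal_le_ofReal ?_
        calc γ (n + 1) ^ q = γ (n + 1) ^ (q - 1) * γ (n + 1) := by
              rw [← Real.rpow_add_one h0.ne', sub_add_cancel]
          _ ≤ _ := by
              gcongr
              linarith [hγ n]
    _ ≤ _ := by
        refine setLIntegral_mono' measurableSet_Ioo fun α hα => mul_le_mul' ?_ ?_
        · exact ENNReal.ofReal_le_ofReal (Real.rpow_le_rpow h0.le hα.1.le (by linarith))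
        · refine ENNReal.rpow_le_rpow (measure_mono fun x hx => ?_) (by positivity)
          rw [mem_ofPred_eq]
          exact lt_of_lt_of_le ((ENNReal.ofReal_lt_ofReal_iff (hγ0 n)).2 hα.2) (h n x hx)

theorem entropyNumber_le_card_dyadic {S : Set ℝ} {u v : ℝ} (hS : S ⊆ Icc u v) (j : ℤ) :
    ∃ T : Finset ℤ, entropyNumber S (2 ^ j) ≤ T.card ∧ ∀ a ∈ T, (dyadicInterval j a ∩ S).Nonempty := by
  classical
  have hj : (0 : ℝ) < 2 ^ j := by positivity
  set T := (Finset.Icc ⌊u / 2 ^ j⌋ ⌊v / 2 ^ j⌋).filter fun a => (dyadicInterval j a ∩ S).Nonempty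
  refine ⟨T, ?_, fun a ha => (Finset.mem_filter.1 ha).2⟩
  refine (entropyNumber_le (s := T.image fun a : ℤ => (a : ℝ) * 2 ^ j) fun x hx => ?_).trans
    Finset.card_image_le
  have hmem : x ∈ dyadicInterval j ⌊x / 2 ^ j⌋ := mem_dyadicInterval.2 rfl
  refine mem_biUnion (x := (⌊x / 2 ^ j⌋ : ℝ) * 2 ^ j) ?_ ⟨hmem.1, by linarith [hmem.2]⟩
  rw [Finset.mem_coe, Finset.mem_image]
  refine ⟨⌊x / 2 ^ j⌋, Finset.mem_filter.2 ⟨Finset.mem_Icc.2 ⟨?_, ?_⟩, x, hmem, hx⟩, rfl⟩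
  · exact Int.floor_le_floor (by gcongr; exact (hS hx).1)
  · exact Int.floor_le_floor (by gcongr; exact (hS hx).2)

/-- Every dyadic interval of length `2^j` meeting `E^{j+n}` consists of admissible radii, and there
are at least as many as the entropy number. None drops below `2^{j+n}`, itself a dyadic endpoint, so
the radial density is at least `2^{(j+n)(k+1)}` on all of them. -/
theorem le_volume_near_dyadicPart (k : ℕ) (E : Set ℝ) (j : ℤ) (n : ℕ) :
    sphereArea k * (twoPow ((j + n) * (k + 1)) *
      (entropyNumber (dyadicPart E (j + n)) (2 ^ j) * twoPow j)) ≤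
    volume {x : Euc k | ∃ t ∈ dyadicPart E (j + n), |‖x‖ - t| ≤ 2 ^ j} := by
  obtain ⟨T, hT1, hT2⟩ := entropyNumber_le_card_dyadic (dyadicPart_subset E (j + n)) j
  have hj : (0 : ℝ) < 2 ^ j := by positivity
  set U := ⋃ a ∈ T, dyadicInterval j a with hU
  have hUm : MeasurableSet U := Finset.measurableSet_biUnion T fun a _ =>
    measurableSet_dyadicInterval j a
  have hUlow : ∀ s ∈ U, (2 : ℝ) ^ (j + n) ≤ s := by
    intro s hs
    obtain ⟨a, ha, hsa⟩ := mem_iUnion₂.1 hs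
    obtain ⟨t, ht1, ht2⟩ := hT2 a ha
    have h1 : (2 : ℝ) ^ (j + n) = ((2 ^ n : ℤ) : ℝ) * 2 ^ j := by
      rw [zpow_add₀ two_ne_zero]
      push_cast
      rw [zpow_natCast]
      ring
    have h2 : (2 ^ n : ℤ) < a + 1 := by
      have h3 := ht2.1.1.trans_lt ht1.2
      rw [h1] at h3
      have h4 := lt_of_mul_lt_mul_right h3 hj.le
      exact_mod_cast h4
    rw [h1]
    refine le_trans ?_ hsa.1
    have h5 : ((2 ^ n : ℤ) : ℝ) ≤ a := by exact_mod_cast Int.lt_add_one_iff.1 h2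
    exact mul_le_mul_of_nonneg_right h5 hj.le
  have hUvol : volume U = T.card * twoPow j := by
    rw [hU, measure_biUnion_finset (fun a _ b _ hab => pairwise_disjoint_dyadicInterval j hab)
      fun a _ => measurableSet_dyadicInterval j a]
    simp [volume_dyadicInterval]
  calc _ ≤ sphereArea k * ∫⁻ s in Ioi (0 : ℝ), ENNReal.ofReal (s ^ (k + 1)) * U.indicator 1 s := by
        refine mul_le_mul' le_rfl ?_
        calc _ ≤ twoPow ((j + n) * (k + 1)) * volume U := by
              rw [hUvol]
              refine mul_le_mul' le_rfl (mul_le_mul' ?_ le_rfl)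
              exact_mod_cast hT1
          _ = ∫⁻ s in U, twoPow ((j + n) * (k + 1)) := by rw [setLIntegral_const]
          _ ≤ ∫⁻ s in U, ENNReal.ofReal (s ^ (k + 1)) * U.indicator 1 s := by
              refine setLIntegral_mono' hUm fun s hs => ?_
              rw [indicator_of_mem hs, Pi.one_apply, mul_one]
              have e := ofReal_zpow_pow (j + n) (k + 1)
              push_cast at e
              rw [← e]
              exact ENNReal.ofReal_le_ofReal (pow_le_pow_left₀ (by positivity) (hUlow s hs) _)
          _ ≤ _ := lintegral_mono_set fun s hs => lt_of_lt_of_le (by positivity) (hUlow s hs)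
    _ = ∫⁻ x : Euc k, U.indicator 1 ‖x‖ := (lintegral_radial k (measurable_one.indicator hUm)).symm
    _ = volume ((fun x : Euc k => ‖x‖) ⁻¹' U) := by
        rw [← lintegral_indicator_one (measurable_norm hUm)]
        rfl
    _ ≤ _ := by
        refine measure_mono fun x hx => ?_
        obtain ⟨a, ha, hxa⟩ := mem_iUnion₂.1 hx
        obtain ⟨t, ht1, ht2⟩ := hT2 a ha
        refine ⟨t, ht2, abs_le.2 ⟨?_, ?_⟩⟩ <;> linarith [hxa.1, hxa.2, ht1.1, ht1.2]

/-- The indicator function of the ball of radius `R`. -/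
noncomputable def ballIndicator (k : ℕ) (R : ℝ) : Euc k → ℂ :=
  (Metric.ball (0 : Euc k) R).indicator 1

theorem isRadial_ballIndicator (k : ℕ) (R : ℝ) : IsRadial (ballIndicator k R) := by
  intro x y hxy
  simp [ballIndicator, indicator, hxy]

theorem measurable_ballIndicator (k : ℕ) (R : ℝ) : Measurable (ballIndicator k R) :=
  measurable_one.indicator measurableSet_ball

theorem absSphericalMean_ballIndicator (k : ℕ) (R t : ℝ) (x : Euc k) :
    absSphericalMean t (ballIndicator k R) x =
      ∫⁻ y, (Iio R).indicator 1 ‖x - t • (y : Euc k)‖ ∂sphereMeasure (k + 2) := by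
  have hp : IsProbabilityMeasure (sphereMeasure (k + 2)) := ⟨sphereMeasure_univ k⟩
  set B : Set (Metric.sphere (0 : Euc k) 1) := {y | ‖x - t • (y : Euc k)‖ < R} with hB
  have hBm : MeasurableSet B := measurableSet_lt (by fun_prop) measurable_const
  have e : (fun y : Metric.sphere (0 : Euc k) 1 => ballIndicator k R (x - t • (y : Euc k))) =
      B.indicator 1 := by
    ext y
    simp [ballIndicator, indicator, hB]
  have hintg : Integrable (B.indicator (1 : Metric.sphere (0 : Euc k) 1 → ℂ)) (sphereMeasure (k + 2)) :=
    (integrable_const (1 : ℂ)).indicator hBm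
  have hval : ∫ y, B.indicator (1 : Metric.sphere (0 : Euc k) 1 → ℂ) y ∂sphereMeasure (k + 2) =
      ((sphereMeasure (k + 2)).real B : ℂ) := by
    rw [integral_indicator hBm]
    simp
  rw [absSphericalMean, sphericalMean, e, if_pos hintg, hval]
  have e2 : (fun y : Metric.sphere (0 : Euc k) 1 => (Iio R).indicator (1 : ℝ → ℝ≥0∞)
      ‖x - t • (y : Euc k)‖) = B.indicator 1 := rfl
  rw [e2, lintegral_indicator_one hBm]
  rw [← ofReal_norm, Complex.norm_of_nonneg measureReal_nonneg, measureReal_def,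
    ENNReal.ofReal_toReal (measure_ne_top _ _)]

/-- Angles between `b/2` and `b = h/t` already suffice: the squared distance to the origin is at
most `(r-t)^2 + r t θ^2 ≤ 3h^2 < (3h)^2`, and these angles carry measure about `b^{k+1}`. -/
theorem exists_le_absSphericalMean_ballIndicator (k : ℕ) : ∃ c : ℝ, 0 < c ∧
    ∀ {h t : ℝ} {x : Euc k}, 0 < h → h ≤ t → |‖x‖ - t| ≤ h →
      ENNReal.ofReal (c * (h / t) ^ (k + 1)) ≤
        absSphericalMean t (ballIndicator k (3 * h)) x := by
  obtain ⟨c, hc0, hct, Hc⟩ := lintegral_sphere_norm_sub k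
  have hc : 0 < c.toReal := ENNReal.toReal_pos hc0 hct
  refine ⟨c.toReal / 4 ^ (k + 1), by positivity, fun {h t x} hh ht hx => ?_⟩
  have ht0 : 0 < t := hh.trans_le ht
  set b := h / t with hb
  have hb0 : 0 < b := by positivity
  have hb1 : b ≤ 1 := (div_le_one ht0).2 ht
  have hπ := Real.pi_gt_three
  clear_value b
  rw [absSphericalMean_ballIndicator, Hc _ (measurable_one.indicator measurableSet_Iio)]
  rw [abs_le] at hx
  calc ENNReal.ofReal (c.toReal / 4 ^ (k + 1) * b ^ (k + 1))
      ≤ c * ENNReal.ofReal ((b / 4) ^ k * (b / 2)) := by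
        rw [← ENNReal.ofReal_toReal hct, ENNReal.toReal_ofReal hc.le, ← ENNReal.ofReal_mul hc.le]
        refine ENNReal.ofReal_le_ofReal ?_
        calc c.toReal / 4 ^ (k + 1) * b ^ (k + 1) = c.toReal * ((b / 4) ^ k * (b / 4)) := by
              rw [← pow_succ, div_pow]
              ring
          _ ≤ _ := by gcongr; norm_num
    _ = c * ∫⁻ θ in Ioo (b / 2) b, ENNReal.ofReal ((b / 4) ^ k) := by
        rw [setLIntegral_const, Real.volume_Ioo, ← ENNReal.ofReal_mul (by positivity)]
        congr 3
        ring
    _ ≤ c * ∫⁻ θ in Ioo (b / 2) b, ENNReal.ofReal (Real.sin θ ^ k) * (Iio (3 * h)).indicator 1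
          (√(‖x‖ ^ 2 + t ^ 2 - 2 * ‖x‖ * t * Real.cos θ)) := by
        refine mul_le_mul' le_rfl (setLIntegral_mono' measurableSet_Ioo fun θ hθ => ?_)
        have hθ0 : 0 < θ := (half_pos hb0).trans hθ.1
        have hmem : √(‖x‖ ^ 2 + t ^ 2 - 2 * ‖x‖ * t * Real.cos θ) ∈ Iio (3 * h) := by
          rw [mem_Iio, Real.sqrt_lt' (by positivity)]
          have hcos := Real.one_sub_sq_div_two_le_cos (x := θ)
          have hθt : θ * t ≤ h := by
            have := hθ.2.le
            rw [hb, le_div_iff₀ ht0] at this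
            exact this
          have h1 : ‖x‖ * t * (1 - θ ^ 2 / 2) ≤ ‖x‖ * t * Real.cos θ :=
            mul_le_mul_of_nonneg_left hcos (by positivity)
          have h2 : ‖x‖ * t * θ ^ 2 ≤ 2 * h ^ 2 := by
            calc ‖x‖ * t * θ ^ 2 ≤ (2 * t) * t * θ ^ 2 := by gcongr; linarith
              _ = 2 * (θ * t) ^ 2 := by ring
              _ ≤ _ := by gcongr
          have h3 : (‖x‖ - t) ^ 2 ≤ h ^ 2 := sq_le_sq' (by linarith) (by linarith)
          nlinarith [sq_pos_of_pos hh]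
        rw [indicator_of_mem hmem, Pi.one_apply, mul_one]
        refine ENNReal.ofReal_le_ofReal (pow_le_pow_left₀ (by positivity) ?_ _)
        have hsin := Real.mul_le_sin hθ0.le (by linarith [hθ.2] : θ ≤ Real.pi / 2)
        refine le_trans ?_ hsin
        have h2π : 1 / 2 ≤ 2 / Real.pi := by
          rw [div_le_div_iff₀ (by norm_num) Real.pi_pos]
          linarith [Real.pi_le_four]
        calc b / 4 = 1 / 2 * (b / 2) := by ring
          _ ≤ 2 / Real.pi * θ := mul_le_mul h2π hθ.1.le (by positivity) (by positivity)
    _ ≤ _ := by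
        refine mul_le_mul' le_rfl (lintegral_mono_set fun θ hθ => ⟨?_, ?_⟩)
        · exact (half_pos hb0).trans hθ.1
        · linarith [hθ.2]

theorem eLpNorm_ballIndicator (k : ℕ) {p : ℝ} (hp : 0 < p) (R : ℝ) :
    eLpNorm (ballIndicator k R) (ENNReal.ofReal p) volume =
      volume (Metric.ball (0 : Euc k) R) ^ (1 / p) := by
  have h := eLpNorm_indicator_const (μ := (volume : Measure (Euc k))) (c := (1 : ℂ))
    (measurableSet_ball (x := (0 : Euc k)) (ε := R)) (p := ENNReal.ofReal p)
    (by simpa using hp) ENNReal.ofReal_ne_top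
  rw [ENNReal.toReal_ofReal hp.le] at h
  have e : ballIndicator k R = (Metric.ball (0 : Euc k) R).indicator fun _ => 1 := rfl
  rw [e, h, enorm_one, one_mul]

theorem volume_ball_zpow (k : ℕ) (j : ℤ) :
    volume (Metric.ball (0 : Euc k) (3 * 2 ^ j)) =
      twoPow (j * (k + 2)) * volume (Metric.ball (0 : Euc k) 3) := by
  rw [mul_comm (3 : ℝ), Measure.addHaar_ball_mul _ _ (by positivity)]
  congr 1
  have e := ofReal_zpow_pow j (k + 2)
  push_cast at e
  simpa using e

/-- The maximal inequality implies the entropy condition. -/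
theorem exists_entropyBound {k : ℕ} {p q : ℝ} (hp : 1 ≤ p) (hpq : p ≤ q) {E : Set ℝ} {C : ℝ≥0}
    (H : ∀ f : Euc k → ℂ, IsRadial f → MemLp f (ENNReal.ofReal p) volume →
      lorentzNorm volume p q (maximalFunction E f) ≤ C * eLpNorm f (ENNReal.ofReal p) volume) :
    ∃ A : ℝ≥0∞, A ≠ ∞ ∧ EntropyBound k p q E A := by
  have hp0 : 0 < p := by linarith
  have hq0 : 0 < q := by linarith
  have hs : 0 < q / p := by positivity
  obtain ⟨c, hc, Hc⟩ := exists_le_absSphericalMean_ballIndicator k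
  set V := volume (Metric.ball (0 : Euc k) 3) with hV
  have hVt : V ≠ ∞ := measure_ball_lt_top.ne
  set L := ENNReal.ofReal q * (ENNReal.ofReal c ^ q * twoPow (-(2 * (k + 1) * q)) *
    sphereArea k ^ (q / p)) with hL
  have hL0 : L ≠ 0 := by
    have h1 : ENNReal.ofReal c ^ q ≠ 0 := by simp [ENNReal.rpow_eq_zero_iff, hc, hq0.not_gt]
    have h2 : sphereArea k ^ (q / p) ≠ 0 := by
      simp [ENNReal.rpow_eq_zero_iff, sphereArea_ne_zero, sphereArea_ne_top]
    refine mul_ne_zero (by simpa using hq0) (mul_ne_zero (mul_ne_zero h1 (twoPow_ne_zero _)) h2)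
  refine ⟨L⁻¹ * ((C : ℝ≥0∞) ^ q * V ^ (q / p)), ?_, fun j => ?_⟩
  · refine ENNReal.mul_ne_top (ENNReal.inv_ne_top.2 hL0) (ENNReal.mul_ne_top ?_ ?_)
    · exact ENNReal.rpow_ne_top_of_nonneg hq0.le ENNReal.coe_ne_top
    · exact ENNReal.rpow_ne_top_of_nonneg hs.le hVt
  set f := ballIndicator k (3 * 2 ^ j) with hf
  have hj : (0 : ℝ) < 2 ^ j := by positivity
  have hnorm : eLpNorm f (ENNReal.ofReal p) volume = (twoPow (j * (k + 2)) * V) ^ (1 / p) := by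
    rw [hf, eLpNorm_ballIndicator k hp0, volume_ball_zpow]
  have hmem : MemLp f (ENNReal.ofReal p) volume := by
    refine ⟨(measurable_ballIndicator k _).aestronglyMeasurable, ?_⟩
    rw [hnorm]
    exact ENNReal.rpow_lt_top_of_nonneg (by positivity) (ENNReal.mul_ne_top (twoPow_ne_top _) hVt)
  have hup : ENNReal.ofReal q * levelIntegral volume p q (maximalFunction E f) ≤
      (C : ℝ≥0∞) ^ q * (twoPow (j * (k + 2)) * V) ^ (q / p) := by
    have h1 := H f (isRadial_ballIndicator k _) hmem
    rw [lorentzNorm_eq volume hp0 hq0, hnorm, one_div q, ENNReal.rpow_inv_le_iff hq0,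
      ENNReal.mul_rpow_of_nonneg _ _ hq0.le, ← ENNReal.rpow_mul, one_div_mul_eq_div] at h1
    exact h1
  set S : ℕ → Set (Euc k) := fun n => {x | ∃ t ∈ dyadicPart E (j + n), |‖x‖ - t| ≤ 2 ^ j} with hS
  -- The shift `n + 1` comes from `t ≤ 2^{j+n+1}` on `E^{j+n}`, which gives `2^j / t ≥ 2^{-(n+1)}`.
  set γ : ℕ → ℝ := fun n => c * ((1 / 2) ^ (n + 1)) ^ (k + 1) with hγ
  have hlow := tsum_le_levelIntegral (volume : Measure (Euc k)) (γ := γ) (S := S)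
    (g := maximalFunction E f) hp0 (hp.trans hpq) (fun n => by positivity)
    (fun n => by
      simp only [hγ]
      have h1 : ((1 / 2 : ℝ) ^ (n + 1 + 1)) ^ (k + 1) ≤
          1 / 2 * ((1 / 2) ^ (n + 1)) ^ (k + 1) := by
        rw [pow_succ (1 / 2 : ℝ) (n + 1), mul_pow, mul_comm]
        refine mul_le_mul_of_nonneg_right ?_ (by positivity)
        rw [pow_succ]
        exact mul_le_of_le_one_left (by norm_num) (pow_le_one₀ (by norm_num) (by norm_num))
      nlinarith)
    (fun n x hx => by
      obtain ⟨t, ht, hxt⟩ := hx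
      have ht1 : (2 : ℝ) ^ j ≤ t := (zpow_le_zpow_right₀ one_le_two (by omega)).trans ht.1.1
      have ht0 : 0 < t := hj.trans_le ht1
      refine le_trans ?_ (le_iSup₂_of_le t ht.2 (Hc hj ht1 hxt))
      refine ENNReal.ofReal_le_ofReal ?_
      simp only [hγ]
      have h2 : (1 / 2 : ℝ) ^ (n + 1) ≤ 2 ^ j / t := by
        rw [le_div_iff₀ ht0]
        calc (1 / 2 : ℝ) ^ (n + 1) * t ≤ (1 / 2 : ℝ) ^ (n + 1) * 2 ^ (j + n + 1) := by
              gcongr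
              exact ht.1.2
          _ = 2 ^ j := by
              rw [add_assoc, zpow_add₀ two_ne_zero, ← Nat.cast_succ, zpow_natCast, mul_left_comm,
                ← mul_pow]
              norm_num
      gcongr)
  have hterm : ∀ n : ℕ, ENNReal.ofReal c ^ q * twoPow (-(2 * (k + 1) * q)) *
      sphereArea k ^ (q / p) * twoPow (j * (k + 2) * (q / p)) *
      ((entropyNumber (dyadicPart E (j + n)) ((2 : ℝ) ^ j) : ℝ≥0∞) ^ (q / p) *
        twoPow (-(n * (k + 1) * q * (1 - 1 / p)))) ≤
      ENNReal.ofReal (γ (n + 1)) ^ q * volume (S n) ^ (q / p) := by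
    intro n
    set N := (entropyNumber (dyadicPart E (j + n)) ((2 : ℝ) ^ j) : ℝ≥0∞)
    have hγn : ENNReal.ofReal (γ (n + 1)) ^ q =
        ENNReal.ofReal c ^ q * twoPow (-((n + 2) * (k + 1) * q)) := by
      have h1 : ENNReal.ofReal (γ (n + 1)) = ENNReal.ofReal c * twoPow (-((n + 2) * (k + 1))) := by
        simp only [hγ]
        rw [ENNReal.ofReal_mul hc.le, twoPow_eq_ofReal]
        congr 2
        rw [← pow_mul, one_div, inv_pow, ← Real.rpow_natCast, ← Real.rpow_neg (by norm_num)]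
        congr 1
        push_cast
        ring
      rw [h1, ENNReal.mul_rpow_of_nonneg _ _ hq0.le, twoPow_rpow]
      ring_nf
    have hvol := ENNReal.rpow_le_rpow (le_volume_near_dyadicPart k E j n) hs.le
    rw [ENNReal.mul_rpow_of_nonneg (sphereArea k) _ hs.le,
      ENNReal.mul_rpow_of_nonneg (twoPow _) _ hs.le, ENNReal.mul_rpow_of_nonneg _ (twoPow _) hs.le,
      twoPow_rpow, twoPow_rpow] at hvol
    rw [hγn]
    refine le_trans (le_of_eq ?_) (mul_le_mul' le_rfl hvol)
    calc _ = ENNReal.ofReal c ^ q * sphereArea k ^ (q / p) * N ^ (q / p) *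
          (twoPow (-(2 * (k + 1) * q)) * twoPow (j * (k + 2) * (q / p)) *
            twoPow (-(n * (k + 1) * q * (1 - 1 / p)))) := by ring
      _ = ENNReal.ofReal c ^ q * sphereArea k ^ (q / p) * N ^ (q / p) *
          (twoPow (-((n + 2) * (k + 1) * q)) * twoPow ((j + n) * (k + 1) * (q / p)) *
            twoPow (j * (q / p))) := by
          rw [twoPow_mul, twoPow_mul, twoPow_mul, twoPow_mul]
          congr 2
          field_simp
          ring
      _ = _ := by ring
  have hsum := (ENNReal.tsum_le_tsum hterm).trans hlow
  rw [ENNReal.tsum_mul_left] at hsum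
  set Y := ∑' n : ℕ, (entropyNumber (dyadicPart E (j + n)) ((2 : ℝ) ^ j) : ℝ≥0∞) ^ (q / p) *
    twoPow (-(n * (k + 1) * q * (1 - 1 / p)))
  -- Both sides scale like the volume of a ball of radius `2^j` to the power `q/p`; cancelling this
  -- factor makes the bound uniform in `j`.
  have hfin : twoPow (j * (k + 2) * (q / p)) * (L * Y) ≤
      twoPow (j * (k + 2) * (q / p)) * ((C : ℝ≥0∞) ^ q * V ^ (q / p)) := by
    calc _ = ENNReal.ofReal q * (ENNReal.ofReal c ^ q * twoPow (-(2 * (k + 1) * q)) *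
          sphereArea k ^ (q / p) * twoPow (j * (k + 2) * (q / p)) * Y) := by rw [hL]; ring
      _ ≤ (C : ℝ≥0∞) ^ q * (twoPow (j * (k + 2)) * V) ^ (q / p) :=
          (mul_le_mul' le_rfl hsum).trans hup
      _ = _ := by
          rw [ENNReal.mul_rpow_of_nonneg _ _ hs.le, twoPow_rpow]
          ring
  have hLt : L ≠ ∞ := by
    have h1 : ENNReal.ofReal c ^ q ≠ ∞ :=
      ENNReal.rpow_ne_top_of_nonneg hq0.le ENNReal.ofReal_ne_top
    have h2 : sphereArea k ^ (q / p) ≠ ∞ :=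
      ENNReal.rpow_ne_top_of_nonneg hs.le (sphereArea_ne_top k)
    have h3 := twoPow_ne_top (-(2 * (k + 1) * q))
    rw [hL]
    finiteness
  have hfin' := (ENNReal.mul_le_mul_iff_right (twoPow_ne_zero _) (twoPow_ne_top _)).1 hfin
  calc Y = L⁻¹ * (L * Y) := by rw [← mul_assoc, ENNReal.inv_mul_cancel hL0 hLt, one_mul]
    _ ≤ _ := mul_le_mul' le_rfl hfin'

end SphericalMaximal

theorem theorem1p2 (E : Set ℝ) (hE : E ⊆ Set.Ioi 0) (d : ℕ) (hd : 2 ≤ d) (p q : ℝ)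
    (hp : 1 ≤ p) (hpd : p < (d : ℝ) / ((d : ℝ) - 1)) (hpq : p ≤ q) :
    (∃ C : ℝ≥0, ∀ f : EuclideanSpace ℝ (Fin d) → ℂ,
        SphericalMaximal.IsRadial f → MemLp f (ENNReal.ofReal p) volume →
        SphericalMaximal.lorentzNorm volume p q (SphericalMaximal.maximalFunction E f)
          ≤ C * eLpNorm f (ENNReal.ofReal p) volume) ↔
      SphericalMaximal.entropySup d p q E < ∞ := by
  obtain ⟨k, rfl⟩ : ∃ k, d = k + 2 := ⟨d - 2, by omega⟩
  have hp0 : 0 < p := by linarith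
  rw [SphericalMaximal.entropySup_lt_top_iff hp0 (hp0.trans_le hpq)]
  constructor
  · rintro ⟨C, H⟩
    exact SphericalMaximal.exists_entropyBound hp hpq H
  · rintro ⟨A, hA, h⟩
    refine SphericalMaximal.exists_lorentzNorm_maximalFunction_le hp ?_ hpq hE hA h
    push_cast at hpd
    rw [show (k : ℝ) + 2 - 1 = k + 1 by ring, lt_div_iff₀ (by positivity)] at hpd
    exact hpd
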